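/- Let $G=(V,E)$ be a finite connected simple undirected graph. For $S\subseteq V$ let $\delta(S)$ denote the cutset of the cut $(S,V\setminus S)$, that is, the set of edges of $G$ with one end in $S$ and the other in $V\setminus S$; the size of the cut is $|\delta(S)|$. The cut $(S,V\setminus S)$ is minimal if there is no $T\subseteq V$ with $\emptyset\neq\delta(T)\subsetneq\delta(S)$. \textsc{Maximum Minimal Cut} is the following decision problem: given $G$ and an integer $k\ge 0$, is there a minimal cut of $G$ of size at least $k$? Two adjacent vertices $u,v$ are true twins if $N[u]=N[v]$. A twin-cover of $G$ is a set $X\subseteq V$ such that every edge of $G$ has an end in $X$ or joins two true twins, and ${\rm tc}={\rm tc}(G)$ is the minimum size of a twin-cover of $G$. **Theorem.** \textsc{Maximum Minimal Cut} on connected graphs can be solved in time $O^*\!\left(2^{{\rm tc}}\,3^{2^{{\rm tc}}}\right)$. That is, there are a deterministic algorithm and constants $c,d\in\mathbb N$ such that, for every $n$, every connected graph $G$ with $n$ vertices and every integer $k\ge 0$, the algorithm, given the adjacency matrix of $G$ and $k$ (and not ${\rm tc}(G)$ or a twin-cover), halts after at most $c\,n^{d}\cdot 2^{{\rm tc}(G)}\,3^{2^{{\rm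 tc}(G)}}$ steps and answers correctly whether $G$ has a minimal cut of size at least $k$. Here an algorithm is a program of a random access machine with registers and arrays of natural numbers, in which each of the following is one step: setting a register to a constant, copying a register, adding or subtracting $1$ (with $0-1=0$), reading or writing an array entry, doing nothing, and comparing two registers for a branch or a loop. Initially one register holds $n$, one holds $k$, and one array holds the adjacency matrix of $G$; all other memory is $0$. -/

import Mathlib

/-! ### Cuts, minimal cuts and twin-covers -/

/-- The cutset `δ(S)` of the cut `(S, V ∖ S)`: the edges of `G` between `S` and `V ∖ S`. -/
def cutset {V : Type*} (G : SimpleGraph V) (S : Set V) : Set (Sym2 V) :=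
  {e | e ∈ G.edgeSet ∧ ∃ u ∈ S, ∃ v ∉ S, e = s(u, v)}

/-- The cut `(S, V ∖ S)` is minimal: no cutset of `G` is a non-empty proper subset of `δ(S)`. -/
def IsMinimalCut {V : Type*} (G : SimpleGraph V) (S : Set V) : Prop :=
  ¬ ∃ T : Set V, (cutset G T).Nonempty ∧ cutset G T ⊂ cutset G S

/-- The question of Maximum Minimal Cut on the instance `(G, k)`: is there a minimal cut of `G`
whose size, the number of edges in its cutset, is at least `k`? -/
def HasMinimalCut {V : Type*} (G : SimpleGraph V) (k : ℕ) : Prop :=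
  ∃ S : Set V, IsMinimalCut G S ∧ k ≤ (cutset G S).ncard

/-- `u` and `v` are true twins: they are adjacent and `N[u] = N[v]`. -/
def TrueTwins {V : Type*} (G : SimpleGraph V) (u v : V) : Prop :=
  G.Adj u v ∧ insert u (G.neighborSet u) = insert v (G.neighborSet v)

/-- `X` is a twin-cover of `G`: every edge has an end in `X` or joins true twins. -/
def IsTwinCover {V : Type*} (G : SimpleGraph V) (X : Set V) : Prop :=
  ∀ u v : V, G.Adj u v → u ∈ X ∨ v ∈ X ∨ TrueTwins G u v

/-- The twin-cover number `tc(G)` of a finite graph: the minimum size of a twin-cover. (The set of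
all vertices is a twin-cover.) -/
noncomputable def twinCoverNumber {V : Type*} [Finite V] (G : SimpleGraph V) : ℕ :=
  sInf {m | ∃ X : Set V, IsTwinCover G X ∧ X.ncard = m}

/-! ### A deterministic random access machine with a step count

Programs act on registers and on arrays of natural numbers, which are all named by natural numbers;
a program mentions only finitely many of them. The only arithmetic is `+ 1` and `- 1`, so
in `t` steps no number exceeds the largest one in the input and the program by more than `t`, and
charging one step per instruction does not hide work on long numbers. -/

/-- The memory: the contents of the registers, and `arr a i`, entry `i` of array `a`. -/
structure Memory where
  reg : ℕ → ℕ
  arr : ℕ → ℕ → ℕ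

/-- Set register `x` to `v`. -/
def Memory.setReg (s : Memory) (x v : ℕ) : Memory :=
  { s with reg := Function.update s.reg x v }

/-- Set entry `i` of array `a` to `v`. -/
def Memory.setArr (s : Memory) (a i v : ℕ) : Memory :=
  { s with arr := Function.update s.arr a (Function.update (s.arr a) i v) }

/-- Programs. Here `x`, `y` name registers, `a` names an array and `c` is a constant. -/
inductive Prog : Type
  /-- do nothing -/
  | skip : Prog
  /-- `x := c` -/
  | const (x c : ℕ) : Prog
  /-- `x := y` -/
  | copy (x y : ℕ) : Prog
  /-- `x := x + 1` -/
  | inc (x : ℕ) : Prog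
  /-- `x := max (x - 1) 0` -/
  | dec (x : ℕ) : Prog
  /-- `x := a[y]` -/
  | load (x a y : ℕ) : Prog
  /-- `a[x] := y` -/
  | store (a x y : ℕ) : Prog
  /-- first `p`, then `q` -/
  | seq (p q : Prog) : Prog
  /-- if `x < y` then `p` else `q` -/
  | ifLt (x y : ℕ) (p q : Prog) : Prog
  /-- while `x < y` do `p` -/
  | whileLt (x y : ℕ) (p : Prog) : Prog

/-- `Exec p s t s'`: the program `p`, started in memory `s`, halts after exactly `t` steps in
memory `s'`. Every elementary instruction and every evaluation of a test is one step. -/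
inductive Exec : Prog → Memory → ℕ → Memory → Prop
  | skip (s : Memory) : Exec Prog.skip s 1 s
  | const (s : Memory) (x c : ℕ) : Exec (Prog.const x c) s 1 (s.setReg x c)
  | copy (s : Memory) (x y : ℕ) : Exec (Prog.copy x y) s 1 (s.setReg x (s.reg y))
  | inc (s : Memory) (x : ℕ) : Exec (Prog.inc x) s 1 (s.setReg x (s.reg x + 1))
  | dec (s : Memory) (x : ℕ) : Exec (Prog.dec x) s 1 (s.setReg x (s.reg x - 1))
  | load (s : Memory) (x a y : ℕ) :
      Exec (Prog.load x a y) s 1 (s.setReg x (s.arr a (s.reg y)))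
  | store (s : Memory) (a x y : ℕ) :
      Exec (Prog.store a x y) s 1 (s.setArr a (s.reg x) (s.reg y))
  | seq {p q : Prog} {s s' s'' : Memory} {t t' : ℕ} :
      Exec p s t s' → Exec q s' t' s'' → Exec (Prog.seq p q) s (t + t') s''
  | ifTrue {x y : ℕ} {p q : Prog} {s s' : Memory} {t : ℕ} :
      s.reg x < s.reg y → Exec p s t s' → Exec (Prog.ifLt x y p q) s (t + 1) s'
  | ifFalse {x y : ℕ} {p q : Prog} {s s' : Memory} {t : ℕ} :
      ¬ s.reg x < s.reg y → Exec q s t s' → Exec (Prog.ifLt x y p q) s (t + 1) s'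
  | whileTrue {x y : ℕ} {p : Prog} {s s' s'' : Memory} {t t' : ℕ} :
      s.reg x < s.reg y → Exec p s t s' → Exec (Prog.whileLt x y p) s' t' s'' →
        Exec (Prog.whileLt x y p) s (t + t' + 1) s''
  | whileFalse {x y : ℕ} {p : Prog} {s : Memory} :
      ¬ s.reg x < s.reg y → Exec (Prog.whileLt x y p) s 1 s

open Classical in
/-- The input `(G, k)` for a graph `G` on `{0, …, n - 1}`: register `0` holds `n`, register `1`
holds `k`, array `0` holds the adjacency matrix of `G` row by row, and all else is `0`. -/
noncomputable def inputMemory {n : ℕ} (G : SimpleGraph (Fin n)) (k : ℕ) : Memory where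
  reg x := if x = 0 then n else if x = 1 then k else 0
  arr a m :=
    if a = 0 ∧ ∃ i j : Fin n, G.Adj i j ∧ m = (i : ℕ) * n + (j : ℕ) then 1 else 0

/-! In a connected graph a cut is minimal exactly when both of its sides are connected
(`IsMinimalCut.sidesConnected`, `SidesConnected.isMinimalCut`), so the size is to be maximized over
such cuts. Two vertices have the same type if they have the same non-twin neighbours; a type is a
disjoint union of cliques of twins with no edges between them. A twin-cover is a vertex cover of the
edges between non-twins, and a minimum one can be chosen as a union `X` of types
(`exists_twinCover`). A type outside `X` is determined by its neighbours, a subset of `X`, so there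
are at most 2^tc of these types.

Suppose both sides of a minimal cut meet `X`. Record its trace on `X` and, for each type outside
`X`, whether it lies in `S`, misses `S` or is split: at most 2^tc · 3^(2^tc) records. The record
alone decides whether the sides are connected (`SidesConnected.of_types`), and given the trace on
`X` the types contribute to the size independently. A clique of `c` twins, `j` of them in `S`,
contributes the concave quadratic `twinCut a b c j`, where `a` and `b` count the neighbours in `X`
on the two sides. A greedy rule maximizes it on every clique; if the rule leaves a split type
unsplit, the cheapest repair moves one vertex of a largest clique (`contrib_canonicalSet`). Hence
one canonical cut per record suffices. If a side misses `X`, it lies in one clique of twins, where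
only its cardinality matters, and initial segments of such cliques suffice (`exists_twinSegment`).

As tc is not given, a minimum twin-cover is found by enumerating all unions of types, which obeys
the same bound (`prod_isFirst_le`). Both enumerations are mixed radix counters (`St.enumerate`)
whose rounds take polynomial time; the notions `Fn`, `Pd` and `St` are closed under the
constructions that the rounds need. -/

/-! ### Polynomial bounds -/

/-- `T` is bounded by a polynomial on the positive numbers. -/
def PolyBdd (T : ℕ → ℕ) : Prop := ∃ c d, ∀ n, 0 < n → T n ≤ c * n ^ d

theorem PolyBdd.const (c : ℕ) : PolyBdd fun _ => c := ⟨c, 0, fun n _ => by simp⟩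

theorem PolyBdd.id : PolyBdd fun n => n := ⟨1, 1, fun n _ => by simp⟩

theorem PolyBdd.add {T U : ℕ → ℕ} (hT : PolyBdd T) (hU : PolyBdd U) :
    PolyBdd fun n => T n + U n := by
  obtain ⟨c, d, h⟩ := hT
  obtain ⟨c', d', h'⟩ := hU
  refine ⟨c + c', d + d', fun n hn => ?_⟩
  have h1 : n ^ d ≤ n ^ (d + d') := Nat.pow_le_pow_right hn (by omega)
  have h2 : n ^ d' ≤ n ^ (d + d') := Nat.pow_le_pow_right hn (by omega)
  calc T n + U n ≤ c * n ^ d + c' * n ^ d' := add_le_add (h n hn) (h' n hn)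
    _ ≤ c * n ^ (d + d') + c' * n ^ (d + d') := by gcongr
    _ = _ := by ring

theorem PolyBdd.mul {T U : ℕ → ℕ} (hT : PolyBdd T) (hU : PolyBdd U) :
    PolyBdd fun n => T n * U n := by
  obtain ⟨c, d, h⟩ := hT
  obtain ⟨c', d', h'⟩ := hU
  refine ⟨c * c', d + d', fun n hn => ?_⟩
  calc T n * U n ≤ (c * n ^ d) * (c' * n ^ d') := Nat.mul_le_mul (h n hn) (h' n hn)
    _ = _ := by ring

/-! ### Runs of programs -/

@[simp] theorem Memory.setReg_reg (s : Memory) (x v y : ℕ) :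
    (s.setReg x v).reg y = if y = x then v else s.reg y := by
  simp [Memory.setReg, Function.update_apply]

@[simp] theorem Memory.setReg_arr (s : Memory) (x v : ℕ) : (s.setReg x v).arr = s.arr := rfl

@[simp] theorem Memory.setArr_reg (s : Memory) (a i v : ℕ) : (s.setArr a i v).reg = s.reg := rfl

@[simp] theorem Memory.setArr_arr (s : Memory) (a i v b j : ℕ) :
    (s.setArr a i v).arr b j = if b = a ∧ j = i then v else s.arr b j := by
  simp only [Memory.setArr, Function.update_apply]
  split_ifs with h1 h2 <;> simp_all

/-- Started in `s`, the program `p` halts within `T` steps in a memory with property `Q`. -/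
def Run (p : Prog) (s : Memory) (T : ℕ) (Q : Memory → Prop) : Prop :=
  ∃ t s', Exec p s t s' ∧ t ≤ T ∧ Q s'

namespace Run

variable {p q : Prog} {s : Memory} {T U : ℕ} {Q R : Memory → Prop}

theorem mono (h : Run p s T Q) (hT : T ≤ U) (hQ : ∀ s', Q s' → R s') : Run p s U R := by
  obtain ⟨t, s', h1, h2, h3⟩ := h
  exact ⟨t, s', h1, h2.trans hT, hQ _ h3⟩

theorem seq (h : Run p s T Q) (h' : ∀ s', Q s' → Run q s' U R) :
    Run (.seq p q) s (T + U) R := by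
  obtain ⟨t, s', h1, h2, h3⟩ := h
  obtain ⟨t', s'', h1', h2', h3'⟩ := h' s' h3
  exact ⟨_, _, .seq h1 h1', add_le_add h2 h2', h3'⟩

theorem skip (h : Q s) : Run .skip s 1 Q := ⟨_, _, .skip s, le_rfl, h⟩

theorem const {x c : ℕ} (h : Q (s.setReg x c)) : Run (.const x c) s 1 Q :=
  ⟨_, _, .const s x c, le_rfl, h⟩

theorem copy {x y : ℕ} (h : Q (s.setReg x (s.reg y))) : Run (.copy x y) s 1 Q :=
  ⟨_, _, .copy s x y, le_rfl, h⟩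

theorem inc {x : ℕ} (h : Q (s.setReg x (s.reg x + 1))) : Run (.inc x) s 1 Q :=
  ⟨_, _, .inc s x, le_rfl, h⟩

theorem load {x a y : ℕ} (h : Q (s.setReg x (s.arr a (s.reg y)))) : Run (.load x a y) s 1 Q :=
  ⟨_, _, .load s x a y, le_rfl, h⟩

theorem store {a x y : ℕ} (h : Q (s.setArr a (s.reg x) (s.reg y))) : Run (.store a x y) s 1 Q :=
  ⟨_, _, .store s a x y, le_rfl, h⟩

theorem ifLt {x y : ℕ} (h : s.reg x < s.reg y → Run p s T Q)
    (h' : ¬ s.reg x < s.reg y → Run q s T Q) : Run (.ifLt x y p q) s (T + 1) Q := by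
  by_cases hc : s.reg x < s.reg y
  · obtain ⟨t, s', h1, h2, h3⟩ := h hc
    exact ⟨_, _, .ifTrue hc h1, by omega, h3⟩
  · obtain ⟨t, s', h1, h2, h3⟩ := h' hc
    exact ⟨_, _, .ifFalse hc h1, by omega, h3⟩

/-- A loop that goes round `N` times, with an invariant for the beginning of round `j`. -/
theorem loop {x y N : ℕ} (I : ℕ → Memory → Prop)
    (hI : ∀ j s, j ≤ N → I j s → (s.reg x < s.reg y ↔ j < N))
    (hstep : ∀ j s, j < N → I j s → Run p s T (I (j + 1))) (h0 : I 0 s) :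
    Run (.whileLt x y p) s (N * (T + 1) + 1) (I N) := by
  -- Induction on the number `m` of rounds still to go; the extra step pays for the final failing
  -- test.
  have key : ∀ m j s, j + m = N → I j s → Run (.whileLt x y p) s (m * (T + 1) + 1) (I N) := by
    intro m
    induction m with
    | zero =>
      intro j s hj h
      have : ¬ s.reg x < s.reg y := by rw [hI j s (by omega) h]; omega
      obtain rfl : j = N := by omega
      exact ⟨_, _, .whileFalse this, by omega, h⟩
    | succ m ih =>
      intro j s hj h
      have hc : s.reg x < s.reg y := by rw [hI j s (by omega) h]; omega
      obtain ⟨t, s', h1, h2, h3⟩ := hstep j s (by omega) h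
      obtain ⟨t', s'', h1', h2', h3'⟩ := ih (j + 1) s' (by omega) h3
      refine ⟨_, _, .whileTrue hc h1 h1', ?_, h3'⟩
      have : (m + 1) * (T + 1) = m * (T + 1) + (T + 1) := by ring
      omega
  exact key N 0 s (by omega) h0

end Run

/-! ### Functions and transformations computable in polynomial time

Registers `0`, …, `4` and arrays `0`, …, `5` make up the visible part of the memory. -/

/-- The visible parts of two memories agree. -/
def Agree (s s' : Memory) : Prop := (∀ x < 5, s'.reg x = s.reg x) ∧ ∀ a < 6, s'.arr a = s.arr a

theorem Agree.refl (s : Memory) : Agree s s := ⟨fun _ _ => rfl, fun _ _ => rfl⟩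

/-- A context: a memory with the values of finitely many variables, which are kept in the
registers `5`, …, `depth - 1`. -/
class Ctx (α : Type) where
  mem : α → Memory
  depth : ℕ
  rep : α → Memory → Prop
  le_depth : 5 ≤ depth
  agree : ∀ {a s}, rep a s → Agree (mem a) s
  congr : ∀ {a s s'}, rep a s → (∀ x < depth, s'.reg x = s.reg x) →
    (∀ b < 6, s'.arr b = s.arr b) → rep a s'

instance : Ctx Memory where
  mem s := s
  depth := 5
  rep := Agree
  le_depth := le_rfl
  agree h := h
  congr h h1 h2 := ⟨fun x hx => (h1 x hx).trans (h.1 x hx), fun b hb => (h2 b hb).trans (h.2 b hb)⟩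

/-- A bound variable takes the first register after those of the outer context, so nested
quantifiers become iterated products. -/
instance {α : Type} [Ctx α] : Ctx (α × ℕ) where
  mem a := Ctx.mem a.1
  depth := Ctx.depth α + 1
  rep a s := Ctx.rep a.1 s ∧ s.reg (Ctx.depth α) = a.2
  le_depth := Nat.le_succ_of_le Ctx.le_depth
  agree h := Ctx.agree h.1
  congr h h1 h2 := ⟨Ctx.congr h.1 (fun x hx => h1 x (by omega)) h2, (h1 _ (by omega)).trans h.2⟩

/-- The number of vertices. -/
def Ctx.size {α : Type} [Ctx α] (a : α) : ℕ := (Ctx.mem a).reg 0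

theorem Ctx.reg_zero {α : Type} [Ctx α] {a : α} {s : Memory} (h : Ctx.rep a s) :
    s.reg 0 = Ctx.size a := (Ctx.agree h).1 0 (by omega)

@[simp] theorem Ctx.size_prod {α : Type} [Ctx α] (a : α × ℕ) : Ctx.size a = Ctx.size a.1 := rfl

/-- `f` can be computed in polynomial time. -/
def Fn {α : Type} [Ctx α] (f : α → ℕ) : Prop :=
  ∃ T, PolyBdd T ∧ ∀ d, Ctx.depth α ≤ d → ∃ p, ∀ a s, Ctx.rep a s →
    Run p s (T (Ctx.size a)) fun s' =>
      s'.reg d = f a ∧ (∀ x < d, s'.reg x = s.reg x) ∧ s'.arr = s.arr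

open Classical in
/-- `P` can be decided in polynomial time. -/
def Pd {α : Type} [Ctx α] (P : α → Prop) : Prop := Fn fun a => if P a then 1 else 0

namespace Fn

variable {α : Type} [Ctx α] {f g : α → ℕ}

theorem congr (hf : Fn f) (h : ∀ a, f a = g a) : Fn g := funext h ▸ hf

theorem const (c : ℕ) : Fn fun _ : α => c :=
  ⟨_, .const 1, fun d _ => ⟨.const d c, fun a s _ => .const (by simp +contextual [ne_of_lt])⟩⟩

theorem reg {x : ℕ} (hx : x < 5) : Fn fun a : α => (Ctx.mem a).reg x :=
  ⟨_, .const 1, fun d _ => ⟨.copy d x, fun a s h =>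
    .copy (by simp +contextual [ne_of_lt, (Ctx.agree h).1 x hx])⟩⟩

theorem size : Fn fun a : α => Ctx.size a := reg (by omega)

theorem var : Fn fun a : α × ℕ => a.2 :=
  ⟨_, .const 1, fun d _ => ⟨.copy d (Ctx.depth α), fun a s h =>
    .copy (by simp +contextual [ne_of_lt, h.2])⟩⟩

theorem weaken (hf : Fn f) : Fn fun a : α × ℕ => f a.1 := by
  obtain ⟨T, hT, h⟩ := hf
  refine ⟨T, hT, fun d hd => ?_⟩
  obtain ⟨p, hp⟩ := h d (le_trans (Nat.le_succ _) hd)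
  exact ⟨p, fun a s ha => hp a.1 s ha.1⟩

theorem succ (hf : Fn f) : Fn fun a => f a + 1 := by
  obtain ⟨T, hT, h⟩ := hf
  refine ⟨_, hT.add (.const 1), fun d hd => ?_⟩
  obtain ⟨p, hp⟩ := h d hd
  refine ⟨.seq p (.inc d), fun a s ha => (hp a s ha).seq fun s1 ⟨h1, h2, h3⟩ => .inc ?_⟩
  simp +contextual [ne_of_lt, h1, h2, h3]

theorem arr {b : ℕ} (hb : b < 6) (hf : Fn f) : Fn fun a => (Ctx.mem a).arr b (f a) := by
  obtain ⟨T, hT, h⟩ := hf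
  refine ⟨_, hT.add (.const 1), fun d hd => ?_⟩
  obtain ⟨p, hp⟩ := h d hd
  refine ⟨.seq p (.load d b d), fun a s ha => (hp a s ha).seq fun s1 ⟨h1, h2, h3⟩ => .load ?_⟩
  simp +contextual [ne_of_lt, h1, h2, h3, (Ctx.agree ha).2 b hb]

/-- This makes composition possible: a subprogram with target `d` touches no array and only
registers from `d` on, so the next subprogram still finds its context. -/
theorem rep_of_keep {a : α} {s s' : Memory} {d : ℕ} (hd : Ctx.depth α ≤ d) (ha : Ctx.rep a s)
    (h : ∀ x < d, s'.reg x = s.reg x) (h' : s'.arr = s.arr) : Ctx.rep a s' :=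
  Ctx.congr ha (fun x hx => h x (hx.trans_le hd)) fun b _ => by rw [h']

theorem _root_.Pd.lt (hf : Fn f) (hg : Fn g) : Pd fun a => f a < g a := by
  obtain ⟨T, hT, h⟩ := hf
  obtain ⟨U, hU, h'⟩ := hg
  refine ⟨_, hT.add (hU.add (.const 2)), fun d hd => ?_⟩
  obtain ⟨p, hp⟩ := h d hd
  -- The second value is aimed one register higher, so that computing it leaves the first one in `d`
  -- intact.
  obtain ⟨q, hq⟩ := h' (d + 1) (by omega)
  refine ⟨.seq p (.seq q (.ifLt d (d + 1) (.const d 1) (.const d 0))), fun a s ha =>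
    (hp a s ha).seq fun s1 ⟨h1, h2, h3⟩ =>
    (hq a s1 (rep_of_keep hd ha h2 h3)).seq fun s2 ⟨h1', h2', h3'⟩ => ?_⟩
  have e1 : s2.reg d = f a := by rw [h2' d (by omega), h1]
  refine .ifLt (fun hc => .const ?_) (fun hc => .const ?_) <;> rw [e1, h1'] at hc <;>
    refine ⟨by simp [hc], fun x hx => ?_, by simp [h3, h3']⟩ <;>
    simp [hx.ne, h2' x (by omega), h2 x hx]

theorem ite {P : α → Prop} [DecidablePred P] (hP : Pd P) (hf : Fn f) (hg : Fn g) :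
    Fn fun a => if P a then f a else g a := by
  obtain ⟨T, hT, h⟩ := hf
  obtain ⟨U, hU, h'⟩ := hg
  obtain ⟨W, hW, hP⟩ := hP
  refine ⟨_, hW.add ((PolyBdd.const 1).add ((hT.add hU).add (.const 1))), fun d hd => ?_⟩
  obtain ⟨p, hp⟩ := h d hd
  obtain ⟨q, hq⟩ := h' d hd
  obtain ⟨r, hr⟩ := hP d hd
  -- The only test is `<`, so the indicator in `d` is compared with a `0` placed in `d + 1`.
  refine ⟨.seq r (.seq (.const (d + 1) 0) (.ifLt (d + 1) d p q)), fun a s ha =>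
    (hr a s ha).seq fun s1 ⟨h1, h2, h3⟩ =>
    (Run.const (Q := fun s' => s' = s1.setReg (d + 1) 0) rfl).seq fun s2 e => ?_⟩
  have k : ∀ x < d, s2.reg x = s.reg x := fun x hx => by
    rw [e, Memory.setReg_reg, if_neg (by omega), h2 x hx]
  have k' : s2.arr = s.arr := by rw [e, Memory.setReg_arr, h3]
  have ha' := rep_of_keep hd ha k k'
  have e0 : s2.reg (d + 1) = 0 := by simp [e]
  have e1 : s2.reg d = if P a then 1 else 0 := by
    rw [e, Memory.setReg_reg, if_neg (by omega), h1]; dsimp only; congr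
  refine .ifLt (fun hc => ?_) (fun hc => ?_) <;> rw [e0, e1] at hc
  · have hPa : P a := by by_contra hn; simp [hn] at hc
    refine (hp a s2 ha').mono (by omega) fun s' ⟨i1, i2, i3⟩ => ?_
    exact ⟨by simp [hPa, i1], fun x hx => by rw [i2 x hx, k x hx], by rw [i3, k']⟩
  · have hPa : ¬ P a := by intro hn; simp [hn] at hc
    refine (hq a s2 ha').mono (by omega) fun s' ⟨i1, i2, i3⟩ => ?_
    exact ⟨by simp [hPa, i1], fun x hx => by rw [i2 x hx, k x hx], by rw [i3, k']⟩

/-- Addition is repeated increment, so each summand costs time proportional to its value; hence the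
polynomial bound on the values. -/
theorem sum {f : α × ℕ → ℕ} (hf : Fn f) {B : ℕ → ℕ} (hB : PolyBdd B)
    (hfB : ∀ a, f a ≤ B (Ctx.size a)) :
    Fn fun a : α => ∑ i ∈ Finset.range (Ctx.size a), f (a, i) := by
  obtain ⟨T, hT, h⟩ := hf
  refine ⟨fun n => 1 + (1 + (1 + (n * (1 + (T n + (1 + (B n * 3 + 1 + 1))) + 1) + 1 + 2))),
    (PolyBdd.const 1).add ((PolyBdd.const 1).add ((PolyBdd.const 1).add
      (((PolyBdd.id.mul (((PolyBdd.const 1).add (hT.add ((PolyBdd.const 1).add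
        (((hB.mul (.const 3)).add (.const 1)).add (.const 1))))).add (.const 1))).add
          (.const 1)).add (.const 2)))), fun d hd => ?_⟩
  obtain ⟨p, hp⟩ := h (d + 4) (by change Ctx.depth α + 1 ≤ _; omega)
  set v := Ctx.depth α with hv
  have hv5 : 5 ≤ v := Ctx.le_depth
  -- The summation variable must occupy `v`, which may lie below `d`, so the old content of `v` is
  -- saved in `d + 1` and restored at the end. The others are the sum `d + 2`, the index `d + 3`,
  -- the summand `d + 4` and the counter of the inner loop `d + 5`.
  refine ⟨.seq (.copy (d + 1) v) (.seq (.const (d + 2) 0) (.seq (.const (d + 3) 0)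
    (.seq (.whileLt (d + 3) 0 (.seq (.copy v (d + 3)) (.seq p (.seq (.const (d + 5) 0)
      (.seq (.whileLt (d + 5) (d + 4) (.seq (.inc (d + 2)) (.inc (d + 5)))) (.inc (d + 3)))))))
    (.seq (.copy v (d + 1)) (.copy d (d + 2)))))), fun a s ha => ?_⟩
  set n := Ctx.size a with hn
  let I : ℕ → Memory → Prop := fun j s' => s'.reg (d + 3) = j ∧
    s'.reg (d + 2) = ∑ i ∈ Finset.range j, f (a, i) ∧ s'.reg (d + 1) = s.reg v ∧
    (∀ x < d, x ≠ v → s'.reg x = s.reg x) ∧ s'.arr = s.arr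
  refine (Run.copy (Q := fun s' => s' = s.setReg (d + 1) (s.reg v)) rfl).seq fun s1 e1 =>
    (Run.const (Q := fun s' => s' = s1.setReg (d + 2) 0) rfl).seq fun s2 e2 =>
    (Run.const (Q := I 0) ?_).seq fun s3 h3 =>
    (Run.loop (N := n) I ?_ ?_ h3).seq fun s4 h4 => ?_
  · simp only [I, e1, e2]
    refine ⟨by simp, by simp, by simp, fun x hx hxv => ?_, rfl⟩
    simp [show x ≠ d + 3 by omega, show x ≠ d + 2 by omega, show x ≠ d + 1 by omega]
  · intro j s' _ ⟨h1, _, _, h4, _⟩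
    rw [h1, h4 0 (by omega) (by omega), Ctx.reg_zero ha]
  · intro j s' hj ⟨h1, h2, h3, h4, h5⟩
    let J : Memory → Prop := fun s'' => s''.reg v = j ∧ I j s''
    refine (Run.copy (Q := J) ?_).seq fun s1 ⟨g0, g1, g2, g3, g4, g5⟩ => (hp (a, j) s1 ?_).seq
      fun s2 ⟨k1, k2, k3⟩ => ?_
    · refine ⟨by simp [h1], ?_, ?_, ?_, fun x hx hxv => ?_, h5⟩
      · simp [show d + 3 ≠ v by omega, h1]
      · simp [show d + 2 ≠ v by omega, h2]
      · simp [show d + 1 ≠ v by omega, h3]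
      · simp [hxv, h4 x hx hxv]
    · refine ⟨Ctx.congr ha (fun x hx => g4 x (by omega) (by omega)) fun b _ => by rw [g5], g0⟩
    · have hI2 : I j s2 := ⟨by rw [k2 _ (by omega), g1], by rw [k2 _ (by omega), g2],
        by rw [k2 _ (by omega), g3], fun x hx hxv => by rw [k2 _ (by omega), g4 x hx hxv],
        by rw [k3, g5]⟩
      clear g0 g1 g2 g3 g4 g5 k2 k3
      let J : ℕ → Memory → Prop := fun i s'' => s''.reg (d + 5) = i ∧ s''.reg (d + 4) = f (a, j) ∧
        s''.reg (d + 3) = j ∧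
        s''.reg (d + 2) = ∑ i ∈ Finset.range j, f (a, i) + i ∧ s''.reg (d + 1) = s.reg v ∧
        (∀ x < d, x ≠ v → s''.reg x = s.reg x) ∧ s''.arr = s.arr
      obtain ⟨g1, g2, g3, g4, g5⟩ := hI2
      refine (Run.const (Q := J 0) ?_).seq fun s3 hs3 =>
        ((Run.loop (N := f (a, j)) (T := 2) J ?_ ?_ hs3).mono
          (U := B n * 3 + 1) (by have := hfB (a, j); simp only [Ctx.size_prod, ← hn] at this; omega)
          fun s' h => h).seq fun s4 ⟨m0, m1, m2, m3, m4, m5, m6⟩ => .inc ?_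
      · refine ⟨by simp, by simp [k1], by simp [g1], by simp [g2], by simp [g3],
          fun x hx hxv => ?_, g5⟩
        simp [show x ≠ d + 5 by omega, g4 x hx hxv]
      · intro i s' _ ⟨h1, h2, _⟩
        rw [h1, h2]
      · intro i s' _ ⟨m0, m1, m2, m3, m4, m5, m6⟩
        refine (Run.inc (Q := fun s'' => s'' = s'.setReg (d + 2) (s'.reg (d + 2) + 1)) rfl).seq
          fun s'' e => .inc ?_
        subst e
        refine ⟨by simp [m0], by simp [m1], by simp [m2], by simp [m3]; omega, by simp [m4],
          fun x hx hxv => ?_, m6⟩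
        simp [show x ≠ d + 5 by omega, show x ≠ d + 2 by omega, m5 x hx hxv]
      · refine ⟨by simp [m2], by simp [m3, Finset.sum_range_succ], by simp [m4],
          fun x hx hxv => ?_, m6⟩
        simp [show x ≠ d + 3 by omega, m5 x hx hxv]
  · obtain ⟨_, h2, h3, h4, h5⟩ := h4
    refine (Run.copy (Q := fun s' => s' = s4.setReg v (s4.reg (d + 1))) rfl).seq fun s5 e =>
      .copy ?_
    subst e
    refine ⟨?_, fun x hx => ?_, h5⟩
    · simp [show d + 2 ≠ v by omega, h2, hn]
    · by_cases hxv : x = v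
      · simp [hxv, h3]; intro h; omega
      · simp [hx.ne, hxv, h4 x hx hxv]

end Fn

namespace Pd

variable {α : Type} [Ctx α] {P Q : α → Prop} {f g : α → ℕ}

theorem congr (hP : Pd P) (h : ∀ a, P a ↔ Q a) : Pd Q := by
  have : P = Q := funext fun a => propext (h a)
  exact this ▸ hP

theorem and (hP : Pd P) (hQ : Pd Q) : Pd fun a => P a ∧ Q a := by
  classical
  exact (Fn.ite hP hQ (.const 0)).congr fun a => by split_ifs <;> tauto

theorem not (hP : Pd P) : Pd fun a => ¬ P a := by
  classical
  exact (Fn.ite hP (.const 0) (.const 1)).congr fun a => by split_ifs <;> tauto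

theorem or (hP : Pd P) (hQ : Pd Q) : Pd fun a => P a ∨ Q a :=
  (hP.not.and hQ.not).not.congr fun a => by tauto

theorem imp (hP : Pd P) (hQ : Pd Q) : Pd fun a => P a → Q a :=
  (hP.not.or hQ).congr fun a => by tauto

theorem iff (hP : Pd P) (hQ : Pd Q) : Pd fun a => P a ↔ Q a :=
  ((hP.imp hQ).and (hQ.imp hP)).congr fun a => by tauto

theorem le (hf : Fn f) (hg : Fn g) : Pd fun a => f a ≤ g a :=
  (Pd.lt hg hf).not.congr fun a => by simp

theorem eq (hf : Fn f) (hg : Fn g) : Pd fun a => f a = g a :=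
  ((le hf hg).and (le hg hf)).congr fun a => by omega

/-- Counting is a sum of indicators. Bounded quantifiers follow by comparing the count with `0`. -/
theorem count {P : α → ℕ → Prop} [∀ a, DecidablePred (P a)] (hP : Pd fun a : α × ℕ => P a.1 a.2) :
    Fn fun a : α => ((Finset.range (Ctx.size a)).filter (P a)).card := by
  classical
  exact (Fn.sum hP (.const 1) fun a => by split_ifs <;> simp).congr fun a => by
    rw [Finset.card_filter]; congr!

theorem ex {P : α → ℕ → Prop} (hP : Pd fun a : α × ℕ => P a.1 a.2) :
    Pd fun a : α => ∃ i < Ctx.size a, P a i := by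
  classical
  refine (Pd.lt (.const 0) hP.count).congr fun a => ?_
  simp [Finset.card_pos, Finset.Nonempty]

theorem all {P : α → ℕ → Prop} (hP : Pd fun a : α × ℕ => P a.1 a.2) :
    Pd fun a : α => ∀ i < Ctx.size a, P a i :=
  (ex (P := fun a i => ¬ P a i) hP.not).not.congr fun a => by simp

end Pd

/-- The adjacency matrix, kept in array `0` row by row, has entry `1` at `(u, v)`. -/
def Memory.Adj (s : Memory) (u v : ℕ) : Prop :=
  u < s.reg 0 ∧ v < s.reg 0 ∧ s.arr 0 (u * s.reg 0 + v) = 1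

/-- The address of a matrix entry as a bounded sum, because the machine does not multiply. The guard
`v < n` keeps every summand at most `n` even for `v` out of range, as `Fn.sum` requires. -/
theorem sum_range_row (n u v : ℕ) (hu : u < n) (hv : v < n) :
    ∑ i ∈ Finset.range n, (if i < u then n else if i = u ∧ v < n then v else 0) = u * n + v := by
  have : ∀ i, (if i < u then n else if i = u ∧ v < n then v else 0)
      = (if i < u then n else 0) + if i = u then v else 0 := by
    intro i; split_ifs <;> omega
  simp only [this, Finset.sum_add_distrib, Finset.sum_ite_eq', Finset.mem_range, hu, if_true]
  rw [← Finset.sum_filter, Finset.sum_const, smul_eq_mul]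
  congr 2
  have : (Finset.range n).filter (· < u) = Finset.range u := by ext; simp; omega
  rw [this, Finset.card_range]

theorem Pd.adj {α : Type} [Ctx α] {f g : α → ℕ} (hf : Fn f) (hg : Fn g) :
    Pd fun a => (Ctx.mem a).Adj (f a) (g a) := by
  classical
  have h := Fn.sum (Fn.ite (Pd.lt .var hf.weaken) Fn.size.weaken
    (Fn.ite ((Pd.eq .var hf.weaken).and (Pd.lt hg.weaken Fn.size.weaken)) hg.weaken (.const 0)))
    .id (fun a => by split_ifs <;> (simp; try omega))
  refine ((Pd.lt hf .size).and ((Pd.lt hg .size).and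
    (Pd.eq (Fn.arr (b := 0) (by omega) h) (.const 1)))).congr fun a => ?_
  refine and_congr_right fun h1 => and_congr_right fun h2 => ?_
  dsimp only
  rw [sum_range_row _ _ _ h1 h2]
  rfl

/-- `F` transforms the visible part of the memory in polynomial time. -/
def St (F : Memory → Memory) : Prop :=
  ∃ T, PolyBdd T ∧ (∀ s, (F s).reg 0 = s.reg 0) ∧ ∀ d, 5 ≤ d → ∃ p, ∀ a s, Agree a s →
    Run p s (T (a.reg 0)) fun s' => Agree (F a) s' ∧ ∀ x, 5 ≤ x → x < d → s'.reg x = s.reg x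

namespace St

variable {F F' : Memory → Memory}

theorem size_iterate (hF : ∀ s, (F s).reg 0 = s.reg 0) (s : Memory) (m : ℕ) :
    (F^[m] s).reg 0 = s.reg 0 := by
  induction m with
  | zero => rfl
  | succ m ih => rw [Function.iterate_succ_apply', hF, ih]

theorem assign {x : ℕ} (hx0 : 0 < x) (hx : x < 5) {f : Memory → ℕ} (hf : Fn f) :
    St fun s => s.setReg x (f s) := by
  obtain ⟨T, hT, h⟩ := hf
  refine ⟨_, hT.add (.const 1), fun s => by simp [hx0.ne], fun d hd => ?_⟩
  obtain ⟨p, hp⟩ := h d hd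
  refine ⟨.seq p (.copy x d), fun a s ha => (hp a s ha).seq fun s1 ⟨h1, h2, h3⟩ => .copy
    ⟨⟨fun y hy => ?_, fun b hb => by simp [h3, ha.2 b hb]⟩, fun y hy hyd => ?_⟩⟩
  · simp only [Memory.setReg_reg, h1]
    split_ifs
    · rfl
    · rw [h2 y (by omega), ha.1 y hy]
  · simp [h2 y hyd, show y ≠ x by omega]

theorem seq (hF : St F) (hF' : St F') : St fun s => F' (F s) := by
  obtain ⟨T, hT, h0, h⟩ := hF
  obtain ⟨U, hU, h0', h'⟩ := hF'
  refine ⟨_, hT.add hU, fun s => by rw [h0', h0], fun d hd => ?_⟩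
  obtain ⟨p, hp⟩ := h d hd
  obtain ⟨q, hq⟩ := h' d hd
  refine ⟨.seq p q, fun a s ha => (hp a s ha).seq fun s1 ⟨h1, h2⟩ => ?_⟩
  have := hq _ _ h1
  rw [h0] at this
  exact this.mono le_rfl fun s' ⟨h3, h4⟩ => ⟨h3, fun x hx hxd => by rw [h4 x hx hxd, h2 x hx hxd]⟩

theorem skip : St fun s => s :=
  ⟨_, .const 1, fun _ => rfl, fun _ _ => ⟨.skip, fun _ _ ha => .skip ⟨ha, fun _ _ _ => rfl⟩⟩⟩

theorem ite {P : Memory → Prop} [DecidablePred P] (hP : Pd P) (hF : St F) (hF' : St F') :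
    St fun s => if P s then F s else F' s := by
  obtain ⟨T, hT, h0, h⟩ := hF
  obtain ⟨U, hU, h0', h'⟩ := hF'
  obtain ⟨W, hW, hP⟩ := hP
  refine ⟨_, hW.add ((PolyBdd.const 1).add ((hT.add hU).add (.const 1))),
    fun s => by dsimp only; split_ifs <;> simp [h0, h0'], fun d hd => ?_⟩
  obtain ⟨p, hp⟩ := h d hd
  obtain ⟨q, hq⟩ := h' d hd
  obtain ⟨r, hr⟩ := hP d hd
  refine ⟨.seq r (.seq (.const (d + 1) 0) (.ifLt (d + 1) d p q)), fun a s ha =>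
    (hr a s ha).seq fun s1 ⟨h1, h2, h3⟩ =>
    (Run.const (Q := fun s' => s' = s1.setReg (d + 1) 0) rfl).seq fun s2 e => ?_⟩
  have k : ∀ x < d, s2.reg x = s.reg x := fun x hx => by
    rw [e, Memory.setReg_reg, if_neg (by omega), h2 x hx]
  have k' : s2.arr = s.arr := by rw [e, Memory.setReg_arr, h3]
  have ha' : Agree a s2 := ⟨fun x hx => by rw [k x (by omega), ha.1 x hx],
    fun b hb => by rw [k', ha.2 b hb]⟩
  have e0 : s2.reg (d + 1) = 0 := by simp [e]
  have e1 : s2.reg d = if P a then 1 else 0 := by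
    rw [e, Memory.setReg_reg, if_neg (by omega), h1]; dsimp only; congr
  refine .ifLt (fun hc => ?_) (fun hc => ?_) <;> rw [e0, e1] at hc
  · have hPa : P a := by by_contra hn; simp [hn] at hc
    refine (hp a s2 ha').mono (by omega) fun s' ⟨i1, i2⟩ => ?_
    exact ⟨by simp [hPa, i1], fun x hx hxd => by rw [i2 x hx hxd, k x hxd]⟩
  · have hPa : ¬ P a := by intro hn; simp [hn] at hc
    refine (hq a s2 ha').mono (by omega) fun s' ⟨i1, i2⟩ => ?_
    exact ⟨by simp [hPa, i1], fun x hx hxd => by rw [i2 x hx hxd, k x hxd]⟩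

theorem iter (hF : St F) : St fun s => F^[s.reg 0] s := by
  obtain ⟨T, hT, h0, h⟩ := hF
  refine ⟨fun n => 1 + (n * (T n + 1 + 1) + 1), (PolyBdd.const 1).add ((PolyBdd.id.mul
    ((hT.add (.const 1)).add (.const 1))).add (.const 1)), fun s => size_iterate h0 s _,
    fun d hd => ?_⟩
  -- The body must protect register `d`, which counts the rounds.
  obtain ⟨p, hp⟩ := h (d + 1) (by omega)
  refine ⟨.seq (.const d 0) (.whileLt d 0 (.seq p (.inc d))), fun a s ha => ?_⟩
  let I : ℕ → Memory → Prop := fun j s' => s'.reg d = j ∧ Agree (F^[j] a) s' ∧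
    ∀ x, 5 ≤ x → x < d → s'.reg x = s.reg x
  refine (Run.const (Q := I 0) ?_).seq fun s1 h1 =>
    (Run.loop (N := a.reg 0) I ?_ ?_ h1).mono le_rfl fun s' h => h.2
  · refine ⟨by simp, ⟨fun x hx => ?_, ha.2⟩, fun x hx hxd => ?_⟩
    · simpa [show x ≠ d by omega] using ha.1 x hx
    · simp [hxd.ne]
  · intro j s' _ ⟨h1, h2, _⟩
    rw [h1, h2.1 0 (by omega), size_iterate h0]
  · intro j s' hj ⟨h1, h2, h3⟩
    have := hp _ _ h2
    rw [size_iterate h0] at this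
    refine this.seq fun s2 ⟨h4, h5⟩ => .inc ⟨by simp [h5 d hd (by omega), h1],
      ⟨fun x hx => ?_, fun b hb => ?_⟩, fun x hx hxd => ?_⟩
    · rw [Function.iterate_succ_apply']
      simpa [show x ≠ d by omega] using h4.1 x hx
    · rw [Function.iterate_succ_apply']
      simpa using h4.2 b hb
    · simp [hxd.ne, h5 x hx (by omega), h3 x hx hxd]

/-- Simultaneous assignment to all entries of an array. -/
def _root_.Memory.fill (s : Memory) (b : ℕ) (f : ℕ → ℕ) : Memory :=
  { s with arr := Function.update s.arr b fun i => if i < s.reg 0 then f i else s.arr b i }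

@[simp] theorem _root_.Memory.fill_reg (s : Memory) (b : ℕ) (f : ℕ → ℕ) :
    (s.fill b f).reg = s.reg := rfl

@[simp] theorem _root_.Memory.fill_arr (s : Memory) (b c : ℕ) (f : ℕ → ℕ) :
    (s.fill b f).arr c = if c = b then fun i => if i < s.reg 0 then f i else s.arr b i
      else s.arr c := by
  simp [Memory.fill, Function.update_apply]

/-- Since `f` may read the array being overwritten, all values are first written to the invisible
array `6` and copied to `b` afterwards. Register `5` is the one where `f` expects its variable. -/
theorem fill {b : ℕ} (hb : b < 6) {f : Memory → ℕ → ℕ}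
    (hf : Fn fun a : Memory × ℕ => f a.1 a.2) : St fun s => s.fill b (f s) := by
  obtain ⟨T, hT, h⟩ := hf
  refine ⟨fun n => 1 + (1 + ((n * (1 + (T n + (1 + 1)) + 1) + 1) + (1 + ((n * (1 + (1 + 1) + 1) + 1)
    + 1)))), (PolyBdd.const 1).add ((PolyBdd.const 1).add (((PolyBdd.id.mul
      (((PolyBdd.const 1).add (hT.add (.const 2))).add (.const 1))).add (.const 1)).add
      ((PolyBdd.const 1).add (((PolyBdd.id.mul (.const 4)).add (.const 1)).add (.const 1))))),
    fun s => rfl, fun d' hd' => ?_⟩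
  -- The old content of register `5` is saved in `d`, so `d` itself must lie beyond `5`.
  obtain ⟨d, hd, hdd⟩ : ∃ d, 6 ≤ d ∧ d' ≤ d := ⟨d' + 1, by omega, by omega⟩
  obtain ⟨p, hp⟩ := h (d + 2) (by change 6 ≤ _; omega)
  refine ⟨.seq (.copy d 5) (.seq (.const (d + 1) 0) (.seq (.whileLt (d + 1) 0
    (.seq (.copy 5 (d + 1)) (.seq p (.seq (.store 6 (d + 1) (d + 2)) (.inc (d + 1))))))
    (.seq (.const (d + 1) 0) (.seq (.whileLt (d + 1) 0 (.seq (.load (d + 2) 6 (d + 1))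
      (.seq (.store b (d + 1) (d + 2)) (.inc (d + 1))))) (.copy 5 d))))), fun a s ha => ?_⟩
  let K : Memory → Prop := fun s' => s'.reg d = s.reg 5 ∧ (∀ x < 5, s'.reg x = s.reg x) ∧
    (∀ x < d, x ≠ 5 → s'.reg x = s.reg x)
  let I : ℕ → Memory → Prop := fun j s' => s'.reg (d + 1) = j ∧ K s' ∧
    (∀ b < 6, s'.arr b = s.arr b) ∧ ∀ i < j, s'.arr 6 i = f a i
  let J : ℕ → Memory → Prop := fun j s' => s'.reg (d + 1) = j ∧ K s' ∧
    (∀ c < 6, c ≠ b → s'.arr c = s.arr c) ∧ (∀ i < a.reg 0, s'.arr 6 i = f a i) ∧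
    ∀ i, s'.arr b i = if i < j then f a i else s.arr b i
  refine (Run.copy (Q := fun s' => s' = s.setReg d (s.reg 5)) rfl).seq fun s1 e1 =>
    (Run.const (Q := I 0) ?_).seq fun s2 h2 =>
    (Run.loop (N := a.reg 0) I ?_ ?_ h2).seq fun s3 h3 =>
    (Run.const (Q := J 0) ?_).seq fun s4 h4 =>
    (Run.loop (N := a.reg 0) J ?_ ?_ h4).seq fun s5 h5 => .copy ?_
  · subst e1
    refine ⟨by simp, ⟨by simp, fun x hx => ?_, fun x hx _ => ?_⟩, fun b _ => rfl, by simp⟩ <;>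
      simp [show x ≠ d + 1 by omega, show x ≠ d by omega]
  · intro j s' _ ⟨h1, h2, _⟩
    rw [h1, h2.2.1 0 (by omega), ha.1 0 (by omega)]
  · intro j s' hj ⟨h1, ⟨h2, h3, h4⟩, h5, h6⟩
    refine (Run.copy (Q := fun s'' => s'' = s'.setReg 5 (s'.reg (d + 1))) rfl).seq fun s6 e =>
      (hp (a, j) s6 ?_).seq fun s7 ⟨g1, g2, g3⟩ =>
      (Run.store (Q := fun s'' => s'' = s7.setArr 6 (s7.reg (d + 1)) (s7.reg (d + 2))) rfl).seq
      fun s8 e' => .inc ?_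
    · subst e
      refine ⟨⟨fun x hx => ?_, fun c hc => ?_⟩, ?_⟩
      · simp [show x ≠ 5 by omega, h3 x hx, ha.1 x hx]
      · simp [h5 c hc, ha.2 c hc]
      · change (s'.setReg 5 _).reg 5 = j
        simp [h1]
    · subst e
      have g0 : s7.reg (d + 1) = j := by
        rw [g2 _ (by omega), Memory.setReg_reg, if_neg (by omega), h1]
      subst e'
      refine ⟨by simp [g0], ⟨?_, fun x hx => ?_, fun x hx hx5 => ?_⟩, fun c hc => ?_,
        fun i hi => ?_⟩
      · simp [g2, show d ≠ 5 by omega, h2]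
      · simp [show x ≠ d + 1 by omega, g2 x (by omega), show x ≠ 5 by omega, h3 x hx]
      · simp [show x ≠ d + 1 by omega, g2 x (by omega), hx5, h4 x hx hx5]
      · funext i
        simp [hc.ne, g3, h5 c hc]
      · simp only [Memory.setReg_arr, Memory.setArr_arr, g0, true_and, g1, g3]
        split_ifs with hij
        · rw [hij]
        · exact h6 i (by omega)
  · obtain ⟨_, ⟨h1, h2, h3⟩, h4, h5⟩ := h3
    refine ⟨by simp, ⟨?_, fun x hx => ?_, fun x hx hx5 => ?_⟩, fun c hc _ => h4 c hc, h5,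
      fun i => ?_⟩
    · simp [h1]
    · simp [show x ≠ d + 1 by omega, h2 x hx]
    · simp [show x ≠ d + 1 by omega, h3 x hx hx5]
    · simp [h4 b hb]
  · intro j s' _ ⟨h1, h2, _⟩
    rw [h1, h2.2.1 0 (by omega), ha.1 0 (by omega)]
  · intro j s' hj ⟨h1, ⟨h2, h3, h4⟩, h5, h6, h7⟩
    refine (Run.load (Q := fun s'' => s'' = s'.setReg (d + 2) (f a j)) ?_).seq fun s6 e =>
      (Run.store (Q := fun s'' => s'' = s6.setArr b j (f a j)) ?_).seq
      fun s7 e' => .inc ?_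
    · rw [h1, h6 j hj]
    · subst e; simp [h1]
    · subst e; subst e'
      refine ⟨by simp [h1], ⟨by simp [h2], fun x hx => ?_, fun x hx hx5 => ?_⟩,
        fun c hc hcb => ?_, fun i hi => ?_, fun i => ?_⟩
      · simp [show x ≠ d + 1 by omega, show x ≠ d + 2 by omega, h3 x hx]
      · simp [show x ≠ d + 1 by omega, show x ≠ d + 2 by omega, h4 x hx hx5]
      · funext i
        simp [hcb, h5 c hc hcb]
      · simp [show 6 ≠ b by omega, h6 i hi]
      · by_cases hij : i = j
        · simp [hij]
        · simp [hij, h7 i, show i < j + 1 ↔ i < j by omega]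
  · obtain ⟨_, ⟨h1, h2, h3⟩, h4, h5, h6⟩ := h5
    refine ⟨⟨fun x hx => ?_, fun c hc => ?_⟩, fun x hx hxd => ?_⟩
    · simp [show x ≠ 5 by omega, h2 x hx, ha.1 x hx]
    · funext i
      by_cases hcb : c = b
      · subst hcb; simp [h6, ha.2 c hc]
      · simp [hcb, h4 c hc hcb, ha.2 c hc]
    · by_cases hx5 : x = 5
      · subst hx5; simp [h1]
      · simp [hx5, h3 x (by omega) hx5]

end St

/-! ### Enumeration of digit strings -/

/-- Digit `u` of `m` in the mixed radix system `R`. -/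
def mixedDigit (R : ℕ → ℕ) (m u : ℕ) : ℕ := m / (∏ v ∈ Finset.range u, R v) % R u

theorem mixedDigit_zero (R : ℕ → ℕ) (u : ℕ) : mixedDigit R 0 u = 0 := by simp [mixedDigit]

/-- The carry condition of an odometer. If the product `P` of the first `u` radices divides `m + 1`,
then `(m + 1) / P = m / P + 1`, and this is divisible by `R u` exactly when digit `u` of `m` is
maximal. -/
theorem prod_dvd_succ_iff {R : ℕ → ℕ} {m : ℕ} :
    ∀ {u : ℕ}, (∀ v < u, 0 < R v) → ((∏ v ∈ Finset.range u, R v) ∣ m + 1 ↔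
      ∀ v < u, ¬ mixedDigit R m v + 1 < R v)
  | 0, _ => by simp
  | u + 1, hR => by
    have ih := prod_dvd_succ_iff (m := m) (u := u) fun v hv => hR v (by omega)
    have hP : 0 < ∏ v ∈ Finset.range u, R v :=
      Finset.prod_pos fun v hv => hR v (by simp at hv; omega)
    rw [Finset.prod_range_succ]
    have hr := hR u (by omega)
    have key : (∏ v ∈ Finset.range u, R v) ∣ m + 1 →
        ((∏ v ∈ Finset.range u, R v) * R u ∣ m + 1 ↔ ¬ mixedDigit R m u + 1 < R u) := by
      intro hd
      have h1 : (m + 1) / (∏ v ∈ Finset.range u, R v) = m / (∏ v ∈ Finset.range u, R v) + 1 := by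
        rw [Nat.succ_div, if_pos hd]
      obtain ⟨q, hq⟩ := hd
      rw [hq, Nat.mul_dvd_mul_iff_left hP]
      rw [hq, Nat.mul_div_cancel_left _ hP] at h1
      rw [h1, mixedDigit]
      generalize m / (∏ v ∈ Finset.range u, R v) = x
      have hx := Nat.mod_lt x hr
      rw [Nat.dvd_iff_mod_eq_zero, Nat.add_mod]
      rcases eq_or_lt_of_le (Nat.succ_le_of_lt hr) with h | h
      · rw [← h]; simp [Nat.mod_one]
      · rw [Nat.mod_eq_of_lt h]
        rcases eq_or_lt_of_le (Nat.succ_le_of_lt hx) with h' | h'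
        · have : x % R u + 1 = R u := h'
          rw [this]; simp
        · have : x % R u + 1 < R u := h'
          rw [Nat.mod_eq_of_lt this]; simp [this]
    constructor
    · intro h v hv
      have hd := dvd_of_mul_right_dvd h
      rcases Nat.lt_succ_iff_lt_or_eq.1 hv with h' | rfl
      · exact ih.1 hd v h'
      · exact (key hd).1 h
    · intro h
      have hd := ih.2 fun v hv => h v (by omega)
      exact (key hd).2 (h u (by omega))

/-- By `Nat.succ_div` the quotient that defines digit `u` grows only when the lower product divides
`m + 1`, that is, when a carry arrives. -/
theorem mixedDigit_succ {R : ℕ → ℕ} {u : ℕ} (hR : ∀ v ≤ u, 0 < R v) (m : ℕ) :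
    mixedDigit R (m + 1) u =
      if (∀ v < u, ¬ mixedDigit R m v + 1 < R v) then
        if mixedDigit R m u + 1 < R u then mixedDigit R m u + 1 else 0
      else mixedDigit R m u := by
  have hd := prod_dvd_succ_iff (m := m) (u := u) fun v hv => hR v hv.le
  have hr := hR u le_rfl
  simp only [← hd]
  unfold mixedDigit
  rw [Nat.succ_div]
  split_ifs with h1 h2
  · generalize m / (∏ v ∈ Finset.range u, R v) = x at *
    have : 1 < R u := by omega
    rw [Nat.add_mod, Nat.mod_eq_of_lt this, Nat.mod_eq_of_lt h2]
  · generalize m / (∏ v ∈ Finset.range u, R v) = x at *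
    have hx := Nat.mod_lt x hr
    have : x % R u + 1 = R u := by omega
    rw [← Nat.mod_add_mod, this, Nat.mod_self]
  · rw [add_zero]

theorem exists_mixedDigit_eq (R d : ℕ → ℕ) :
    ∀ n, (∀ u < n, d u < R u) → ∃ m < ∏ v ∈ Finset.range n, R v, ∀ u < n, mixedDigit R m u = d u
  | 0, _ => ⟨0, by simp, by simp⟩
  | n + 1, h => by
    obtain ⟨m, hm, hd⟩ := exists_mixedDigit_eq R d n fun u hu => h u (by omega)
    have hn := h n (by omega)
    set P := ∏ v ∈ Finset.range n, R v with hP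
    have hP0 : 0 < P := by omega
    refine ⟨m + P * d n, ?_, fun u hu => ?_⟩
    · rw [Finset.prod_range_succ, ← hP]
      calc m + P * d n < P + P * d n := by omega
        _ = P * (d n + 1) := by ring
        _ ≤ P * R n := Nat.mul_le_mul_left _ hn
    · rcases Nat.lt_succ_iff_lt_or_eq.1 hu with hu | rfl
      · rw [← hd u hu, mixedDigit, mixedDigit]
        -- The new leading term is a multiple of `P`, hence of the product of the radices up to `u`,
        -- so it is invisible to digit `u`.
        obtain ⟨Q, hQ⟩ : (∏ v ∈ Finset.range (u + 1), R v) ∣ P :=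
          Finset.prod_dvd_prod_of_subset _ _ _ fun x hx => by simp at hx ⊢; omega
        rw [Finset.prod_range_succ] at hQ
        set p := ∏ v ∈ Finset.range u, R v
        have hp : 0 < p := by
          rcases Nat.eq_zero_or_pos p with h0 | h0
          · rw [h0] at hQ; simp at hQ; omega
          · exact h0
        rw [hQ, show m + p * R u * Q * d n = m + p * (R u * (Q * d n)) by ring,
          Nat.add_mul_div_left _ _ hp, Nat.add_mul_mod_self_left]
      · rw [mixedDigit, ← hP, Nat.add_mul_div_left _ _ hP0, Nat.div_eq_of_lt hm, zero_add,
          Nat.mod_eq_of_lt hn]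

open Classical in
/-- Passes to the next string of digits, in array `1`, with the radices in array `2`. Register `2`
is set to `1` unless the string was the last one. -/
noncomputable def advance (s : Memory) : Memory :=
  (s.setReg 2 (if ∃ u < s.reg 0, s.arr 1 u + 1 < s.arr 2 u then 1 else 0)).fill 1 fun u =>
    if ∀ v < s.reg 0, v < u → ¬ s.arr 1 v + 1 < s.arr 2 v then
      if s.arr 1 u + 1 < s.arr 2 u then s.arr 1 u + 1 else 0
    else s.arr 1 u

theorem St.advance : St advance := by
  classical
  have hlt : ∀ {α : Type} [Ctx α] {f : α → ℕ}, Fn f →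
      Pd fun a => (Ctx.mem a).arr 1 (f a) + 1 < (Ctx.mem a).arr 2 (f a) := fun hf =>
    Pd.lt (Fn.arr (by omega) hf).succ (Fn.arr (by omega) hf)
  have h1 : Pd fun s : Memory => ∃ u < s.reg 0, s.arr 1 u + 1 < s.arr 2 u :=
    Pd.ex (P := fun (s : Memory) u => s.arr 1 u + 1 < s.arr 2 u) (hlt .var)
  have h2 : Fn fun a : Memory × ℕ =>
      if ∀ v < a.1.reg 0, v < a.2 → ¬ a.1.arr 1 v + 1 < a.1.arr 2 v then
        if a.1.arr 1 a.2 + 1 < a.1.arr 2 a.2 then a.1.arr 1 a.2 + 1 else 0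
      else a.1.arr 1 a.2 :=
    Fn.ite (Pd.all (α := Memory × ℕ) (P := fun (a : Memory × ℕ) v => v < a.2 → ¬ a.1.arr 1 v + 1 < a.1.arr 2 v)
        (.imp (.lt .var Fn.var.weaken) (hlt .var).not))
      (Fn.ite (hlt .var) (Fn.arr (b := 1) (by omega) .var).succ (.const 0))
      (Fn.arr (b := 1) (by omega) .var)
  refine (congrArg St (funext fun s => ?_)).mp (St.seq
    (St.assign (x := 2) (by omega) (by omega) h1) (St.fill (b := 1) (by omega)
      (f := fun s u => if ∀ v < s.reg 0, v < u → ¬ s.arr 1 v + 1 < s.arr 2 v then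
        if s.arr 1 u + 1 < s.arr 2 u then s.arr 1 u + 1 else 0 else s.arr 1 u) ?_))
  · simp [_root_.advance]
    congr!
  · exact h2.congr fun a => by congr

@[simp] theorem advance_arr {s : Memory} {b : ℕ} (hb : b ≠ 1) : (advance s).arr b = s.arr b := by
  simp [advance, hb]

@[simp] theorem advance_reg {s : Memory} {x : ℕ} (hx : x ≠ 2) : (advance s).reg x = s.reg x := by
  simp [advance, hx]

theorem iterate_advance {B : Memory → Memory} (h0 : ∀ s, (B s).reg 0 = s.reg 0)
    (h1 : ∀ s, (B s).arr 1 = s.arr 1) (h2 : ∀ s, (B s).arr 2 = s.arr 2) {a : Memory}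
    (hgo : a.reg 2 = 1) (hD : ∀ u < a.reg 0, a.arr 1 u = 0) (hR : ∀ u < a.reg 0, 0 < a.arr 2 u) :
    ∀ m ≤ ∏ u ∈ Finset.range (a.reg 0), a.arr 2 u,
      ((fun s => advance (B s))^[m] a).reg 0 = a.reg 0 ∧
      ((fun s => advance (B s))^[m] a).arr 2 = a.arr 2 ∧
      (∀ u < a.reg 0, ((fun s => advance (B s))^[m] a).arr 1 u = mixedDigit (a.arr 2) m u) ∧
      ((fun s => advance (B s))^[m] a).reg 2 =
        if m < ∏ u ∈ Finset.range (a.reg 0), a.arr 2 u then 1 else 0 := by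
  have hN : 0 < ∏ u ∈ Finset.range (a.reg 0), a.arr 2 u :=
    Finset.prod_pos fun v hv => hR v (by simpa using hv)
  intro m
  induction m with
  | zero => exact fun _ => ⟨rfl, rfl, fun u hu => by simp [hD u hu, mixedDigit_zero],
      by simp [hgo, hN]⟩
  | succ m ih =>
    intro hm
    obtain ⟨i1, i2, i3, -⟩ := ih (by omega)
    rw [Function.iterate_succ_apply']
    set s := (fun s => advance (B s))^[m] a
    refine ⟨by simp [h0, i1], by simp [h2, i2], fun u hu => ?_, ?_⟩
    · rw [mixedDigit_succ (fun v hv => hR v (by omega))]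
      simp only [advance, Memory.fill_arr, if_true, Memory.setReg_reg, h0, i1, h1, h2, i2]
      simp only [show (0 : ℕ) ≠ 2 by omega, if_false, hu, if_true, i3 u hu]
      have : (∀ v < a.reg 0, v < u → ¬ s.arr 1 v + 1 < a.arr 2 v) ↔
          ∀ v < u, ¬ mixedDigit (a.arr 2) m v + 1 < a.arr 2 v :=
        ⟨fun h v hv => by rw [← i3 v (by omega)]; exact h v (by omega) hv,
          fun h v hv hvu => by rw [i3 v hv]; exact h v hvu⟩
      simp only [this]
    · simp only [advance, Memory.fill_reg, Memory.setReg_reg, if_true, h0, i1, h1, h2, i2]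
      -- No digit can be raised exactly when the full product divides `m + 1`; as `m + 1` is at most
      -- the product, this means equality.
      have hd := prod_dvd_succ_iff (m := m) hR
      have : (∃ u < a.reg 0, s.arr 1 u + 1 < a.arr 2 u) ↔
          m + 1 < ∏ u ∈ Finset.range (a.reg 0), a.arr 2 u := by
        rw [← not_iff_not]
        push Not
        have e : (∀ u < a.reg 0, a.arr 2 u ≤ s.arr 1 u + 1) ↔
            ∀ v < a.reg 0, ¬ mixedDigit (a.arr 2) m v + 1 < a.arr 2 v :=
          forall₂_congr fun u hu => by rw [i3 u hu, not_lt]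
        rw [e, ← hd]
        exact ⟨fun h => Nat.le_of_dvd (by omega) h, fun h => by rw [le_antisymm hm h]⟩
      simp only [this]

theorem St.enumerate {B : Memory → Memory} (hB : St B)
    (h1 : ∀ s, (B s).arr 1 = s.arr 1) (h2 : ∀ s, (B s).arr 2 = s.arr 2) :
    ∃ p T, PolyBdd T ∧ ∀ a s, Agree a s → a.reg 2 = 1 → (∀ u < a.reg 0, a.arr 1 u = 0) →
      (∀ u < a.reg 0, 0 < a.arr 2 u) →
      Run p s (T (a.reg 0) * ∏ u ∈ Finset.range (a.reg 0), a.arr 2 u)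
        (Agree ((fun s => _root_.advance (B s))^[∏ u ∈ Finset.range (a.reg 0), a.arr 2 u] a)) := by
  obtain ⟨T, hT, h0, h⟩ := St.seq hB St.advance
  have h0' : ∀ s, (B s).reg 0 = s.reg 0 := fun s => by simpa using h0 s
  -- With limit `6` the body preserves register `5`, which holds the `0` that the flag in register
  -- `2` is tested against.
  obtain ⟨p, hp⟩ := h 6 (by omega)
  refine ⟨.seq (.const 5 0) (.whileLt 5 2 p), fun n => T n + 3, hT.add (.const 3),
    fun a s ha hgo hD hR => ?_⟩
  have key := iterate_advance h0' h1 h2 hgo hD hR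
  have hN : 0 < ∏ u ∈ Finset.range (a.reg 0), a.arr 2 u :=
    Finset.prod_pos fun v hv => hR v (by simpa using hv)
  set N := ∏ u ∈ Finset.range (a.reg 0), a.arr 2 u
  let I : ℕ → Memory → Prop := fun m s' =>
    s'.reg 5 = 0 ∧ Agree ((fun s => _root_.advance (B s))^[m] a) s'
  refine ((Run.const (Q := I 0) ?_).seq fun s1 hs1 =>
    Run.loop (T := T (a.reg 0)) (N := N) I ?_ ?_ hs1).mono ?_ fun s' h => h.2
  · exact ⟨by simp, fun x hx => by simp [show x ≠ 5 by omega, ha.1 x hx], ha.2⟩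
  · intro j s' hj ⟨e1, e2⟩
    rw [e1, e2.1 2 (by omega), (key j hj).2.2.2]
    split_ifs <;> simp [*]
  · intro j s' hj ⟨e1, e2⟩
    have := hp _ _ e2
    rw [(key j hj.le).1] at this
    refine this.mono le_rfl fun s'' ⟨g1, g2⟩ => ⟨by rw [g2 5 le_rfl (by omega), e1], ?_⟩
    rw [Function.iterate_succ_apply']
    exact g1
  · calc 1 + (N * (T (a.reg 0) + 1) + 1) = N * (T (a.reg 0) + 1) + 2 := by ring
      _ ≤ N * (T (a.reg 0) + 1) + 2 * N := by omega
      _ = _ := by ring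

/-! ### Minimal cuts -/

section Cuts

variable {V : Type*} (G : SimpleGraph V)

/-- The graph `G` without the edges of the cut `(S, V ∖ S)`. -/
def sideGraph (S : Set V) : SimpleGraph V where
  Adj u v := G.Adj u v ∧ (u ∈ S ↔ v ∈ S)
  symm := ⟨fun _ _ h => ⟨h.1.symm, h.2.symm⟩⟩
  loopless := ⟨fun _ h => G.loopless.irrefl _ h.1⟩

/-- Both sides of the cut `(S, V ∖ S)` are connected. -/
def SidesConnected (S : Set V) : Prop :=
  ∀ u v, (u ∈ S ↔ v ∈ S) → (sideGraph G S).Reachable u v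

variable {G} {S S' : Set V}

theorem mem_cutset_iff {u v : V} :
    s(u, v) ∈ cutset G S ↔ G.Adj u v ∧ ¬ (u ∈ S ↔ v ∈ S) := by
  constructor
  · rintro ⟨h, x, hx, y, hy, e⟩
    refine ⟨h, fun hh => ?_⟩
    rcases Sym2.eq_iff.1 e with ⟨rfl, rfl⟩ | ⟨rfl, rfl⟩ <;> tauto
  · rintro ⟨h, hh⟩
    by_cases hu : u ∈ S
    · exact ⟨h, u, hu, v, by tauto, rfl⟩
    · exact ⟨h, v, by tauto, u, hu, Sym2.eq_swap⟩

theorem cutset_compl : cutset G Sᶜ = cutset G S := by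
  ext e
  induction e with
  | _ u v => simp [mem_cutset_iff, not_iff_not]

theorem isMinimalCut_compl : IsMinimalCut G Sᶜ ↔ IsMinimalCut G S := by
  simp [IsMinimalCut, cutset_compl]

theorem sideGraph_reachable_side {u v : V} (h : (sideGraph G S).Reachable u v) :
    u ∈ S ↔ v ∈ S := by
  obtain ⟨w⟩ := h
  induction w with
  | nil => rfl
  | cons h _ ih => exact h.2.trans ih

theorem exists_adj_of_connected (hG : G.Connected) {T : Set V} {u v : V} (hu : u ∈ T)
    (hv : v ∉ T) : ∃ x y, x ∈ T ∧ y ∉ T ∧ G.Adj x y := by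
  obtain ⟨w⟩ := hG.preconnected u v
  induction w with
  | nil => exact absurd hu hv
  | @cons a b c h w ih =>
    by_cases hb : b ∈ T
    · exact ih hb hv
    · exact ⟨a, b, hu, hb, h⟩

/-- If `u` and `v` on one side lie in different components `C` and `D` of `sideGraph G S`, then
`δ(C)` is non-empty because `G` is connected, and it is contained in `δ(S)`. The inclusion is
proper: an edge leaving `D` lies in `δ(S)`, but if it were in `δ(C)` it would join `D` to `C`, which
are on the same side. -/
theorem IsMinimalCut.sidesConnected (hG : G.Connected) (h : IsMinimalCut G S) :
    SidesConnected G S := by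
  intro u v huv
  by_contra hn
  have hcut : ∀ {a x y : V}, (sideGraph G S).Reachable a x → ¬ (sideGraph G S).Reachable a y →
      G.Adj x y → ¬ (x ∈ S ↔ y ∈ S) := fun hx hy hxy hs =>
    hy (hx.trans (SimpleGraph.Adj.reachable (show (sideGraph G S).Adj _ _ from ⟨hxy, hs⟩)))
  refine h ⟨{x | (sideGraph G S).Reachable u x}, ?_, ?_, fun hsub => ?_⟩
  · obtain ⟨x, y, hx, hy, hxy⟩ := exists_adj_of_connected hG
      (T := {x | (sideGraph G S).Reachable u x}) (SimpleGraph.Reachable.refl u) hn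
    exact ⟨s(x, y), mem_cutset_iff.2 ⟨hxy, fun h => hy (h.1 hx)⟩⟩
  · intro e he
    induction e with
    | _ x y =>
      rw [mem_cutset_iff] at he ⊢
      refine ⟨he.1, fun hs => he.2 ⟨fun hx => ?_, fun hy => ?_⟩⟩
      · by_contra hy
        exact hcut hx hy he.1 hs
      · by_contra hx
        exact hcut hy hx he.1.symm hs.symm
  · obtain ⟨x, y, hx, hy, hxy⟩ := exists_adj_of_connected hG
      (T := {x | (sideGraph G S).Reachable v x}) (SimpleGraph.Reachable.refl v)
      (fun h => hn (SimpleGraph.Reachable.symm h))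
    have hs := hcut hx hy hxy
    have := hsub (mem_cutset_iff.2 ⟨hxy, hs⟩)
    rw [mem_cutset_iff] at this
    refine this.2 ⟨fun hux => ?_, fun huy => ?_⟩
    · exact absurd (SimpleGraph.Reachable.trans hux (SimpleGraph.Reachable.symm hx)) hn
    · have h1 := sideGraph_reachable_side hx
      have h2 := sideGraph_reachable_side huy
      tauto

/-- If `δ(T) ⊆ δ(S)`, no edge within a side crosses `T`, so membership in `T` is constant on each
connected side. A non-empty `δ(T)` then forces `T` to separate the two sides, whence `δ(S) ⊆ δ(T)`.
Connectedness of `G` plays no role here. -/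
theorem SidesConnected.isMinimalCut (h : SidesConnected G S) : IsMinimalCut G S := by
  rintro ⟨T, ⟨e, he⟩, hTS⟩
  have hT : ∀ {u v}, (u ∈ S ↔ v ∈ S) → (u ∈ T ↔ v ∈ T) := by
    intro u v huv
    obtain ⟨w⟩ := h u v huv
    clear huv
    induction w with
    | nil => rfl
    | cons hadj _ ih =>
      refine Iff.trans ?_ ih
      by_contra hn
      have := hTS.1 (mem_cutset_iff.2 ⟨hadj.1, hn⟩)
      exact (mem_cutset_iff.1 this).2 hadj.2
  induction e with
  | _ x y =>
    have hx := mem_cutset_iff.1 he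
    have hxS := mem_cutset_iff.1 (hTS.1 he)
    refine hTS.2 fun e' he' => ?_
    induction e' with
    | _ u v =>
      rw [mem_cutset_iff] at he' ⊢
      refine ⟨he'.1, ?_⟩
      by_cases hux : u ∈ S ↔ x ∈ S
      · have hvy : v ∈ S ↔ y ∈ S := by tauto
        have := hT hux
        have := hT hvy
        tauto
      · have huy : u ∈ S ↔ y ∈ S := by tauto
        have hvx : v ∈ S ↔ x ∈ S := by tauto
        have := hT huy
        have := hT hvx
        tauto

/-- Connectedness of both sides is carried along a map that respects the sides. -/
theorem SidesConnected.of_map (h : SidesConnected G S) (r : V → V)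
    (hr : ∀ u v, (sideGraph G S).Adj u v → (sideGraph G S').Reachable (r u) (r v))
    (hr' : ∀ v, ∃ u, (v ∈ S' ↔ u ∈ S) ∧ (sideGraph G S').Reachable v (r u)) :
    SidesConnected G S' := by
  have key : ∀ u v, (u ∈ S ↔ v ∈ S) → (sideGraph G S').Reachable (r u) (r v) := by
    intro u v huv
    obtain ⟨w⟩ := h u v huv
    clear huv
    induction w with
    | nil => exact .refl _
    | cons hadj _ ih => exact (hr _ _ hadj).trans ih
  intro u v huv
  obtain ⟨u', h1, h2⟩ := hr' u
  obtain ⟨v', h3, h4⟩ := hr' v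
  exact h2.trans ((key u' v' (h1.symm.trans (huv.trans h3))).trans h4.symm)

section Size

open Classical

variable [Fintype V] (G) (S)

/-- The number of edges of a cut, as a sum over the vertices. -/
noncomputable def cutSize : ℕ :=
  ∑ u, (Finset.univ.filter fun v => G.Adj u v ∧ u ∈ S ∧ v ∉ S).card

/-- Every cut edge has exactly one orientation from `S` to the other side. -/
theorem ncard_cutset : (cutset G S).ncard = cutSize G S := by
  let P : Finset (V × V) := Finset.univ.filter fun p => G.Adj p.1 p.2 ∧ p.1 ∈ S ∧ p.2 ∉ S
  have h1 : cutset G S = (fun p : V × V => s(p.1, p.2)) '' (P : Set (V × V)) := by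
    ext e
    constructor
    · rintro ⟨he, u, hu, v, hv, rfl⟩
      exact ⟨(u, v), by simpa [P] using ⟨he, hu, hv⟩, rfl⟩
    · rintro ⟨⟨u, v⟩, hp, rfl⟩
      have : G.Adj u v ∧ u ∈ S ∧ v ∉ S := by simpa [P] using hp
      exact ⟨this.1, u, this.2.1, v, this.2.2, rfl⟩
  rw [h1, Set.InjOn.ncard_image, Set.ncard_coe_finset, cutSize, Finset.card_filter,
    Fintype.sum_prod_type]
  · simp_rw [Finset.card_filter]
  · rintro ⟨u, v⟩ hp ⟨u', v'⟩ hp' e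
    have h : G.Adj u v ∧ u ∈ S ∧ v ∉ S := by simpa [P] using hp
    have h' : G.Adj u' v' ∧ u' ∈ S ∧ v' ∉ S := by simpa [P] using hp'
    rcases Sym2.eq_iff.1 e with ⟨rfl, rfl⟩ | ⟨rfl, rfl⟩
    · rfl
    · exact absurd h.2.1 h'.2.2

end Size

end Cuts

/-! ### Twins and types -/

section Twins

variable {V : Type*} (G : SimpleGraph V)

/-- `u` and `v` have the same closed neighbourhood. -/
def Tw (u v : V) : Prop := ∀ w, (G.Adj u w ∨ u = w) ↔ (G.Adj v w ∨ v = w)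

/-- `w` is a neighbour of `u` that is not a twin. -/
def OuterAdj (u w : V) : Prop := G.Adj u w ∧ ¬ Tw G u w

/-- `u` and `v` have the same type: the same neighbours that are not twins. -/
def SameType (u v : V) : Prop := ∀ w, OuterAdj G u w ↔ OuterAdj G v w

/-- `X` is a union of types. -/
def TypeClosed (X : Set V) : Prop := ∀ u v, SameType G u v → u ∈ X → v ∈ X

variable {G} {u v w u' v' : V}

theorem Tw.refl (u : V) : Tw G u u := fun _ => Iff.rfl
theorem Tw.symm (h : Tw G u v) : Tw G v u := fun w => (h w).symm
theorem Tw.trans (h : Tw G u v) (h' : Tw G v w) : Tw G u w := fun x => (h x).trans (h' x)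

theorem Tw.adj (h : Tw G u v) (hne : u ≠ v) : G.Adj u v := by
  have := h v
  tauto

/-- Adjacency or equality is a relation between twin classes: replace one end at a time. -/
theorem Tw.closed (hu : Tw G u u') (hv : Tw G v v') (h : G.Adj u v ∨ u = v) :
    G.Adj u' v' ∨ u' = v' := by
  have h1 := (hu v).1 h
  have h2 := (hv u').1 (by rcases h1 with h | h; exacts [.inl h.symm, .inr h.symm])
  rcases h2 with h | h
  exacts [.inl h.symm, .inr h.symm]

theorem SameType.refl (u : V) : SameType G u u := fun _ => Iff.rfl
theorem SameType.symm (h : SameType G u v) : SameType G v u := fun w => (h w).symm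
theorem SameType.trans (h : SameType G u v) (h' : SameType G v w) : SameType G u w :=
  fun x => (h x).trans (h' x)

theorem OuterAdj.symm (h : OuterAdj G u w) : OuterAdj G w u := ⟨h.1.symm, fun h' => h.2 h'.symm⟩

theorem Tw.sameType (h : Tw G u v) : SameType G u v := by
  have key : ∀ {u v : V}, Tw G u v → ∀ w, OuterAdj G u w → OuterAdj G v w := by
    intro u v h w hw
    refine ⟨?_, fun h' => hw.2 (h.trans h')⟩
    rcases (h w).1 (.inl hw.1) with h' | rfl
    · exact h'
    · exact absurd h hw.2
  exact fun w => ⟨key h w, key h.symm w⟩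

/-- Adjacency between non-twins is a relation between types, by symmetry and replacing one end at a
time. -/
theorem OuterAdj.congr (h : OuterAdj G u v) (hu : SameType G u u') (hv : SameType G v v') :
    OuterAdj G u' v' :=
  ((hv u').1 ((hu v).1 h).symm).symm

theorem trueTwins_iff : TrueTwins G u v ↔ G.Adj u v ∧ Tw G u v := by
  refine and_congr_right fun _ => ?_
  rw [Set.ext_iff]
  refine forall_congr' fun w => ?_
  simp only [Set.mem_insert_iff, SimpleGraph.mem_neighborSet]
  rw [or_comm, eq_comm, or_comm (a := w = v), eq_comm (a := w)]

theorem isTwinCover_iff {X : Set V} :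
    IsTwinCover G X ↔ ∀ u v, OuterAdj G u v → u ∈ X ∨ v ∈ X := by
  simp only [IsTwinCover, trueTwins_iff, OuterAdj]
  refine forall₂_congr fun u v => ?_
  tauto

/-- The types that are contained in a twin-cover form a twin-cover. -/
theorem IsTwinCover.core {X : Set V} (h : IsTwinCover G X) :
    IsTwinCover G {u | ∀ v, SameType G u v → v ∈ X} := by
  rw [isTwinCover_iff] at h ⊢
  intro u v huv
  by_contra hn
  simp only [Set.mem_ofPred_eq, not_or, not_forall] at hn
  -- If neither type lies in `X`, each has a representative outside `X`, and these are still outer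
  -- neighbours, hence uncovered.
  obtain ⟨⟨u', hu, hu'⟩, v', hv, hv'⟩ := hn
  rcases h u' v' (huv.congr hu hv) with h | h
  exacts [hu' h, hv' h]

theorem typeClosed_core (X : Set V) : TypeClosed G {u | ∀ v, SameType G u v → v ∈ X} :=
  fun _ _ huv hu w hw => hu w (huv.trans hw)

theorem twinCoverNumber_le [Finite V] {X : Set V} (h : IsTwinCover G X) :
    twinCoverNumber G ≤ X.ncard := Nat.sInf_le ⟨X, h, rfl⟩

/-- The core of a minimum twin-cover is a twin-cover contained in it, so it is also minimum. -/
theorem exists_twinCover [Finite V] (G : SimpleGraph V) :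
    ∃ X, IsTwinCover G X ∧ TypeClosed G X ∧ X.ncard = twinCoverNumber G := by
  obtain ⟨X, hX, hc⟩ : twinCoverNumber G ∈ {m | ∃ X : Set V, IsTwinCover G X ∧ X.ncard = m} :=
    Nat.sInf_mem ⟨_, Set.univ, fun u v _ => .inl trivial, rfl⟩
  refine ⟨_, hX.core, typeClosed_core X, le_antisymm ?_ (twinCoverNumber_le hX.core)⟩
  rw [← hc]
  exact Set.ncard_le_ncard fun u hu => hu u (.refl u)

end Twins

/-! ### Exchanging vertices of the same type -/

section Exchange

open Classical

variable {V : Type*} {G : SimpleGraph V} {X S S' : Set V}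

theorem outerAdj_of_mem (hX : TypeClosed G X) {u w : V} (hu : u ∉ X) (hw : w ∈ X)
    (h : G.Adj u w) : OuterAdj G u w :=
  ⟨h, fun ht => hu (hX w u ht.symm.sameType hw)⟩

theorem tw_of_notMem (hX : IsTwinCover G X) {u w : V} (hu : u ∉ X) (hw : w ∉ X)
    (h : G.Adj u w) : Tw G u w := by
  by_contra hn
  rcases isTwinCover_iff.1 hX u w ⟨h, hn⟩ with h | h <;> contradiction

/-- Until it first enters `X`, the walk stays among twins of `u`, so the vertex of `X` it enters is
already a neighbour of `u`. -/
theorem exists_adj_mem_of_walk (hX : TypeClosed G X) (hX' : IsTwinCover G X) {u t : V}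
    (w : (sideGraph G S).Walk u t) (hu : u ∉ X) (ht : t ∈ X) :
    ∃ x ∈ X, G.Adj u x ∧ (x ∈ S ↔ u ∈ S) := by
  induction w with
  | nil => exact absurd ht hu
  | @cons a b c h w ih =>
    by_cases hb : b ∈ X
    · exact ⟨b, hb, h.1, h.2.symm⟩
    · obtain ⟨x, hx, hbx, hs⟩ := ih hb ht
      refine ⟨x, hx, ?_, hs.trans h.2.symm⟩
      exact ((tw_of_notMem hX' hu hb h.1).sameType x |>.2 (outerAdj_of_mem hX hb hx hbx)).1

/-- The exchange argument. A map `r` fixes `X` and sends any other `u` to a vertex of its type whose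
position relative to `S'` is that of `u` relative to `S`. Edges between `X` and the rest survive,
since adjacency to `X` depends only on the type, and edges outside `X` collapse. Vertices missed by
`r` are attached through neighbours in `X`, which exist because both sides meet `X`. -/
theorem SidesConnected.of_types (hX : TypeClosed G X) (hX' : IsTwinCover G X)
    (h : SidesConnected G S) (h1 : ∃ x ∈ X, x ∈ S) (h2 : ∃ x ∈ X, x ∉ S)
    (hXS : ∀ u ∈ X, u ∈ S' ↔ u ∈ S)
    (ht : ∀ u ∉ X, ((∃ v, SameType G u v ∧ v ∈ S') ↔ ∃ v, SameType G u v ∧ v ∈ S) ∧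
      ((∃ v, SameType G u v ∧ v ∉ S') ↔ ∃ v, SameType G u v ∧ v ∉ S)) :
    SidesConnected G S' := by
  have e1 : ∀ u ∉ X, ∃ v, SameType G u v ∧ (v ∈ S' ↔ u ∈ S) := by
    intro u hu
    by_cases hs : u ∈ S
    · obtain ⟨v, hv, hv'⟩ := (ht u hu).1.2 ⟨u, .refl u, hs⟩
      exact ⟨v, hv, by tauto⟩
    · obtain ⟨v, hv, hv'⟩ := (ht u hu).2.2 ⟨u, .refl u, hs⟩
      exact ⟨v, hv, by tauto⟩
  have e2 : ∀ u ∉ X, ∃ v, SameType G u v ∧ (v ∈ S ↔ u ∈ S') := by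
    intro u hu
    by_cases hs : u ∈ S'
    · obtain ⟨v, hv, hv'⟩ := (ht u hu).1.1 ⟨u, .refl u, hs⟩
      exact ⟨v, hv, by tauto⟩
    · obtain ⟨v, hv, hv'⟩ := (ht u hu).2.1 ⟨u, .refl u, hs⟩
      exact ⟨v, hv, by tauto⟩
  have cl : ∀ {u v}, SameType G u v → u ∉ X → v ∉ X := fun huv hu hv => hu (hX _ _ huv.symm hv)
  -- The choice is made from a predicate that depends only on the type and the side of `u`, so twins
  -- on one side get the same image.
  let r : V → V := fun u => if u ∈ X then u
    else @Classical.epsilon V ⟨u⟩ fun v => SameType G u v ∧ (v ∈ S' ↔ u ∈ S)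
  have hrX : ∀ u ∈ X, r u = u := fun u hu => if_pos hu
  have hr : ∀ u ∉ X, SameType G u (r u) ∧ (r u ∈ S' ↔ u ∈ S) := by
    intro u hu
    simp only [r, if_neg hu]
    exact @Classical.epsilon_spec_aux V ⟨u⟩ _ (e1 u hu)
  have hr2 : ∀ u v, u ∈ X → v ∉ X → (sideGraph G S).Adj u v → (sideGraph G S').Adj (r u) (r v) := by
    intro u v hu hv huv
    rw [hrX u hu]
    have := (outerAdj_of_mem hX hv hu huv.1.symm).congr (hr v hv).1 (.refl u)
    exact ⟨this.1.symm, (hXS u hu).trans (huv.2.trans (hr v hv).2.symm)⟩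
  refine h.of_map r (fun u v huv => ?_) fun v => ?_
  · by_cases hu : u ∈ X <;> by_cases hv : v ∈ X
    · rw [hrX u hu, hrX v hv]
      exact SimpleGraph.Adj.reachable (show (sideGraph G S').Adj u v from
        ⟨huv.1, (hXS u hu).trans (huv.2.trans (hXS v hv).symm)⟩)
    · exact (hr2 u v hu hv huv).reachable
    · exact (hr2 v u hv hu huv.symm).symm.reachable
    · have hty := (tw_of_notMem hX' hu hv huv.1).sameType
      have : r u = r v := by
        simp only [r, if_neg hu, if_neg hv]
        congr 1
        funext w
        have : SameType G u w ↔ SameType G v w := ⟨hty.symm.trans, hty.trans⟩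
        rw [this, huv.2]
      rw [this]
  · by_cases hv : v ∈ X
    · exact ⟨v, hXS v hv, by rw [hrX v hv]⟩
    · obtain ⟨u, hvu, hus⟩ := e2 v hv
      have hu := cl hvu hv
      refine ⟨u, hus.symm, ?_⟩
      -- A walk from `u` to `X` within its side yields a neighbour `x` of `u` in `X`; both `v` and
      -- `r u` have the type of `u`, so `x` links them.
      obtain ⟨t, htX, htS⟩ : ∃ t ∈ X, (u ∈ S ↔ t ∈ S) := by
        obtain ⟨x, hx, hx'⟩ := h1
        obtain ⟨y, hy, hy'⟩ := h2
        by_cases hs : u ∈ S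
        · exact ⟨x, hx, by tauto⟩
        · exact ⟨y, hy, by tauto⟩
      obtain ⟨w⟩ := h u t htS
      obtain ⟨x, hx, hux, hxs⟩ := exists_adj_mem_of_walk hX hX' w hu htX
      have o1 := outerAdj_of_mem hX hu hx hux
      have o2 := o1.congr hvu.symm (.refl x)
      have o3 := o1.congr (hr u hu).1 (.refl x)
      have a1 : (sideGraph G S').Adj v x := ⟨o2.1, by rw [hXS x hx, hxs, hus]⟩
      have a2 : (sideGraph G S').Adj (r u) x := ⟨o3.1, by rw [hXS x hx, hxs, (hr u hu).2]⟩
      exact a1.reachable.trans a2.reachable.symm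

end Exchange

/-! ### Canonical cuts -/

section Canonical

open Classical

variable {V : Type*} [LinearOrder V] (G : SimpleGraph V)

/-- `u` is the first vertex of its type. -/
def IsFirst (u : V) : Prop := ∀ v, v < u → ¬ SameType G u v

variable {G} in
theorem IsFirst.eq {u v : V} (hu : IsFirst G u) (hv : IsFirst G v) (h : SameType G u v) : u = v := by
  rcases lt_trichotomy u v with h' | h' | h'
  · exact absurd h.symm (hv u h')
  · exact h'
  · exact absurd h (hu v h')

/-- The digits that encode a cut. -/
noncomputable def encode (X S : Set V) (u : V) : ℕ :=
  if u ∈ X then if u ∈ S then 1 else 0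
  else if IsFirst G u then
    if ∀ v, SameType G u v → v ∈ S then 1 else if ∀ v, SameType G u v → v ∉ S then 0 else 2
  else 0

variable {G} in
theorem encode_eq_one {X S : Set V} {u : V} (hu : u ∈ X) : encode G X S u = 1 ↔ u ∈ S := by
  simp [encode, hu]

variable [Fintype V]

/-- The digit in `P` of the type of `u` is `i`. -/
def TypeDigit (P : V → ℕ) (i : ℕ) (u : V) : Prop := ∃ v, IsFirst G v ∧ SameType G u v ∧ P v = i

/-- Where the part of `S` in the twin-cover `X` is given by the digits `1` of `P`, the cut gets
larger if `u` is added after the earlier and before the later vertices outside `X`. -/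
def Prefers (X : Set V) (P : V → ℕ) (u : V) : Prop :=
  (Finset.univ.filter fun w => G.Adj u w ∧ ((w ∉ X ∧ w < u) ∨ (w ∈ X ∧ P w = 1))).card <
    (Finset.univ.filter fun w => G.Adj u w ∧ ((w ∉ X ∧ u < w) ∨ (w ∈ X ∧ P w ≠ 1))).card

/-- The number of twins of `u`, including `u`. -/
noncomputable def twins (u : V) : ℕ := (Finset.univ.filter fun w => Tw G u w).card

/-- `u` is the first vertex with the most twins in its type. -/
def IsBig (u : V) : Prop :=
  ∀ v, SameType G u v → twins G v < twins G u ∨ (twins G v = twins G u ∧ u ≤ v)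

/-- Either all or none of the vertices of the type of `u` prefer to be added. -/
def Uniform (X : Set V) (P : V → ℕ) (u : V) : Prop :=
  (∀ v, SameType G u v → Prefers G X P v) ∨ ∀ v, SameType G u v → ¬ Prefers G X P v

/-- The cut encoded by the digits `P`. -/
def canonicalSet (X : Set V) (P : V → ℕ) : Set V :=
  {u | (u ∈ X ∧ P u = 1) ∨ (u ∉ X ∧ (TypeDigit G P 1 u ∨
    (TypeDigit G P 2 u ∧ ¬ (Prefers G X P u ↔ (IsBig G u ∧ Uniform G X P u)))))}

variable {G} {X S S' : Set V}

theorem exists_isFirst (u : V) : ∃ v, IsFirst G v ∧ SameType G u v := by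
  obtain ⟨v, hv, hmin⟩ := Finset.exists_min_image (Finset.univ.filter fun v => SameType G u v) id
    ⟨u, by simpa using SameType.refl u⟩
  have hv' : SameType G u v := by simpa using hv
  refine ⟨v, fun w hw h => ?_, hv'⟩
  have := hmin w (by simpa using hv'.trans h)
  exact absurd hw (not_lt.2 this)

theorem typeDigit_encode_one (hX : TypeClosed G X) {u : V} (hu : u ∉ X) :
    TypeDigit G (encode G X S) 1 u ↔ ∀ v, SameType G u v → v ∈ S := by
  constructor
  · rintro ⟨v, hv, huv, h⟩ w hw
    have hvX : v ∉ X := fun h => hu (hX v u huv.symm h)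
    simp only [encode, hvX, hv, if_true, if_false] at h
    by_contra hw'
    rw [if_neg fun h => hw' (h w (huv.symm.trans hw))] at h
    split_ifs at h
    omega
  · intro h
    obtain ⟨v, hv, huv⟩ := exists_isFirst (G := G) u
    have hvX : v ∉ X := fun h => hu (hX v u huv.symm h)
    refine ⟨v, hv, huv, ?_⟩
    simp only [encode, hvX, hv, if_true, if_false]
    rw [if_pos fun w hw => h w (huv.trans hw)]

theorem typeDigit_encode_two (hX : TypeClosed G X) {u : V} (hu : u ∉ X) :
    TypeDigit G (encode G X S) 2 u ↔
      (∃ v, SameType G u v ∧ v ∈ S) ∧ ∃ v, SameType G u v ∧ v ∉ S := by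
  constructor
  · rintro ⟨v, hv, huv, h⟩
    have hvX : v ∉ X := fun h => hu (hX v u huv.symm h)
    simp only [encode, hvX, hv, if_true, if_false] at h
    split_ifs at h with h1 h2 <;> try omega
    push Not at h1 h2
    obtain ⟨w, hw, hw'⟩ := h1
    obtain ⟨x, hx, hx'⟩ := h2
    exact ⟨⟨x, huv.trans hx, hx'⟩, w, huv.trans hw, hw'⟩
  · rintro ⟨⟨x, hx, hx'⟩, w, hw, hw'⟩
    obtain ⟨v, hv, huv⟩ := exists_isFirst (G := G) u
    have hvX : v ∉ X := fun h => hu (hX v u huv.symm h)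
    refine ⟨v, hv, huv, ?_⟩
    simp only [encode, hvX, hv, if_true, if_false]
    rw [if_neg fun h => hw' (h w (huv.symm.trans hw)),
      if_neg fun h => h x (huv.symm.trans hx) hx']

theorem mem_canonicalSet_of_mem {P : V → ℕ} {u : V} (hu : u ∈ X) :
    u ∈ canonicalSet G X P ↔ P u = 1 := by
  simp [canonicalSet, hu]

theorem exists_isBig (u : V) : ∃ v, SameType G u v ∧ IsBig G v := by
  obtain ⟨v, hv, hmax⟩ := Finset.exists_max_image (Finset.univ.filter fun v => SameType G u v)
    (twins G) ⟨u, by simpa using SameType.refl u⟩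
  obtain ⟨w, hw, hmin⟩ := Finset.exists_min_image
    (Finset.univ.filter fun w => SameType G u w ∧ twins G w = twins G v) id ⟨v, by simpa using hv⟩
  simp only [Finset.mem_filter, Finset.mem_univ, true_and] at hv hmax hw hmin
  refine ⟨w, hw.1, fun x hx => ?_⟩
  have hux := hw.1.trans hx
  rcases lt_or_eq_of_le (hmax x hux) with h | h
  · exact .inl (hw.2 ▸ h)
  · exact .inr ⟨h.trans hw.2.symm, hmin x ⟨hux, h⟩⟩

theorem IsBig.eq {u v : V} (hu : IsBig G u) (hv : IsBig G v) (h : SameType G u v) : u = v := by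
  rcases hu v h with h1 | ⟨h1, h2⟩ <;> rcases hv u h.symm with h3 | ⟨h3, h4⟩
  · omega
  · omega
  · omega
  · exact le_antisymm h2 h4

theorem IsBig.le {u v : V} (hu : IsBig G u) (h : SameType G u v) : twins G v ≤ twins G u := by
  rcases hu v h with h | h <;> omega

/-- The vertices of the type of `u` in a canonical set, when the type is split. -/
theorem canonicalSet_split (hX : TypeClosed G X) {u : V} (hu : u ∉ X)
    (h1 : ∃ v, SameType G u v ∧ v ∈ S) (h2 : ∃ v, SameType G u v ∧ v ∉ S) :
    let P := encode G X S
    let S' := canonicalSet G X P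
    ((∃ v, SameType G u v ∧ Prefers G X P v) ∧ (∃ v, SameType G u v ∧ ¬ Prefers G X P v) ∧
      ∀ v, SameType G u v → (v ∈ S' ↔ Prefers G X P v)) ∨
    ((∀ v, SameType G u v → ¬ Prefers G X P v) ∧ ∃ w, SameType G u w ∧ IsBig G w ∧
      ∀ v, SameType G u v → (v ∈ S' ↔ v = w)) ∨
    ((∀ v, SameType G u v → Prefers G X P v) ∧ ∃ w, SameType G u w ∧ IsBig G w ∧
      ∀ v, SameType G u v → (v ∈ S' ↔ v ≠ w)) := by
  intro P S'
  -- In a split type the negated equivalence acts as an exclusive or: membership is preference,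
  -- reversed at the big vertex if the type is uniform.
  have key : ∀ v, SameType G u v →
      (v ∈ S' ↔ ¬ (Prefers G X P v ↔ (IsBig G v ∧ Uniform G X P u))) := by
    intro v hv
    have hvX : v ∉ X := fun h => hu (hX v u hv.symm h)
    have d1 : ¬ TypeDigit G P 1 v := by
      rw [typeDigit_encode_one hX hvX]
      obtain ⟨w, hw, hw'⟩ := h2
      exact fun h => hw' (h w (hv.symm.trans hw))
    have d2 : TypeDigit G P 2 v := by
      rw [typeDigit_encode_two hX hvX]
      obtain ⟨w, hw, hw'⟩ := h2
      obtain ⟨x, hx, hx'⟩ := h1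
      exact ⟨⟨x, hv.symm.trans hx, hx'⟩, w, hv.symm.trans hw, hw'⟩
    have hU : Uniform G X P v ↔ Uniform G X P u := by
      have : ∀ w, SameType G v w ↔ SameType G u w :=
        fun w => ⟨fun h => hv.trans h, fun h => hv.symm.trans h⟩
      simp only [Uniform, this]
    simp only [S', canonicalSet, Set.mem_ofPred_eq, hvX, d1, d2, hU, not_false_eq_true, true_and,
      false_and, false_or]
  obtain ⟨w, hw, hbig⟩ := exists_isBig (G := G) u
  have hbig' : ∀ v, SameType G u v → (IsBig G v ↔ v = w) := fun v hv =>
    ⟨fun h => h.eq hbig (hv.symm.trans hw), fun h => h ▸ hbig⟩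
  by_cases hU : Uniform G X P u
  · right
    rcases id hU with hU' | hU'
    · refine .inr ⟨hU', w, hw, hbig, fun v hv => ?_⟩
      rw [key v hv, hbig' v hv]
      have := hU' v hv
      tauto
    · refine .inl ⟨hU', w, hw, hbig, fun v hv => ?_⟩
      rw [key v hv, hbig' v hv]
      have := hU' v hv
      tauto
  · left
    have hU' := hU
    simp only [Uniform, not_or, not_forall, not_not] at hU'
    obtain ⟨⟨x, hx, hx'⟩, y, hy, hy'⟩ := hU'
    refine ⟨⟨y, hy, hy'⟩, ⟨x, hx, hx'⟩, fun v hv => ?_⟩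
    rw [key v hv]
    simp [hU]

theorem canonicalSet_of_all (hX : TypeClosed G X) {u : V} (hu : u ∉ X)
    (h : ∀ v, SameType G u v → v ∈ S) : u ∈ canonicalSet G X (encode G X S) :=
  .inr ⟨hu, .inl ((typeDigit_encode_one hX hu).2 h)⟩

theorem canonicalSet_of_none (hX : TypeClosed G X) {u : V} (hu : u ∉ X)
    (h : ∀ v, SameType G u v → v ∉ S) : u ∉ canonicalSet G X (encode G X S) := by
  rintro (h' | ⟨_, h' | h'⟩)
  · exact hu h'.1
  · exact h u (.refl u) ((typeDigit_encode_one hX hu).1 h' u (.refl u))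
  · obtain ⟨v, hv, hv'⟩ := ((typeDigit_encode_two hX hu).1 h'.1).1
    exact h v hv hv'

/-- Supplies the hypothesis of `SidesConnected.of_types`: reversing one vertex keeps a uniform split
type split. -/
theorem canonicalSet_type (hX : TypeClosed G X) {u : V} (hu : u ∉ X) :
    let S' := canonicalSet G X (encode G X S)
    ((∃ v, SameType G u v ∧ v ∈ S') ↔ ∃ v, SameType G u v ∧ v ∈ S) ∧
      ((∃ v, SameType G u v ∧ v ∉ S') ↔ ∃ v, SameType G u v ∧ v ∉ S) := by
  intro S'
  by_cases h1 : ∃ v, SameType G u v ∧ v ∈ S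
  swap
  · push Not at h1
    have : ∀ v, SameType G u v → v ∉ S' := fun v hv =>
      canonicalSet_of_none hX (fun h => hu (hX v u hv.symm h)) fun w hw => h1 w (hv.trans hw)
    refine ⟨?_, ?_⟩
    · constructor <;> rintro ⟨v, hv, hv'⟩
      exacts [absurd hv' (this v hv), absurd hv' (h1 v hv)]
    · exact ⟨fun _ => ⟨u, .refl u, h1 u (.refl u)⟩, fun _ => ⟨u, .refl u, this u (.refl u)⟩⟩
  by_cases h2 : ∃ v, SameType G u v ∧ v ∉ S
  swap
  · push Not at h2
    have : ∀ v, SameType G u v → v ∈ S' := fun v hv =>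
      canonicalSet_of_all hX (fun h => hu (hX v u hv.symm h)) fun w hw => h2 w (hv.trans hw)
    refine ⟨?_, ?_⟩
    · exact ⟨fun _ => ⟨u, .refl u, h2 u (.refl u)⟩, fun _ => ⟨u, .refl u, this u (.refl u)⟩⟩
    · constructor <;> rintro ⟨v, hv, hv'⟩
      exacts [absurd (this v hv) hv', absurd (h2 v hv) hv']
  simp only [h1, h2, iff_true]
  -- A split type has at least two vertices, so one remains besides the reversed vertex.
  have hne : ∀ w, ∃ v, SameType G u v ∧ v ≠ w := by
    obtain ⟨x, hx, hx'⟩ := h1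
    obtain ⟨y, hy, hy'⟩ := h2
    intro w
    by_cases hxw : x = w
    · exact ⟨y, hy, fun h => hy' (by rwa [h, ← hxw])⟩
    · exact ⟨x, hx, hxw⟩
  rcases canonicalSet_split hX hu h1 h2 with ⟨⟨v, hv, hv'⟩, ⟨w, hw, hw'⟩, h⟩ | ⟨_, w, hw, _, h⟩ |
    ⟨_, w, hw, _, h⟩
  · exact ⟨⟨v, hv, (h v hv).2 hv'⟩, w, hw, fun h' => hw' ((h w hw).1 h')⟩
  · obtain ⟨v, hv, hv'⟩ := hne w
    exact ⟨⟨w, hw, (h w hw).2 rfl⟩, v, hv, fun h' => hv' ((h v hv).1 h')⟩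
  · obtain ⟨v, hv, hv'⟩ := hne w
    exact ⟨⟨v, hv, (h v hv).2 hv'⟩, w, hw, fun h' => (h w hw).1 h' rfl⟩

end Canonical

/-! ### Sizes of cuts -/

section Optimum

/-- The number of edges of a cut at `c` twins, `j` of them in `S`, that have `a` neighbours in `S`
and `b` neighbours outside `S`, apart from the twins. -/
def twinCut (a b c j : ℤ) : ℤ := j * (b + (c - j)) + (c - j) * a

/-- Concavity in `j`: raising `J` to `J + 1` gains `c - 1 + b - a - 2 * J`. The hypotheses say that
the last increment gained and that the next one would not. -/
theorem twinCut_le {a b c j J : ℤ} (h0 : 0 ≤ j) (hc : j ≤ c)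
    (h1 : 0 < J → 2 * (J - 1) < c - 1 + b - a) (h2 : J < c → c - 1 + b - a ≤ 2 * J) :
    twinCut a b c j ≤ twinCut a b c J := by
  have key : twinCut a b c J - twinCut a b c j = (J - j) * (c + b - a - j - J) := by
    unfold twinCut; ring
  rcases lt_trichotomy j J with h | h | h
  · have := h1 (by omega)
    have : 0 ≤ (J - j) * (c + b - a - j - J) := mul_nonneg (by omega) (by omega)
    omega
  · rw [h]
  · have := h2 (by omega)
    have : 0 ≤ (J - j) * (c + b - a - j - J) :=
      mul_nonneg_of_nonpos_of_nonpos (by omega) (by omega)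
    omega

/-- Exchanging the two sides reduces the case where all vertices prefer `S` to the case where none
does. -/
theorem twinCut_swap (a b c j : ℤ) : twinCut b a c (c - j) = twinCut a b c j := by
  unfold twinCut; ring

/-- No first vertex of a clique brings a gain, yet some clique `l` must give one. By concavity,
emptying the other cliques and keeping one vertex of `l` does no harm; that vertex changes the sum
by `c l - 1 + b - a`, which is largest for a largest clique `k`. -/
theorem sum_twinCut_le {ι : Type*} {I : Finset ι} {a b : ℤ} {c j J : ι → ℤ} {k l : ι}
    (hk : k ∈ I) (hkc : ∀ i ∈ I, c i ≤ c k) (hJk : J k = 1) (hJ : ∀ i ∈ I, i ≠ k → J i = 0)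
    (hj : ∀ i ∈ I, 0 ≤ j i) (hc : ∀ i ∈ I, c i - 1 + b - a ≤ 0) (hl : l ∈ I) (hjl : 1 ≤ j l) :
    ∑ i ∈ I, twinCut a b (c i) (j i) ≤ ∑ i ∈ I, twinCut a b (c i) (J i) := by
  classical
  have h1 : ∀ i ∈ I, twinCut a b (c i) (j i) ≤
      twinCut a b (c i) 0 + if i = l then c l - 1 + b - a else 0 := by
    intro i hi
    have h := hc i hi
    have h' := hj i hi
    split_ifs with hil
    · subst hil
      have : twinCut a b (c i) 0 + (c i - 1 + b - a) - twinCut a b (c i) (j i) =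
        (j i - 1) * (j i + 1 - (c i + b - a)) := by unfold twinCut; ring
      have : 0 ≤ (j i - 1) * (j i + 1 - (c i + b - a)) := mul_nonneg (by omega) (by omega)
      omega
    · have : twinCut a b (c i) 0 - twinCut a b (c i) (j i) =
        j i * (j i - (c i + b - a)) := by unfold twinCut; ring
      have : 0 ≤ j i * (j i - (c i + b - a)) := by
        rcases h'.eq_or_lt with h' | h'
        · simp [← h']
        · exact mul_nonneg (by omega) (by omega)
      omega
  have h2 : ∀ i ∈ I, twinCut a b (c i) (J i) =
      twinCut a b (c i) 0 + if i = k then c k - 1 + b - a else 0 := by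
    intro i hi
    split_ifs with hik
    · subst hik; rw [hJk]; unfold twinCut; ring
    · rw [hJ i hi hik, add_zero]
  rw [Finset.sum_congr rfl h2]
  refine (Finset.sum_le_sum h1).trans ?_
  rw [Finset.sum_add_distrib, Finset.sum_add_distrib, Finset.sum_ite_eq', Finset.sum_ite_eq',
    if_pos hl, if_pos hk]
  have := hkc l hl
  omega

end Optimum

/-! ### Splitting the size of a cut over types and cliques of twins -/

section Value

open Classical

variable {V : Type*} [Fintype V] (G : SimpleGraph V)

/-- The number of neighbours of `u` with property `Y`. -/
noncomputable def nbrs (Y : V → Prop) (u : V) : ℕ :=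
  (Finset.univ.filter fun w => G.Adj u w ∧ Y w).card

theorem nbrs_eq (X S : Set V) (u : V) : nbrs G (fun w => w ∈ X ∧ w ∈ S) u =
    (Finset.univ.filter fun w => G.Adj u w ∧ w ∈ X ∧ w ∈ S).card := by
  unfold nbrs; congr!

theorem nbrs_eq' (X S : Set V) (u : V) : nbrs G (fun w => w ∈ X ∧ w ∉ S) u =
    (Finset.univ.filter fun w => G.Adj u w ∧ w ∈ X ∧ w ∉ S).card := by
  unfold nbrs; congr!

/-- The edges of the cut `T` at a vertex `u` outside of `X`, where the edges between twins are
counted at the end in `T`. -/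
noncomputable def contrib (X S T : Set V) (u : V) : ℕ :=
  if u ∈ T then nbrs G (fun w => w ∈ X ∧ w ∉ S) u + (Finset.univ.filter fun v => Tw G u v ∧ v ∉ T).card
  else nbrs G (fun w => w ∈ X ∧ w ∈ S) u

variable {G} {X S T : Set V}

/-- Edges inside `X` depend only on the trace on `X`. Edges between `X` and the rest are charged to
the end outside `X`; edges outside `X` join twins and are charged to the end in `T`. -/
theorem cutSize_eq (hX : TypeClosed G X) (hX' : IsTwinCover G X) (hT : ∀ u ∈ X, u ∈ T ↔ u ∈ S) :
    cutSize G T = ∑ u ∈ Finset.univ.filter (· ∈ X),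
      ((Finset.univ.filter (· ∈ X)).filter fun v => G.Adj u v ∧ u ∈ S ∧ v ∉ S).card +
      ∑ u ∈ Finset.univ.filter (· ∉ X), contrib G X S T u := by
  have h1 : ∀ u ∈ Finset.univ.filter (· ∈ X),
      (Finset.univ.filter fun v => G.Adj u v ∧ u ∈ T ∧ v ∉ T).card =
      ((Finset.univ.filter (· ∈ X)).filter fun v => G.Adj u v ∧ u ∈ S ∧ v ∉ S).card +
      ∑ v ∈ Finset.univ.filter (· ∉ X), if G.Adj u v ∧ u ∈ T ∧ v ∉ T then 1 else 0 := by
    intro u hu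
    have huX : u ∈ X := by simpa using hu
    rw [Finset.card_filter, ← Finset.sum_filter_add_sum_filter_not _ (· ∈ X), Finset.card_filter]
    congr 1
    refine Finset.sum_congr rfl fun v hv => ?_
    rw [hT u huX, hT v (by simpa using hv)]
  have h2 : ∀ u ∈ Finset.univ.filter (· ∉ X),
      (∑ v ∈ Finset.univ.filter (· ∈ X), if G.Adj v u ∧ v ∈ T ∧ u ∉ T then 1 else 0) +
      (Finset.univ.filter fun v => G.Adj u v ∧ u ∈ T ∧ v ∉ T).card = contrib G X S T u := by
    intro u hu
    have huX : u ∉ X := by simpa using hu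
    rw [← Finset.card_filter, Finset.filter_filter, contrib]
    split_ifs with huT
    · rw [nbrs_eq', Finset.filter_eq_empty_iff.2 (by simp [huT]), Finset.card_empty, zero_add,
        ← Finset.card_union_of_disjoint]
      · congr 1
        ext v
        simp only [Finset.mem_filter, Finset.mem_univ, true_and, Finset.mem_union, huT]
        by_cases hv : v ∈ X
        · have : ¬ Tw G u v := fun h => huX (hX v u h.symm.sameType hv)
          simp [hv, hT v hv, this]
        · constructor
          · exact fun h => .inr ⟨tw_of_notMem hX' huX hv h.1, h.2⟩
          · rintro (h | h)
            · exact absurd h.2.1 hv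
            · exact ⟨h.1.adj (by rintro rfl; exact h.2 huT), h.2⟩
      · rw [Finset.disjoint_filter]
        exact fun v _ h h' => huX (hX v u h'.1.symm.sameType h.2.1)
    · have e : (Finset.univ.filter fun v => G.Adj u v ∧ u ∈ T ∧ v ∉ T) = ∅ := by simp [huT]
      rw [_root_.nbrs_eq, e, Finset.card_empty, add_zero]
      congr 1
      ext v
      simp only [Finset.mem_filter, Finset.mem_univ, true_and]
      constructor
      · exact fun h => ⟨h.2.1.symm, h.1, (hT v h.1).1 h.2.2.1⟩
      · exact fun h => ⟨h.2.1, h.1.symm, (hT v h.2.1).2 h.2.2, huT⟩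
  rw [cutSize, ← Finset.sum_filter_add_sum_filter_not _ (· ∈ X), Finset.sum_congr rfl h1,
    Finset.sum_add_distrib, Finset.sum_comm (s := Finset.univ.filter (· ∈ X)), add_assoc,
    ← Finset.sum_add_distrib, Finset.sum_congr rfl h2]

theorem SameType.nbrs_eq (hX : TypeClosed G X) {u v : V} (hu : u ∉ X) (h : SameType G u v)
    {Y : V → Prop} (hY : ∀ w, Y w → w ∈ X) : nbrs G Y u = nbrs G Y v := by
  have hv : v ∉ X := fun hv => hu (hX v u h.symm hv)
  unfold nbrs
  congr 1
  ext w
  simp only [Finset.mem_filter, Finset.mem_univ, true_and]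
  refine and_congr_left fun hw => ⟨fun h' => ?_, fun h' => ?_⟩
  · exact ((h w).1 (outerAdj_of_mem hX hu (hY w hw) h')).1
  · exact ((h w).2 (outerAdj_of_mem hX hv (hY w hw) h')).1

/-- The contribution of a type, grouped by cliques of twins. -/
theorem exists_sum_contrib (hX : TypeClosed G X) {u : V} (hu : u ∉ X) :
    ∃ I : Finset (Finset V),
      (∀ K, K ∈ I ↔ ∃ x, SameType G u x ∧ K = Finset.univ.filter (Tw G x)) ∧ ∀ T,
    ((∑ v ∈ Finset.univ.filter (SameType G u), contrib G X S T v : ℕ) : ℤ) =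
      ∑ K ∈ I, twinCut (nbrs G (fun w => w ∈ X ∧ w ∈ S) u) (nbrs G (fun w => w ∈ X ∧ w ∉ S) u) K.card (K.filter (· ∈ T)).card := by
  refine ⟨(Finset.univ.filter (SameType G u)).image fun v => Finset.univ.filter (Tw G v),
    fun K => by simp [eq_comm], fun T => ?_⟩
  rw [← Finset.sum_fiberwise_of_maps_to (g := fun v => Finset.univ.filter (Tw G v))
    (t := (Finset.univ.filter (SameType G u)).image fun v => Finset.univ.filter (Tw G v))
    fun v hv => Finset.mem_image_of_mem _ hv]
  push_cast
  refine Finset.sum_congr rfl fun K hK => ?_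
  obtain ⟨x, hx, rfl⟩ := Finset.mem_image.1 hK
  have hux : SameType G u x := by simpa using hx
  -- Grouping the type by twin class: the fibre over the class of `x` is that class, since twins
  -- have the same type.
  have hfib : ((Finset.univ.filter (SameType G u)).filter fun v =>
      Finset.univ.filter (Tw G v) = Finset.univ.filter (Tw G x)) = Finset.univ.filter (Tw G x) := by
    ext v
    simp only [Finset.mem_filter, Finset.mem_univ, true_and]
    constructor
    · rintro ⟨_, h⟩
      have : v ∈ Finset.univ.filter (Tw G v) := by simpa using Tw.refl v
      rw [h] at this
      simpa using this
    · intro h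
      refine ⟨hux.trans h.sameType, ?_⟩
      ext w
      simp only [Finset.mem_filter, Finset.mem_univ, true_and]
      exact ⟨h.trans, h.symm.trans⟩
  rw [hfib]
  have hval : ∀ v ∈ Finset.univ.filter (Tw G x), (contrib G X S T v : ℤ) =
      if v ∈ T then (nbrs G (fun w => w ∈ X ∧ w ∉ S) u : ℤ) +
        ((Finset.univ.filter (Tw G x)).filter (· ∉ T)).card else (nbrs G (fun w => w ∈ X ∧ w ∈ S) u : ℤ) := by
    intro v hv
    have hxv : Tw G x v := by simpa using hv
    have huv := hux.trans hxv.sameType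
    rw [contrib, huv.nbrs_eq hX hu (fun _ h => h.1), huv.nbrs_eq hX hu (fun _ h => h.1),
      Finset.filter_filter]
    have : ∀ w, Tw G v w ↔ Tw G x w := fun w => ⟨hxv.trans, hxv.symm.trans⟩
    simp only [this]
    split_ifs <;> push_cast <;> rfl
  rw [Finset.sum_congr rfl hval, Finset.sum_ite, Finset.sum_const, Finset.sum_const,
    nsmul_eq_mul, nsmul_eq_mul, twinCut]
  have := Finset.card_filter_add_card_filter_not (s := Finset.univ.filter (Tw G x)) (· ∈ T)
  have e : (((Finset.univ.filter (Tw G x)).filter (· ∉ T)).card : ℤ) =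
    (Finset.univ.filter (Tw G x)).card - ((Finset.univ.filter (Tw G x)).filter (· ∈ T)).card := by
    omega
  rw [e]

/-- To compare two cuts that agree on `X`, compare the contributions of each type. -/
theorem cutSize_le (hX : TypeClosed G X) (hX' : IsTwinCover G X) (hT : ∀ u ∈ X, u ∈ T ↔ u ∈ S)
    (h : ∀ u ∉ X, ∑ v ∈ Finset.univ.filter (SameType G u), contrib G X S S v ≤
      ∑ v ∈ Finset.univ.filter (SameType G u), contrib G X S T v) :
    cutSize G S ≤ cutSize G T := by
  rw [cutSize_eq hX hX' hT, cutSize_eq hX hX' (S := S) fun _ _ => Iff.rfl]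
  refine Nat.add_le_add_left ?_ _
  -- The types are the fibres of the map to outer neighbourhoods.
  rw [← Finset.sum_fiberwise _ fun u => Finset.univ.filter (OuterAdj G u),
    ← Finset.sum_fiberwise (Finset.univ.filter (· ∉ X)) (fun u => Finset.univ.filter (OuterAdj G u))
      (contrib G X S T)]
  refine Finset.sum_le_sum fun D _ => ?_
  by_cases hD : ∃ u ∉ X, Finset.univ.filter (OuterAdj G u) = D
  · obtain ⟨u, hu, rfl⟩ := hD
    have : ((Finset.univ.filter (· ∉ X)).filter fun v =>
        Finset.univ.filter (OuterAdj G v) = Finset.univ.filter (OuterAdj G u)) =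
        Finset.univ.filter (SameType G u) := by
      ext v
      simp only [Finset.mem_filter, Finset.mem_univ, true_and, Finset.ext_iff]
      constructor
      · exact fun h => fun w => (h.2 w).symm
      · exact fun h => ⟨fun hv => hu (hX v u h.symm hv), fun w => (h w).symm⟩
    rw [this]
    exact h u hu
  · push Not at hD
    rw [Finset.sum_eq_zero, Finset.sum_eq_zero] <;>
    · intro v hv
      simp only [Finset.mem_filter, Finset.mem_univ, true_and] at hv
      exact absurd hv.2 (hD v hv.1)

end Value

/-! ### Optimality of canonical cuts -/

section Compare

open Classical

variable {V : Type*} [Fintype V] [LinearOrder V] {G : SimpleGraph V} {X S : Set V}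

/-- Outside `X` all neighbours of `u` are twins, and no twin of `u` lies in `X`, so preference
depends only on the rank of `u` among its twins and its neighbours in `X`. -/
theorem prefers_iff (hX : TypeClosed G X) (hX' : IsTwinCover G X) {u : V} (hu : u ∉ X) :
    Prefers G X (encode G X S) u ↔
      (Finset.univ.filter fun w => Tw G u w ∧ w < u).card + nbrs G (fun w => w ∈ X ∧ w ∈ S) u <
      (Finset.univ.filter fun w => Tw G u w ∧ u < w).card + nbrs G (fun w => w ∈ X ∧ w ∉ S) u := by
  have hnot : ∀ w ∈ X, ¬ Tw G u w := fun w hw h => hu (hX w u h.symm.sameType hw)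
  rw [Prefers, nbrs_eq, nbrs_eq', ← Finset.card_union_of_disjoint, ← Finset.card_union_of_disjoint]
  · refine iff_of_eq ?_
    congr 2 <;>
    · ext w
      simp only [Finset.mem_filter, Finset.mem_univ, true_and, Finset.mem_union]
      by_cases hw : w ∈ X
      · simp [hw, hnot w hw, encode_eq_one]
      · simp only [hw, not_false_eq_true, true_and, false_and, or_false, and_false]
        refine and_congr_left fun hlt => ⟨tw_of_notMem hX' hu hw, fun h => h.adj ?_⟩
        first | exact hlt.ne' | exact hlt.ne
  · rw [Finset.disjoint_filter]
    exact fun w _ h h' => hnot w h'.2.1 h.1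
  · rw [Finset.disjoint_filter]
    exact fun w _ h h' => hnot w h'.2.1 h.1

theorem card_twins_split (u : V) :
    (Finset.univ.filter fun w => Tw G u w ∧ w < u).card +
      (Finset.univ.filter fun w => Tw G u w ∧ u < w).card + 1 = twins G u := by
  have h1 : (Finset.univ.filter fun w => Tw G u w) =
      insert u ((Finset.univ.filter fun w => Tw G u w ∧ w < u) ∪
        (Finset.univ.filter fun w => Tw G u w ∧ u < w)) := by
    ext w
    simp only [Finset.mem_filter, Finset.mem_univ, true_and, Finset.mem_insert, Finset.mem_union]
    constructor
    · intro h
      rcases lt_trichotomy w u with h' | h' | h'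
      exacts [.inr (.inl ⟨h, h'⟩), .inl h', .inr (.inr ⟨h, h'⟩)]
    · rintro (rfl | h | h)
      exacts [Tw.refl _, h.1, h.1]
  rw [twins, h1, Finset.card_insert_of_notMem (by simp), Finset.card_union_of_disjoint]
  rw [Finset.disjoint_filter]
  exact fun w _ h h' => lt_asymm h.2 h'.2

/-- The number of twins that prefer to be added is optimal. -/
theorem prefers_optimal (hX : TypeClosed G X) (hX' : IsTwinCover G X) {u : V} (hu : u ∉ X) :
    let J : ℤ := ((Finset.univ.filter (Tw G u)).filter (Prefers G X (encode G X S))).card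
    let m : ℤ := (Finset.univ.filter (Tw G u)).card - 1 + nbrs G (fun w => w ∈ X ∧ w ∉ S) u - nbrs G (fun w => w ∈ X ∧ w ∈ S) u
    (0 < J → 2 * (J - 1) < m) ∧ (J < (Finset.univ.filter (Tw G u)).card → m ≤ 2 * J) := by
  set P := encode G X S
  set K := Finset.univ.filter (Tw G u) with hK
  intro J m
  have mem : ∀ v, v ∈ K ↔ Tw G u v := fun v => by simp [hK]
  -- With `p` earlier twins, `v` prefers to be added exactly when `2 * p < m`, so the preferring
  -- twins form an initial segment of the clique.
  have key : ∀ v ∈ K, ∃ p : ℕ, p = (K.filter (· < v)).card ∧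
      (Prefers G X P v ↔ 2 * (p : ℤ) < m) := by
    intro v hv
    have huv := (mem v).1 hv
    have hty := huv.sameType
    have hvX : v ∉ X := fun h => hu (hX v u hty.symm h)
    refine ⟨_, rfl, ?_⟩
    rw [prefers_iff hX hX' hvX, ← hty.nbrs_eq hX hu (fun _ h => h.1),
      ← hty.nbrs_eq hX hu (fun _ h => h.1)]
    have h1 := card_twins_split (G := G) v
    have e : ∀ w, Tw G v w ↔ Tw G u w := fun w => ⟨huv.trans, huv.symm.trans⟩
    have h2 : twins G v = K.card := by simp only [twins, e, hK]
    have h3 : (Finset.univ.filter fun w => Tw G v w ∧ w < v) = K.filter (· < v) := by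
      simp only [e, hK, Finset.filter_filter]
    rw [h3] at h1 ⊢
    omega
  constructor
  · intro hJ
    obtain ⟨v, hv, hmax⟩ := Finset.exists_max_image (K.filter (Prefers G X P)) id
      (Finset.card_pos.1 (by omega))
    rw [Finset.mem_filter] at hv
    obtain ⟨p, hp, hiff⟩ := key v hv.1
    have h := hiff.1 hv.2
    -- The last preferring twin has rank at least `J - 1`.
    have : (K.filter (Prefers G X P)).card ≤ (insert v (K.filter (· < v))).card := by
      refine Finset.card_le_card fun w hw => ?_
      rcases (hmax w hw).lt_or_eq with h' | h'
      · exact Finset.mem_insert_of_mem (Finset.mem_filter.2 ⟨(Finset.mem_filter.1 hw).1, h'⟩)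
      · exact Finset.mem_insert.2 (.inl h')
    have := this.trans (Finset.card_insert_le _ _)
    omega
  · intro hJ
    have hsplit := Finset.card_filter_add_card_filter_not (s := K) (Prefers G X P)
    obtain ⟨v, hv, hmin⟩ := Finset.exists_min_image (K.filter fun w => ¬ Prefers G X P w) id
      (Finset.card_pos.1 (by omega))
    rw [Finset.mem_filter] at hv
    obtain ⟨p, hp, hiff⟩ := key v hv.1
    have h := mt hiff.2 hv.2
    -- The first twin that does not prefer has rank at most `J`.
    have : (K.filter (· < v)).card ≤ (K.filter (Prefers G X P)).card := by
      refine Finset.card_le_card fun w hw => ?_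
      rw [Finset.mem_filter] at hw ⊢
      refine ⟨hw.1, ?_⟩
      by_contra hn
      exact absurd hw.2 (not_lt.2 (hmin w (Finset.mem_filter.2 ⟨hw.1, hn⟩)))
    omega

theorem contrib_canonicalSet (hX : TypeClosed G X) (hX' : IsTwinCover G X) {u : V} (hu : u ∉ X) :
    ∑ v ∈ Finset.univ.filter (SameType G u), contrib G X S S v ≤
      ∑ v ∈ Finset.univ.filter (SameType G u),
        contrib G X S (canonicalSet G X (encode G X S)) v := by
  set S' := canonicalSet G X (encode G X S) with hS'
  have cl : ∀ v, SameType G u v → v ∉ X := fun v h hv => hu (hX v u h.symm hv)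
  have same : (∀ v, SameType G u v → (v ∈ S' ↔ v ∈ S)) →
      ∑ v ∈ Finset.univ.filter (SameType G u), contrib G X S S v ≤
        ∑ v ∈ Finset.univ.filter (SameType G u), contrib G X S S' v := by
    intro h
    refine Finset.sum_le_sum fun v hv => ?_
    have huv : SameType G u v := by simpa using hv
    rw [contrib, contrib]
    have e : (Finset.univ.filter fun w => Tw G v w ∧ w ∉ S') =
        Finset.univ.filter fun w => Tw G v w ∧ w ∉ S := by
      ext w
      simp only [Finset.mem_filter, Finset.mem_univ, true_and]
      exact and_congr_right fun hw => not_congr (h w (huv.trans hw.sameType))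
    simp only [h v huv, e]
    exact le_rfl
  by_cases h1 : ∃ v, SameType G u v ∧ v ∈ S
  swap
  · push Not at h1
    exact same fun v hv => iff_of_false
      (canonicalSet_of_none hX (cl v hv) fun w hw => h1 w (hv.trans hw)) (h1 v hv)
  by_cases h2 : ∃ v, SameType G u v ∧ v ∉ S
  swap
  · push Not at h2
    exact same fun v hv => iff_of_true
      (canonicalSet_of_all hX (cl v hv) fun w hw => h2 w (hv.trans hw)) (h2 v hv)
  have hcast : ∀ {m n : ℕ}, (m : ℤ) ≤ n → m ≤ n := fun h => by exact_mod_cast h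
  refine hcast ?_
  obtain ⟨I, hI, hsum⟩ := exists_sum_contrib (S := S) hX hu
  rw [hsum, hsum]
  set a : ℤ := ((nbrs G (fun w => w ∈ X ∧ w ∈ S) u : ℕ) : ℤ) with ha
  set b : ℤ := ((nbrs G (fun w => w ∈ X ∧ w ∉ S) u : ℕ) : ℤ) with hb
  have memI : ∀ K ∈ I, ∃ x, SameType G u x ∧ K = Finset.univ.filter (Tw G x) :=
    fun K => (hI K).1
  have Imem : ∀ x, SameType G u x → Finset.univ.filter (Tw G x) ∈ I := fun x hx =>
    (hI _).2 ⟨x, hx, rfl⟩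
  have typ : ∀ K ∈ I, ∀ v ∈ K, SameType G u v := by
    intro K hK v hv
    obtain ⟨x, hx, rfl⟩ := memI K hK
    exact hx.trans (Tw.sameType (by simpa using hv))
  have eqK : ∀ K ∈ I, ∀ w ∈ K, K = Finset.univ.filter (Tw G w) := by
    intro K hK v hv
    obtain ⟨x, hx, rfl⟩ := memI K hK
    have hxv : Tw G x v := by simpa using hv
    ext w
    simp only [Finset.mem_filter, Finset.mem_univ, true_and]
    exact ⟨hxv.symm.trans, hxv.trans⟩
  have opt : ∀ K ∈ I, (0 < ((K.filter (Prefers G X (encode G X S))).card : ℤ) →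
      2 * (((K.filter (Prefers G X (encode G X S))).card : ℤ) - 1) < K.card - 1 + b - a) ∧
      (((K.filter (Prefers G X (encode G X S))).card : ℤ) < K.card →
        K.card - 1 + b - a ≤ 2 * ((K.filter (Prefers G X (encode G X S))).card : ℤ)) := by
    intro K hK
    obtain ⟨x, hx, rfl⟩ := memI K hK
    have := prefers_optimal (S := S) hX hX' (cl x hx)
    rwa [← hx.nbrs_eq hX hu (fun _ h => h.1), ← hx.nbrs_eq hX hu (fun _ h => h.1)] at this
  have pos : ∀ K ∈ I, 0 < K.card := by
    intro K hK
    obtain ⟨x, hx, rfl⟩ := memI K hK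
    exact Finset.card_pos.2 ⟨x, by simpa using Tw.refl x⟩
  have self : ∀ w, w ∈ Finset.univ.filter (Tw G w) := fun w => by simpa using Tw.refl w
  rcases canonicalSet_split hX hu h1 h2 with ⟨-, -, h⟩ | ⟨hp, w, hw, hbig, h⟩ | ⟨hp, w, hw, hbig, h⟩
  · refine Finset.sum_le_sum fun K hK => ?_
    have e : K.filter (· ∈ S') = K.filter (Prefers G X (encode G X S)) :=
      Finset.filter_congr fun v hv => h v (typ K hK v hv)
    rw [e]
    exact twinCut_le (by omega) (by exact_mod_cast Finset.card_filter_le _ _) (opt K hK).1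
      (opt K hK).2
  · obtain ⟨x, hx, hxS⟩ := h1
    refine sum_twinCut_le (k := Finset.univ.filter (Tw G w)) (l := Finset.univ.filter (Tw G x))
      (Imem w hw) (fun K hK => ?_) ?_ (fun K hK hne => ?_) (fun K _ => by omega) (fun K hK => ?_)
      (Imem x hx) ?_
    · obtain ⟨y, hy, rfl⟩ := memI K hK
      exact_mod_cast hbig.le (hw.symm.trans hy)
    · have : (Finset.univ.filter (Tw G w)).filter (· ∈ S') = {w} := by
        ext v
        rw [Finset.mem_filter, Finset.mem_singleton]
        constructor
        · exact fun hv => (h v (typ _ (Imem w hw) v hv.1)).1 hv.2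
        · rintro rfl
          exact ⟨self v, (h v hw).2 rfl⟩
      rw [this]; simp
    · rw [Finset.filter_eq_empty_iff.2 fun v hv hvS => hne ?_]
      · simp
      · rw [← (h v (typ K hK v hv)).1 hvS]
        exact eqK K hK v hv
    -- Optimality with `J = 0` says that the first vertex of each clique brings no gain.
    · have := (opt K hK).2
      rw [Finset.filter_eq_empty_iff.2 fun v hv => hp v (typ K hK v hv)] at this
      have hc := pos K hK
      simp only [Finset.card_empty] at this
      have := this (by exact_mod_cast hc)
      omega
    · have : 0 < ((Finset.univ.filter (Tw G x)).filter (· ∈ S)).card :=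
        Finset.card_pos.2 ⟨x, Finset.mem_filter.2 ⟨self x, hxS⟩⟩
      omega
  · obtain ⟨x, hx, hxS⟩ := h2
    -- From here the vertices outside the cut set are counted, with the roles of `a` and `b`
    -- exchanged.
    simp only [← twinCut_swap a b]
    have hle : ∀ (K : Finset V) (T : Set V), ((K.filter (· ∈ T)).card : ℤ) ≤ K.card := fun K T => by
      exact_mod_cast Finset.card_filter_le _ _
    refine sum_twinCut_le (k := Finset.univ.filter (Tw G w)) (l := Finset.univ.filter (Tw G x))
      (Imem w hw) (fun K hK => ?_) ?_ (fun K hK hne => ?_) (fun K _ => by linarith [hle K S])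
      (fun K hK => ?_) (Imem x hx) ?_
    · obtain ⟨y, hy, rfl⟩ := memI K hK
      exact_mod_cast hbig.le (hw.symm.trans hy)
    · have : (Finset.univ.filter (Tw G w)).filter (· ∈ S') = (Finset.univ.filter (Tw G w)).erase w := by
        ext v
        rw [Finset.mem_filter, Finset.mem_erase, and_comm]
        exact and_congr_left fun hv => h v (typ _ (Imem w hw) v hv)
      rw [this, Finset.card_erase_of_mem (self w)]
      have := pos _ (Imem w hw)
      omega
    · rw [Finset.filter_true_of_mem fun v hv => (h v (typ K hK v hv)).2 fun hvw => hne ?_]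
      · simp
      · rw [← hvw]
        exact eqK K hK v hv
    · have := (opt K hK).1
      rw [Finset.filter_true_of_mem fun v hv => hp v (typ K hK v hv)] at this
      have hc := pos K hK
      have := this (by exact_mod_cast hc)
      omega
    · have h1 := Finset.card_filter_add_card_filter_not (s := Finset.univ.filter (Tw G x)) (· ∈ S)
      have : 0 < ((Finset.univ.filter (Tw G x)).filter (· ∉ S)).card :=
        Finset.card_pos.2 ⟨x, Finset.mem_filter.2 ⟨self x, hxS⟩⟩
      omega

/-- A minimal cut that divides the twin-cover is no larger than some canonical minimal cut. -/
theorem canonicalSet_isMinimalCut (hG : G.Connected) (hX : TypeClosed G X) (hX' : IsTwinCover G X)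
    (hS : IsMinimalCut G S) (h1 : ∃ x ∈ X, x ∈ S) (h2 : ∃ x ∈ X, x ∉ S) :
    IsMinimalCut G (canonicalSet G X (encode G X S)) ∧
      cutSize G S ≤ cutSize G (canonicalSet G X (encode G X S)) := by
  have hXS : ∀ u ∈ X, u ∈ canonicalSet G X (encode G X S) ↔ u ∈ S := fun u hu => by
    rw [mem_canonicalSet_of_mem hu, encode_eq_one hu]
  refine ⟨?_, cutSize_le hX hX' hXS fun u hu => contrib_canonicalSet hX hX' hu⟩
  exact ((hS.sidesConnected hG).of_types hX hX' h1 h2 hXS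
    fun u hu => canonicalSet_type hX hu).isMinimalCut

end Compare

/-! ### Cuts with a side that misses the twin-cover, and the list of candidates -/

section Candidates

open Classical

variable {V : Type*} {G : SimpleGraph V} {X S T : Set V}

/-- A side of a minimal cut that misses the twin-cover is a clique of twins. -/
theorem SidesConnected.tw_of_disjoint (hX' : IsTwinCover G X) (h : SidesConnected G S)
    (hSX : ∀ x ∈ X, x ∉ S) {u v : V} (hu : u ∈ S) (hv : v ∈ S) : Tw G u v := by
  obtain ⟨w⟩ := h u v (iff_of_true hu hv)
  induction w with
  | nil => exact .refl _
  | @cons a b c hab _ ih =>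
    have hb : b ∈ S := hab.2.1 hu
    exact (tw_of_notMem hX' (fun h => hSX _ h hu) (fun h => hSX _ h hb) hab.1).trans (ih hb hv)

/-- Two non-empty proper subsets of a twin class are interchangeable: `r` sends `S` to one point of
`T`, the other vertices of `T` to a twin `z` outside `T`, and fixes the rest. Replacing vertices by
twins preserves closed adjacency. -/
theorem SidesConnected.of_twins {s : V} (h : SidesConnected G S) (hS : ∀ v ∈ S, Tw G s v)
    (hT : ∀ v ∈ T, Tw G s v) (hSne : S.Nonempty) (hTne : T.Nonempty) {z w : V} (hz : Tw G s z)
    (hzT : z ∉ T) (hw : Tw G s w) (hwS : w ∉ S) : SidesConnected G T := by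
  obtain ⟨x, hx⟩ := hSne
  obtain ⟨y, hy⟩ := hTne
  let r : V → V := fun u => if u ∈ S then y else if u ∈ T then z else u
  have hrS : ∀ u ∈ S, r u = y := fun u hu => if_pos hu
  have hr : ∀ u ∉ S, r u ∉ T ∧ Tw G u (r u) := by
    intro u hu
    simp only [r, if_neg hu]
    split_ifs with h
    · exact ⟨hzT, (hT u h).symm.trans hz⟩
    · exact ⟨h, .refl u⟩
  have step : ∀ u v, (u ∈ T ↔ v ∈ T) → (G.Adj u v ∨ u = v) → (sideGraph G T).Reachable u v := by
    rintro u v huv (h | rfl)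
    · exact SimpleGraph.Adj.reachable (show (sideGraph G T).Adj u v from ⟨h, huv⟩)
    · exact .refl _
  refine h.of_map r (fun u v huv => ?_) fun v => ?_
  · by_cases hu : u ∈ S
    · rw [hrS u hu, hrS v (huv.2.1 hu)]
    · have hv : v ∉ S := fun hv => hu (huv.2.2 hv)
      exact step _ _ (iff_of_false (hr u hu).1 (hr v hv).1)
        ((hr u hu).2.closed (hr v hv).2 (.inl huv.1))
  · by_cases hv : v ∈ T
    · refine ⟨x, iff_of_true hv hx, ?_⟩
      rw [hrS x hx]
      exact step _ _ (iff_of_true hv hy) ((hT v hv).closed (hT y hy) (.inr rfl))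
    · by_cases hvS : v ∈ S
      · refine ⟨w, iff_of_false hv hwS, step _ _ (iff_of_false hv (hr w hwS).1) ?_⟩
        exact (hS v hvS).closed (hw.trans (hr w hwS).2) (.inr rfl)
      · exact ⟨v, iff_of_false hv hvS, step _ _ (iff_of_false hv (hr v hvS).1)
          (Tw.closed (.refl v) (hr v hvS).2 (.inr rfl))⟩

variable [LinearOrder V]

variable (G) in

/-- The twins of `y` up to `y`. -/
def twinSegment (y : V) : Set V := {z | Tw G y z ∧ z ≤ y}

variable (G) in
/-- The number of digits for a vertex in the encoding of cuts. -/
noncomputable def radix (X : Set V) (u : V) : ℕ := if u ∈ X then 2 else if IsFirst G u then 3 else 1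

theorem encode_lt_radix (u : V) : encode G X S u < radix G X u := by
  unfold encode radix
  split_ifs <;> omega

/-- Initial segments attain every size: take the least `y` with at least `j` elements up to it;
fewer than `j` come strictly before. -/
theorem exists_card_filter_le (K : Finset V) {j : ℕ} (hj : 0 < j) (hjK : j ≤ K.card) :
    ∃ y ∈ K, (K.filter (· ≤ y)).card = j := by
  obtain ⟨m, hm, hmax⟩ := Finset.exists_max_image K id (Finset.card_pos.1 (by omega))
  have hmj : j ≤ (K.filter (· ≤ m)).card := by
    rwa [Finset.filter_true_of_mem (p := (· ≤ m)) hmax]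
  obtain ⟨y, hy, hmin⟩ := Finset.exists_min_image (K.filter fun y => j ≤ (K.filter (· ≤ y)).card) id
    ⟨m, Finset.mem_filter.2 ⟨hm, hmj⟩⟩
  rw [Finset.mem_filter] at hy
  refine ⟨y, hy.1, le_antisymm ?_ hy.2⟩
  have hlt : (K.filter (· < y)).card < j := by
    rcases (K.filter (· < y)).eq_empty_or_nonempty with h | h
    · rw [h]; exact hj
    · obtain ⟨z, hz, hzmax⟩ := Finset.exists_max_image _ id h
      rw [Finset.mem_filter] at hz
      by_contra hn
      have hsub : K.filter (· < y) ⊆ K.filter (· ≤ z) := fun w hw =>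
        Finset.mem_filter.2 ⟨(Finset.mem_filter.1 hw).1, hzmax w hw⟩
      have := hmin z (Finset.mem_filter.2 ⟨hz.1, (not_lt.1 hn).trans (Finset.card_le_card hsub)⟩)
      exact absurd hz.2 (not_lt.2 this)
  have hsub : K.filter (· ≤ y) ⊆ insert y (K.filter (· < y)) := by
    intro w hw
    rw [Finset.mem_filter] at hw
    rcases hw.2.eq_or_lt with h | h
    · exact Finset.mem_insert.2 (.inl h)
    · exact Finset.mem_insert_of_mem (Finset.mem_filter.2 ⟨hw.1, h⟩)
  have := (Finset.card_le_card hsub).trans (Finset.card_insert_le _ _)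
  omega

variable [Fintype V]

/-- All vertices of `T` share one closed neighbourhood, which contains `T`; hence the size depends
only on the cardinality of `T`. -/
theorem cutSize_of_twins {s : V} (hT : ∀ v ∈ T, Tw G s v) :
    cutSize G T = (Finset.univ.filter (· ∈ T)).card *
      ((Finset.univ.filter fun v => G.Adj s v ∨ s = v).card -
        (Finset.univ.filter (· ∈ T)).card) := by
  have h : ∀ u, (Finset.univ.filter fun v => G.Adj u v ∧ u ∈ T ∧ v ∉ T).card =
      if u ∈ T then (Finset.univ.filter fun v => G.Adj s v ∨ s = v).card -
        (Finset.univ.filter (· ∈ T)).card else 0 := by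
    intro u
    split_ifs with hu
    · rw [← Finset.card_sdiff_of_subset]
      · congr 1
        ext v
        simp only [Finset.mem_filter, Finset.mem_univ, true_and, Finset.mem_sdiff, hu]
        rw [hT u hu v]
        refine and_congr_left fun hv => ⟨.inl, ?_⟩
        rintro (h | rfl)
        exacts [h, absurd hu hv]
      · intro v hv
        simp only [Finset.mem_filter, Finset.mem_univ, true_and] at hv ⊢
        exact (hT v hv v).2 (.inr rfl)
    · simp [hu]
  rw [cutSize, Finset.sum_congr rfl fun u _ => h u, ← Finset.sum_filter, Finset.sum_const,
    smul_eq_mul]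

theorem exists_twinSegment (hX' : IsTwinCover G X) (hS : SidesConnected G S)
    (hSX : ∀ x ∈ X, x ∉ S) (hne : S.Nonempty) :
    ∃ y, IsMinimalCut G (twinSegment G y) ∧ cutSize G S ≤ cutSize G (twinSegment G y) := by
  obtain ⟨s, hs⟩ := hne
  have hST : ∀ v ∈ S, Tw G s v := fun v hv => hS.tw_of_disjoint hX' hSX hs hv
  set K := Finset.univ.filter (Tw G s) with hK
  have mem : ∀ v, v ∈ K ↔ Tw G s v := fun v => by simp [hK]
  have hsub : Finset.univ.filter (· ∈ S) ⊆ K := fun v hv => (mem v).2 (hST v (by simpa using hv))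
  obtain ⟨y, hy, hyc⟩ := exists_card_filter_le K (j := (Finset.univ.filter (· ∈ S)).card)
    (Finset.card_pos.2 ⟨s, by simpa using hs⟩) (Finset.card_le_card hsub)
  have hsy := (mem y).1 hy
  have hT : ∀ v ∈ twinSegment G y, Tw G s v := fun v hv => hsy.trans hv.1
  have hTK : Finset.univ.filter (· ∈ twinSegment G y) = K.filter (· ≤ y) := by
    ext v
    simp only [Finset.mem_filter, Finset.mem_univ, true_and, mem]
    exact ⟨fun h => ⟨hT v h, h.2⟩, fun h => ⟨hsy.symm.trans h.1, h.2⟩⟩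
  refine ⟨y, ?_, by rw [cutSize_of_twins hST, cutSize_of_twins hT, hTK, hyc]⟩
  -- If `S` is the whole class, the segment is `S` itself; otherwise both are proper subsets of the
  -- class and `SidesConnected.of_twins` applies.
  by_cases hfull : (Finset.univ.filter (· ∈ S)).card = K.card
  · have h1 := Finset.eq_of_subset_of_card_le hsub hfull.ge
    have h2 := Finset.eq_of_subset_of_card_le (Finset.filter_subset (· ≤ y) K) (by omega)
    rw [← hTK, ← h1] at h2
    have : twinSegment G y = S := by
      ext v
      simpa using Finset.ext_iff.1 h2 v
    rw [this]
    exact hS.isMinimalCut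
  · have hlt := lt_of_le_of_ne (Finset.card_le_card hsub) hfull
    obtain ⟨w, hw, hwS⟩ := Finset.exists_mem_notMem_of_card_lt_card hlt
    rw [← hyc, ← hTK] at hlt
    obtain ⟨z, hz, hzT⟩ := Finset.exists_mem_notMem_of_card_lt_card hlt
    exact (hS.of_twins hST hT ⟨s, hs⟩ ⟨y, .refl y, le_rfl⟩ ((mem z).1 hz) (by simpa using hzT)
      ((mem w).1 hw) (by simpa using hwS)).isMinimalCut

/-- Every minimal cut is no larger than one of the candidates. -/
theorem exists_candidate (hG : G.Connected) (hX : TypeClosed G X) (hX' : IsTwinCover G X)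
    (hS : IsMinimalCut G S) :
    (∃ y, IsMinimalCut G (twinSegment G y) ∧ cutSize G S ≤ cutSize G (twinSegment G y)) ∨
    ∃ P : V → ℕ, (∀ u, P u < radix G X u) ∧ IsMinimalCut G (canonicalSet G X P) ∧
      cutSize G S ≤ cutSize G (canonicalSet G X P) := by
  have case : ∀ S, IsMinimalCut G S → (∀ x ∈ X, x ∉ S) →
      (∃ y, IsMinimalCut G (twinSegment G y) ∧ cutSize G S ≤ cutSize G (twinSegment G y)) ∨
      ∃ P : V → ℕ, (∀ u, P u < radix G X u) ∧ IsMinimalCut G (canonicalSet G X P) ∧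
        cutSize G S ≤ cutSize G (canonicalSet G X P) := by
    intro S hS hSX
    rcases S.eq_empty_or_nonempty with rfl | hne
    -- The empty side is the canonical set of its own encoding.
    · right
      have : canonicalSet G X (encode G X ∅) = ∅ := by
        ext u
        simp only [Set.mem_empty_iff_false, iff_false]
        by_cases hu : u ∈ X
        · rw [mem_canonicalSet_of_mem hu, encode_eq_one hu]
          exact id
        · exact canonicalSet_of_none hX hu fun _ _ => id
      exact ⟨_, encode_lt_radix, by rwa [this], by rw [this]⟩
    · exact .inl (exists_twinSegment hX' (hS.sidesConnected hG) hSX hne)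
  by_cases h1 : ∃ x ∈ X, x ∈ S
  · by_cases h2 : ∃ x ∈ X, x ∉ S
    · exact .inr ⟨_, encode_lt_radix, canonicalSet_isMinimalCut hG hX hX' hS h1 h2⟩
    · push Not at h2
      -- A side that contains all of `X` is handled through its complement, which has the same
      -- cutset.
      have := case Sᶜ (isMinimalCut_compl.2 hS) fun x hx h => h (h2 x hx)
      rwa [← ncard_cutset, cutset_compl, ncard_cutset] at this
  · push Not at h1
    exact case S hS h1

/-! ### The number of candidates -/

/-- The outer neighbourhood of a vertex outside `X` is a subset of `X` and determines its type. -/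
theorem card_isFirst_notMem (hX' : IsTwinCover G X) :
    (Finset.univ.filter fun u => u ∉ X ∧ IsFirst G u).card ≤ 2 ^ X.ncard := by
  rw [Set.ncard_eq_toFinset_card', ← Finset.card_powerset]
  refine Finset.card_le_card_of_injOn (fun u => Finset.univ.filter (OuterAdj G u)) ?_ ?_
  · intro u hu
    simp only [Finset.coe_filter, Finset.mem_univ, true_and, Set.mem_ofPred_eq] at hu
    rw [Finset.mem_coe, Finset.mem_powerset]
    intro w hw
    rw [Set.mem_toFinset]
    exact (isTwinCover_iff.1 hX' u w (by simpa using hw)).resolve_left hu.1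
  · intro u hu v hv h
    simp only [Finset.coe_filter, Finset.mem_univ, true_and, Set.mem_ofPred_eq] at hu hv
    refine hu.2.eq hv.2 fun w => ?_
    simpa using Finset.ext_iff.1 h w

theorem prod_radix_le (hX' : IsTwinCover G X) :
    ∏ u, radix G X u ≤ 2 ^ X.ncard * 3 ^ 2 ^ X.ncard := by
  have h : ∀ u, radix G X u = (if u ∈ X then 2 else 1) * if u ∉ X ∧ IsFirst G u then 3 else 1 := by
    intro u
    unfold radix
    split_ifs <;> simp_all
  simp only [h]
  rw [Finset.prod_mul_distrib, ← Finset.prod_filter, ← Finset.prod_filter, Finset.prod_const,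
    Finset.prod_const]
  have e : (Finset.univ.filter (· ∈ X)).card = X.ncard := by
    rw [← Set.ncard_coe_finset]; simp
  rw [e]
  exact Nat.mul_le_mul_left _ (Nat.pow_le_pow_right (by omega) (card_isFirst_notMem hX'))

/-- Bounds the number of unions of types, including the types inside `X`: each such type has its
first vertex in `X`, where the radix is already `2`. -/
theorem prod_isFirst_le (hX' : IsTwinCover G X) :
    ∏ u, (if IsFirst G u then 2 else 1) ≤ 2 ^ X.ncard * 3 ^ 2 ^ X.ncard := by
  refine le_trans (Finset.prod_le_prod' fun u _ => ?_) (prod_radix_le hX')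
  unfold radix
  split_ifs <;> omega

end Candidates

/-! ### The predicates as tests on the memory

The array `3` holds a twin-cover `X`, the array `1` the digits `P`, and the array `4` a set `S`. -/

namespace Memory

open Classical

/-- `Tw` -/
def Twins (s : Memory) (u v : ℕ) : Prop :=
  ∀ w < s.reg 0, (s.Adj u w ∨ u = w) ↔ (s.Adj v w ∨ v = w)

/-- `OuterAdj` -/
def Outer (s : Memory) (u w : ℕ) : Prop := s.Adj u w ∧ ¬ s.Twins u w

/-- `SameType` -/
def Typ (s : Memory) (u v : ℕ) : Prop := ∀ w < s.reg 0, s.Outer u w ↔ s.Outer v w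

/-- `IsFirst` -/
def First (s : Memory) (u : ℕ) : Prop := ∀ v < s.reg 0, v < u → ¬ s.Typ u v

/-- `TypeDigit` -/
def Digit (s : Memory) (i u : ℕ) : Prop := ∃ v < s.reg 0, s.First v ∧ s.Typ u v ∧ s.arr 1 v = i

/-- `Prefers` -/
def Pref (s : Memory) (u : ℕ) : Prop :=
  ((Finset.range (s.reg 0)).filter fun w => s.Adj u w ∧
      ((s.arr 3 w ≠ 1 ∧ w < u) ∨ (s.arr 3 w = 1 ∧ s.arr 1 w = 1))).card <
    ((Finset.range (s.reg 0)).filter fun w => s.Adj u w ∧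
      ((s.arr 3 w ≠ 1 ∧ u < w) ∨ (s.arr 3 w = 1 ∧ s.arr 1 w ≠ 1))).card

/-- `twins` -/
noncomputable def numTwins (s : Memory) (u : ℕ) : ℕ :=
  ((Finset.range (s.reg 0)).filter (s.Twins u)).card

/-- `IsBig` -/
def Big (s : Memory) (u : ℕ) : Prop := ∀ v < s.reg 0, s.Typ u v →
  s.numTwins v < s.numTwins u ∨ (s.numTwins v = s.numTwins u ∧ u ≤ v)

/-- `Uniform` -/
def Unif (s : Memory) (u : ℕ) : Prop :=
  (∀ v < s.reg 0, s.Typ u v → s.Pref v) ∨ ∀ v < s.reg 0, s.Typ u v → ¬ s.Pref v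

/-- Membership in `canonicalSet` -/
def Canon (s : Memory) (u : ℕ) : Prop :=
  (s.arr 3 u = 1 ∧ s.arr 1 u = 1) ∨ (s.arr 3 u ≠ 1 ∧
    (s.Digit 1 u ∨ (s.Digit 2 u ∧ ¬ (s.Pref u ↔ (s.Big u ∧ s.Unif u)))))

/-- `IsTwinCover` for the set in array `4` -/
def Cover (s : Memory) : Prop :=
  ∀ u < s.reg 0, ∀ v < s.reg 0, s.Outer u v → s.arr 4 u = 1 ∨ s.arr 4 v = 1

/-- The size of the set in array `b` -/
noncomputable def count (s : Memory) (b : ℕ) : ℕ :=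
  ((Finset.range (s.reg 0)).filter fun u => s.arr b u = 1).card

/-- `cutSize` for the set in array `4` -/
noncomputable def cut (s : Memory) : ℕ := ∑ u ∈ Finset.range (s.reg 0),
  ((Finset.range (s.reg 0)).filter fun v => s.Adj u v ∧ s.arr 4 u = 1 ∧ s.arr 4 v ≠ 1).card

/-- `u` and `v` are on the same side of the cut in array `4`. -/
def Same (s : Memory) (u v : ℕ) : Prop := s.arr 4 u = 1 ↔ s.arr 4 v = 1

/-- `u` is the first vertex on its side. -/
def Start (s : Memory) (u : ℕ) : Prop :=
  u = 0 ∨ (¬ s.Same u 0 ∧ ∀ v < s.reg 0, v < u → s.Same v 0)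

end Memory

section Tests

open Classical

variable {α : Type} [Ctx α] {f g : α → ℕ}

theorem Pd.twins (hf : Fn f) (hg : Fn g) : Pd fun a => (Ctx.mem a).Twins (f a) (g a) :=
  .all (P := fun a w => ((Ctx.mem a).Adj (f a) w ∨ f a = w) ↔ ((Ctx.mem a).Adj (g a) w ∨ g a = w))
    (.iff (.or (.adj hf.weaken .var) (.eq hf.weaken .var))
      (.or (.adj hg.weaken .var) (.eq hg.weaken .var)))

theorem Pd.outer (hf : Fn f) (hg : Fn g) : Pd fun a => (Ctx.mem a).Outer (f a) (g a) :=
  .and (.adj hf hg) (.not (.twins hf hg))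

theorem Pd.typ (hf : Fn f) (hg : Fn g) : Pd fun a => (Ctx.mem a).Typ (f a) (g a) :=
  .all (P := fun a w => (Ctx.mem a).Outer (f a) w ↔ (Ctx.mem a).Outer (g a) w)
    (.iff (.outer hf.weaken .var) (.outer hg.weaken .var))

theorem Pd.first (hf : Fn f) : Pd fun a => (Ctx.mem a).First (f a) :=
  .all (P := fun a v => v < f a → ¬ (Ctx.mem a).Typ (f a) v)
    (.imp (.lt .var hf.weaken) (.not (.typ hf.weaken .var)))

theorem Pd.entry (b c : ℕ) (hb : b < 6) (hf : Fn f) : Pd fun a => (Ctx.mem a).arr b (f a) = c :=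
  .eq (.arr hb hf) (.const c)

theorem Pd.digit (i : ℕ) (hf : Fn f) : Pd fun a => (Ctx.mem a).Digit i (f a) :=
  .ex (P := fun a v => (Ctx.mem a).First v ∧ (Ctx.mem a).Typ (f a) v ∧ (Ctx.mem a).arr 1 v = i)
    (.and (.first .var) (.and (.typ hf.weaken .var) (.entry 1 i (by omega) .var)))

theorem Pd.pref (hf : Fn f) : Pd fun a => (Ctx.mem a).Pref (f a) :=
  .lt (Pd.count (P := fun a w => (Ctx.mem a).Adj (f a) w ∧ (((Ctx.mem a).arr 3 w ≠ 1 ∧ w < f a) ∨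
        ((Ctx.mem a).arr 3 w = 1 ∧ (Ctx.mem a).arr 1 w = 1)))
      (.and (.adj hf.weaken .var) (.or
        (.and (.not (.entry 3 1 (by omega) .var)) (.lt .var hf.weaken))
        (.and (.entry 3 1 (by omega) .var) (.entry 1 1 (by omega) .var)))))
    (Pd.count (P := fun a w => (Ctx.mem a).Adj (f a) w ∧ (((Ctx.mem a).arr 3 w ≠ 1 ∧ f a < w) ∨
        ((Ctx.mem a).arr 3 w = 1 ∧ (Ctx.mem a).arr 1 w ≠ 1)))
      (.and (.adj hf.weaken .var) (.or
        (.and (.not (.entry 3 1 (by omega) .var)) (.lt hf.weaken .var))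
        (.and (.entry 3 1 (by omega) .var) (.not (.entry 1 1 (by omega) .var))))))

theorem Fn.numTwins (hf : Fn f) : Fn fun a => (Ctx.mem a).numTwins (f a) :=
  Pd.count (P := fun a w => (Ctx.mem a).Twins (f a) w) (.twins hf.weaken .var)

theorem Pd.big (hf : Fn f) : Pd fun a => (Ctx.mem a).Big (f a) :=
  .all (P := fun a v => (Ctx.mem a).Typ (f a) v →
    (Ctx.mem a).numTwins v < (Ctx.mem a).numTwins (f a) ∨
      ((Ctx.mem a).numTwins v = (Ctx.mem a).numTwins (f a) ∧ f a ≤ v))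
    (.imp (.typ hf.weaken .var) (.or (.lt (.numTwins .var) (.numTwins hf.weaken))
      (.and (.eq (.numTwins .var) (.numTwins hf.weaken)) (.le hf.weaken .var))))

theorem Pd.unif (hf : Fn f) : Pd fun a => (Ctx.mem a).Unif (f a) :=
  .or (.all (P := fun a v => (Ctx.mem a).Typ (f a) v → (Ctx.mem a).Pref v)
      (.imp (.typ hf.weaken .var) (.pref .var)))
    (.all (P := fun a v => (Ctx.mem a).Typ (f a) v → ¬ (Ctx.mem a).Pref v)
      (.imp (.typ hf.weaken .var) (.not (.pref .var))))

theorem Pd.canon (hf : Fn f) : Pd fun a => (Ctx.mem a).Canon (f a) :=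
  .or (.and (.entry 3 1 (by omega) hf) (.entry 1 1 (by omega) hf))
    (.and (.not (.entry 3 1 (by omega) hf)) (.or (.digit 1 hf)
      (.and (.digit 2 hf) (.not (.iff (.pref hf) (.and (.big hf) (.unif hf)))))))

theorem Pd.cover : Pd fun a : α => (Ctx.mem a).Cover :=
  .all (P := fun a u => ∀ v < Ctx.size a, (Ctx.mem a).Outer u v →
      (Ctx.mem a).arr 4 u = 1 ∨ (Ctx.mem a).arr 4 v = 1)
    (.all (P := fun (a : α × ℕ) v => (Ctx.mem a).Outer a.2 v →
      (Ctx.mem a).arr 4 a.2 = 1 ∨ (Ctx.mem a).arr 4 v = 1)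
      (.imp (.outer Fn.var.weaken .var)
        (.or (.entry 4 1 (by omega) Fn.var.weaken) (.entry 4 1 (by omega) .var))))

theorem Fn.countOnes (b : ℕ) (hb : b < 6) : Fn fun a : α => (Ctx.mem a).count b :=
  Pd.count (P := fun a u => (Ctx.mem a).arr b u = 1) (.entry b 1 hb .var)

theorem Fn.cut : Fn fun a : α => (Ctx.mem a).cut :=
  Fn.sum (f := fun a : α × ℕ => ((Finset.range (Ctx.size a)).filter fun v =>
      (Ctx.mem a).Adj a.2 v ∧ (Ctx.mem a).arr 4 a.2 = 1 ∧ (Ctx.mem a).arr 4 v ≠ 1).card)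
    (Pd.count (P := fun (a : α × ℕ) v => (Ctx.mem a).Adj a.2 v ∧ (Ctx.mem a).arr 4 a.2 = 1 ∧
        (Ctx.mem a).arr 4 v ≠ 1)
      (.and (.adj Fn.var.weaken .var) (.and (.entry 4 1 (by omega) Fn.var.weaken)
        (.not (.entry 4 1 (by omega) .var))))) .id
    fun a => (Finset.card_filter_le _ _).trans_eq (Finset.card_range _)

theorem Pd.same (hf : Fn f) (hg : Fn g) : Pd fun a => (Ctx.mem a).Same (f a) (g a) :=
  .iff (.entry 4 1 (by omega) hf) (.entry 4 1 (by omega) hg)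

theorem Pd.start (hf : Fn f) : Pd fun a => (Ctx.mem a).Start (f a) :=
  .or (.eq hf (.const 0)) (.and (.not (.same hf (.const 0)))
    (.all (P := fun a v => v < f a → (Ctx.mem a).Same v 0)
      (.imp (.lt .var hf.weaken) (.same .var (.const 0)))))

end Tests

/-! ### The meaning of the tests -/

/-- The memory `s` holds the graph `G`. -/
def Memory.Holds {n : ℕ} (s : Memory) (G : SimpleGraph (Fin n)) : Prop :=
  s.reg 0 = n ∧ ∀ u v : Fin n, s.Adj u v ↔ G.Adj u v

/-- The set with the characteristic function in array `b`. -/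
def Memory.toSet (n : ℕ) (s : Memory) (b : ℕ) : Set (Fin n) := {u | s.arr b u = 1}

namespace Memory.Holds

open Classical

variable {n : ℕ} {s : Memory} {G : SimpleGraph (Fin n)} (h : s.Holds G)

include h

theorem all_iff {P : ℕ → Prop} : (∀ v < s.reg 0, P v) ↔ ∀ v : Fin n, P v := by
  rw [h.1, Fin.forall_iff]

theorem ex_iff {P : ℕ → Prop} : (∃ v < s.reg 0, P v) ↔ ∃ v : Fin n, P v := by
  rw [h.1, Fin.exists_iff]
  simp

theorem card_eq {P : ℕ → Prop} {Q : Fin n → Prop} [DecidablePred P] [DecidablePred Q] (hPQ : ∀ v : Fin n, P v ↔ Q v) :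
    ((Finset.range (s.reg 0)).filter P).card = (Finset.univ.filter Q).card := by
  rw [h.1, Finset.card_filter, Finset.card_filter, Finset.sum_range]
  simp only [hPQ]

theorem twins_iff (u v : Fin n) : s.Twins u v ↔ Tw G u v := by
  simp only [Twins, h.all_iff, h.2, Tw, Fin.val_inj]

theorem outer_iff (u v : Fin n) : s.Outer u v ↔ OuterAdj G u v := by
  simp only [Outer, h.2, h.twins_iff, OuterAdj]

theorem typ_iff (u v : Fin n) : s.Typ u v ↔ SameType G u v := by
  simp only [Typ, h.all_iff, h.outer_iff, SameType]

theorem first_iff (u : Fin n) : s.First u ↔ IsFirst G u := by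
  simp only [First, h.all_iff, h.typ_iff, IsFirst, Fin.val_fin_lt]

theorem digit_iff (i : ℕ) (u : Fin n) :
    s.Digit i u ↔ TypeDigit G (fun v => s.arr 1 v) i u := by
  simp only [Digit, h.ex_iff, h.first_iff, h.typ_iff, TypeDigit]

theorem pref_iff (u : Fin n) : s.Pref u ↔ Prefers G (s.toSet n 3) (fun v => s.arr 1 v) u := by
  unfold Pref Prefers
  refine iff_of_eq (congrArg₂ _ (h.card_eq fun w => ?_) (h.card_eq fun w => ?_)) <;>
  simp only [h.2, Fin.val_fin_lt, toSet, Set.mem_ofPred_eq, ne_eq]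

theorem numTwins_eq (u : Fin n) : s.numTwins u = _root_.twins G u :=
  h.card_eq fun v => h.twins_iff u v

theorem big_iff (u : Fin n) : s.Big u ↔ IsBig G u := by
  simp only [Big, h.all_iff, h.typ_iff, h.numTwins_eq, IsBig, Fin.val_fin_le]

theorem unif_iff (u : Fin n) : s.Unif u ↔ Uniform G (s.toSet n 3) (fun v => s.arr 1 v) u := by
  simp only [Unif, h.all_iff, h.typ_iff, h.pref_iff, Uniform]

theorem canon_iff (u : Fin n) :
    s.Canon u ↔ u ∈ canonicalSet G (s.toSet n 3) (fun v => s.arr 1 v) := by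
  simp only [Canon, h.digit_iff, h.pref_iff, h.big_iff, h.unif_iff, canonicalSet, toSet,
    Set.mem_ofPred_eq, ne_eq]

theorem cover_iff : s.Cover ↔ IsTwinCover G (s.toSet n 4) := by
  rw [isTwinCover_iff]
  simp only [Cover, h.all_iff, h.outer_iff, toSet, Set.mem_ofPred_eq]

theorem count_eq (b : ℕ) : s.count b = (s.toSet n b).ncard := by
  rw [Memory.count, h.card_eq (P := fun u => s.arr b u = 1) (Q := (· ∈ s.toSet n b)) fun v => Iff.rfl, ← Set.ncard_coe_finset]
  simp

theorem cut_eq : s.cut = cutSize G (s.toSet n 4) := by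
  have key : ∀ u : Fin n, ((Finset.range (s.reg 0)).filter fun v =>
      s.Adj u v ∧ s.arr 4 u = 1 ∧ s.arr 4 v ≠ 1).card =
      (Finset.univ.filter fun v => G.Adj u v ∧ u ∈ s.toSet n 4 ∧ v ∉ s.toSet n 4).card := by
    intro u
    refine h.card_eq fun v => ?_
    simp only [h.2, toSet, Set.mem_ofPred_eq, ne_eq]
  rw [Memory.cut, cutSize, ← Finset.sum_congr rfl fun u _ => key u, ← Finset.sum_range
    (fun u => ((Finset.range (s.reg 0)).filter fun v =>
      s.Adj u v ∧ s.arr 4 u = 1 ∧ s.arr 4 v ≠ 1).card), h.1]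

end Memory.Holds

/-! ### Testing a cut -/

section Marks

variable {V : Type*}

/-- The vertices reached from `A` in at most `i` steps within the sides of a cut. -/
def reachIn (G : SimpleGraph V) (S : Set V) (A : V → Prop) : ℕ → V → Prop
  | 0, u => A u
  | i + 1, u => reachIn G S A i u ∨ ∃ v, reachIn G S A i v ∧ (sideGraph G S).Adj v u

variable {G : SimpleGraph V} {S : Set V} {A : V → Prop}

theorem reachIn_mono {i j : ℕ} (hij : i ≤ j) {u : V} (h : reachIn G S A i u) :
    reachIn G S A j u := by
  induction hij with
  | refl => exact h
  | step _ ih => exact .inl ih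

theorem reachIn_sound : ∀ {i : ℕ} {u : V}, reachIn G S A i u →
    ∃ a, A a ∧ (sideGraph G S).Reachable a u
  | 0, u, h => ⟨u, h, .refl _⟩
  | i + 1, u, h => by
    rcases h with h | ⟨v, hv, hvu⟩
    · exact reachIn_sound h
    · obtain ⟨a, ha, hav⟩ := reachIn_sound hv
      exact ⟨a, ha, hav.trans hvu.reachable⟩

theorem reachIn_walk {u v : V} (w : (sideGraph G S).Walk u v) :
    ∀ {i : ℕ}, reachIn G S A i u → reachIn G S A (i + w.length) v := by
  induction w with
  | nil => exact fun h => h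
  | @cons a b c hab w ih =>
    intro i h
    have := ih (i := i + 1) (.inr ⟨a, h, hab⟩)
    rw [SimpleGraph.Walk.length_cons]
    exact reachIn_mono (by omega) this

/-- The starting set contains exactly one vertex of each non-empty side: `z` and the least vertex
opposite to `z`. Thus everything is reached exactly when both sides are connected, and `n` rounds
suffice because a path has fewer than `n` edges. -/
theorem reachIn_iff {n : ℕ} {G : SimpleGraph (Fin n)} {S : Set (Fin n)} {z : Fin n}
    (hz : ∀ u, z ≤ u) :
    (∀ u, reachIn G S (fun u => u = z ∨ (¬ (u ∈ S ↔ z ∈ S) ∧ ∀ v, v < u → (v ∈ S ↔ z ∈ S))) n u) ↔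
      SidesConnected G S := by
  classical
  constructor
  · intro h u v huv
    obtain ⟨a, ha, hau⟩ := reachIn_sound (h u)
    obtain ⟨b, hb, hbv⟩ := reachIn_sound (h v)
    have hs : a ∈ S ↔ b ∈ S :=
      (sideGraph_reachable_side hau).trans (huv.trans (sideGraph_reachable_side hbv).symm)
    have : a = b := by
      rcases ha with rfl | ⟨ha, ha'⟩ <;> rcases hb with rfl | ⟨hb, hb'⟩
      · rfl
      · exact absurd hs.symm hb
      · exact absurd hs ha
      · rcases lt_trichotomy a b with h | h | h
        · exact absurd (hb' a h) ha
        · exact h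
        · exact absurd (ha' b h) hb
    subst this
    exact hau.symm.trans hbv
  · intro h u
    obtain ⟨a, ha, hau⟩ : ∃ a, (a = z ∨ (¬ (a ∈ S ↔ z ∈ S) ∧ ∀ v, v < a → (v ∈ S ↔ z ∈ S))) ∧
        (a ∈ S ↔ u ∈ S) := by
      by_cases hu : u ∈ S ↔ z ∈ S
      · exact ⟨z, .inl rfl, hu.symm⟩
      · obtain ⟨a, ha, hmin⟩ := Finset.exists_min_image
          (Finset.univ.filter fun v => ¬ (v ∈ S ↔ z ∈ S)) id ⟨u, by simpa using hu⟩
        simp only [Finset.mem_filter, Finset.mem_univ, true_and, id] at ha hmin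
        refine ⟨a, .inr ⟨ha, fun v hv => ?_⟩, by tauto⟩
        by_contra hn
        exact absurd hv (not_lt.2 (hmin v hn))
    obtain ⟨w, hw⟩ := (h a u hau).exists_isPath
    have hlen := hw.length_lt
    rw [Fintype.card_fin] at hlen
    exact reachIn_mono (by omega) (reachIn_walk w (i := 0) ha)

end Marks

namespace Memory

open Classical

/-- The same number of vertices, the same threshold, and the same graph. -/
def Frame (s s' : Memory) : Prop := s'.reg 0 = s.reg 0 ∧ s'.reg 1 = s.reg 1 ∧ s'.arr 0 = s.arr 0

theorem Frame.trans {s s' s'' : Memory} (h : Frame s s') (h' : Frame s' s'') : Frame s s'' :=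
  ⟨h'.1.trans h.1, h'.2.1.trans h.2.1, h'.2.2.trans h.2.2⟩

theorem Holds.frame {n : ℕ} {s s' : Memory} {G : SimpleGraph (Fin n)} (h : s.Holds G)
    (hf : Frame s s') : s'.Holds G :=
  ⟨hf.1.trans h.1, fun u v => by rw [← h.2]; simp only [Memory.Adj, hf.1, hf.2.2]⟩

/-- Marks the first vertex of each side. -/
noncomputable def initMarks (s : Memory) : Memory := s.fill 5 fun u => if s.Start u then 1 else 0

/-- Marks the neighbours of marked vertices on the same side. -/
noncomputable def stepMarks (s : Memory) : Memory := s.fill 5 fun u =>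
  if s.arr 5 u = 1 ∨ ∃ v < s.reg 0, s.arr 5 v = 1 ∧ s.Adj v u ∧ s.Same v u then 1 else 0

/-- Marks all vertices reachable from the first vertex of each side. -/
noncomputable def marks (s : Memory) : Memory :=
  stepMarks^[(initMarks s).reg 0] (initMarks s)

/-- Sets register `3` to `1` if all vertices are marked and the cut is large enough. -/
noncomputable def accept (s : Memory) : Memory :=
  if (∀ u < s.reg 0, s.arr 5 u = 1) ∧ s.reg 1 ≤ s.cut then s.setReg 3 1 else s

/-- Sets register `3` to `1` if array `4` holds a minimal cut that is large enough. -/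
noncomputable def check (s : Memory) : Memory := accept (marks s)

theorem iterate_stepMarks (s : Memory) (i : ℕ) :
    (stepMarks^[i] (initMarks s)).reg = s.reg ∧
      ∀ b ≠ 5, (stepMarks^[i] (initMarks s)).arr b = s.arr b := by
  induction i with
  | zero => exact ⟨rfl, fun b hb => by simp [initMarks, hb]⟩
  | succ i ih =>
    rw [Function.iterate_succ_apply']
    exact ⟨ih.1, fun b hb => by simp [stepMarks, hb, ih.2 b hb]⟩

theorem check_reg (s : Memory) {x : ℕ} (hx : x ≠ 3) : (check s).reg x = s.reg x := by
  unfold check accept marks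
  split_ifs <;> simp [hx, iterate_stepMarks]

theorem check_arr (s : Memory) {b : ℕ} (hb : b ≠ 5) : (check s).arr b = s.arr b := by
  unfold check accept marks
  split_ifs <;> simp [hb, iterate_stepMarks]

theorem check_frame (s : Memory) : Frame s (check s) :=
  ⟨check_reg s (by omega), check_reg s (by omega), check_arr s (by omega)⟩

theorem marks_iff {n : ℕ} {s : Memory} {G : SimpleGraph (Fin n)} (h : s.Holds G) (z : Fin n)
    (hz : (z : ℕ) = 0) (i : ℕ) : ∀ u : Fin n, (stepMarks^[i] (initMarks s)).arr 5 u = 1 ↔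
      reachIn G (s.toSet n 4) (fun u => u = z ∨ (¬ (u ∈ s.toSet n 4 ↔ z ∈ s.toSet n 4) ∧
        ∀ v, v < u → (v ∈ s.toSet n 4 ↔ z ∈ s.toSet n 4))) i u := by
  induction i with
  | zero =>
    intro u
    have hu : (u : ℕ) < s.reg 0 := by rw [h.1]; exact u.2
    have h0 : ∀ v : Fin n, s.Same v 0 ↔ (v ∈ s.toSet n 4 ↔ z ∈ s.toSet n 4) := by
      intro v; rw [← hz]; rfl
    have hS : s.Start u ↔ reachIn G (s.toSet n 4) (fun u => u = z ∨
        (¬ (u ∈ s.toSet n 4 ↔ z ∈ s.toSet n 4) ∧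
          ∀ v, v < u → (v ∈ s.toSet n 4 ↔ z ∈ s.toSet n 4))) 0 u := by
      unfold Start reachIn
      rw [h.all_iff]
      simp only [h0, Fin.val_fin_lt]
      rw [← hz, Fin.val_inj]
    rw [← hS]
    simp [initMarks, hu]
  | succ i ih =>
    intro u
    have hu : (u : ℕ) < s.reg 0 := by rw [h.1]; exact u.2
    obtain ⟨h1, h2⟩ := iterate_stepMarks s i
    rw [Function.iterate_succ_apply', reachIn]
    set t := stepMarks^[i] (initMarks s)
    have ht : t.Holds G := h.frame ⟨by rw [h1], by rw [h1], h2 0 (by omega)⟩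
    simp only [stepMarks, fill_arr, if_true, h1, hu]
    have : (∃ v < s.reg 0, t.arr 5 v = 1 ∧ t.Adj v u ∧ t.Same v u) ↔
        ∃ v : Fin n, t.arr 5 v = 1 ∧ (sideGraph G (s.toSet n 4)).Adj v u := by
      rw [h.ex_iff]
      refine exists_congr fun v => and_congr_right fun _ => ?_
      rw [ht.2]
      simp only [Same, h2 4 (by omega)]
      rfl
    simp only [this, ih]
    split_ifs with hc <;> simp [hc]

theorem check_answer {n : ℕ} {s : Memory} {G : SimpleGraph (Fin n)} (h : s.Holds G) (hn : 0 < n) :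
    (check s).reg 3 = if SidesConnected G (s.toSet n 4) ∧ s.reg 1 ≤ cutSize G (s.toSet n 4)
      then 1 else s.reg 3 := by
  obtain ⟨h1, h2⟩ := iterate_stepMarks s ((initMarks s).reg 0)
  have hm := marks_iff h ⟨0, hn⟩ rfl ((initMarks s).reg 0)
  have ht : (marks s).Holds G := h.frame ⟨by rw [marks, h1], by rw [marks, h1], h2 0 (by omega)⟩
  have h4 : (marks s).toSet n 4 = s.toSet n 4 := by
    ext u
    change (marks s).arr 4 u = 1 ↔ s.arr 4 u = 1
    rw [marks, h2 4 (by omega)]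
  have e : (initMarks s).reg 0 = n := h.1
  have h5 : (∀ u < (marks s).reg 0, (marks s).arr 5 u = 1) ↔ SidesConnected G (s.toSet n 4) := by
    rw [ht.all_iff, ← reachIn_iff (z := ⟨0, hn⟩) fun u => Nat.zero_le _]
    simp only [marks]
    refine forall_congr' fun u => (hm u).trans ?_
    rw [e]
  have hr : (marks s).reg = s.reg := h1
  rw [hr] at h5
  simp only [check, accept, hr, h5, ht.cut_eq, h4]
  split_ifs <;> simp [hr]

end Memory

theorem St.check : St Memory.check := by
  classical
  have h1 : St Memory.initMarks := St.fill (f := fun s u => if s.Start u then 1 else 0) (by omega)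
    (Fn.ite (Pd.start .var) (.const 1) (.const 0))
  have h2 : St Memory.stepMarks := St.fill (f := fun s u => if s.arr 5 u = 1 ∨
      ∃ v < s.reg 0, s.arr 5 v = 1 ∧ s.Adj v u ∧ s.Same v u then 1 else 0) (by omega)
    (Fn.ite (Pd.or (.entry 5 1 (by omega) .var) (.ex (α := Memory × ℕ)
      (P := fun a v => a.1.arr 5 v = 1 ∧ a.1.Adj v a.2 ∧ a.1.Same v a.2)
      (.and (.entry 5 1 (by omega) .var) (.and (.adj .var Fn.var.weaken)
        (.same .var Fn.var.weaken))))) (.const 1) (.const 0))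
  have h3 : St Memory.accept := St.ite (Pd.and
    (.all (α := Memory) (P := fun s u => s.arr 5 u = 1) (.entry 5 1 (by omega) .var))
    (.le (.reg (by omega)) .cut)) (St.assign (by omega) (by omega) (.const 1)) St.skip
  exact (h1.seq h2.iter).seq h3

/-! ### The algorithm -/

namespace Memory

open Classical

/-- Takes the union of types given by the digits as the new twin-cover if it is a smaller one. -/
noncomputable def improve (s : Memory) : Memory :=
  let t := s.fill 4 fun u => if s.Digit 1 u then 1 else 0
  if t.Cover ∧ t.count 4 < t.count 3 then t.fill 3 fun u => t.arr 4 u else t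

/-- Tests the canonical cut with the current digits. -/
noncomputable def tryCanonical (s : Memory) : Memory :=
  check (s.fill 4 fun u => if s.Canon u then 1 else 0)

/-- Tests the twins up to the vertex in register `4` and passes to the next vertex. -/
noncomputable def trySegment (s : Memory) : Memory :=
  let t := check (s.fill 4 fun u => if s.Twins (s.reg 4) u ∧ u ≤ s.reg 4 then 1 else 0)
  t.setReg 4 (t.reg 4 + 1)

/-- Prepares the enumeration of the unions of types. -/
noncomputable def setupCover (s : Memory) : Memory :=
  ((s.fill 2 fun u => if s.First u then 2 else 1).fill 3 fun _ => 1).setReg 2 1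

/-- Prepares the enumeration of the canonical cuts. -/
noncomputable def setupCuts (s : Memory) : Memory :=
  let t := s.fill 2 fun u => if s.arr 3 u = 1 then 2 else if s.First u then 3 else 1
  (t.fill 1 fun _ => 0).setReg 2 1

end Memory

theorem St.improve : St Memory.improve := by
  classical
  exact (St.fill (f := fun s u => if s.Digit 1 u then 1 else 0) (b := 4) (by omega)
    (Fn.ite (Pd.digit 1 .var) (.const 1) (.const 0))).seq
    (St.ite (P := fun t => t.Cover ∧ t.count 4 < t.count 3)
      (Pd.and .cover (.lt (.countOnes 4 (by omega)) (.countOnes 3 (by omega))))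
      (St.fill (f := fun t u => t.arr 4 u) (by omega) (Fn.arr (b := 4) (by omega) .var)) St.skip)

theorem St.tryCanonical : St Memory.tryCanonical := by
  classical
  exact (St.fill (f := fun s u => if s.Canon u then 1 else 0) (b := 4) (by omega)
    (Fn.ite (Pd.canon .var) (.const 1) (.const 0))).seq St.check

theorem St.trySegment : St Memory.trySegment := by
  classical
  have hreg : Fn fun a : Memory × ℕ => a.1.reg 4 := Fn.reg (α := Memory × ℕ) (by omega)
  exact ((St.fill (f := fun s u => if s.Twins (s.reg 4) u ∧ u ≤ s.reg 4 then 1 else 0) (b := 4)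
    (by omega) (Fn.ite (Pd.and (.twins hreg .var) (.le .var hreg)) (.const 1) (.const 0))).seq
      St.check).seq (St.assign (f := fun t => t.reg 4 + 1) (by omega) (by omega)
        (Fn.succ (Fn.reg (by omega))))

theorem St.setupCover : St Memory.setupCover := by
  classical
  exact ((St.fill (f := fun s u => if s.First u then 2 else 1) (b := 2) (by omega)
    (Fn.ite (Pd.first .var) (.const 2) (.const 1))).seq
    (St.fill (f := fun _ _ => 1) (b := 3) (by omega) (.const 1))).seq
    (St.assign (x := 2) (by omega) (by omega) (.const 1))

theorem St.setupCuts : St Memory.setupCuts := by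
  classical
  exact ((St.fill (f := fun s u => if s.arr 3 u = 1 then 2 else if s.First u then 3 else 1) (b := 2)
    (by omega) (Fn.ite (Pd.entry 3 1 (by omega) .var) (.const 2)
      (Fn.ite (Pd.first .var) (.const 3) (.const 1)))).seq
    (St.fill (f := fun _ _ => 0) (b := 1) (by omega) (.const 0))).seq
    (St.assign (x := 2) (by omega) (by omega) (.const 1))

/-! ### Correctness -/

namespace Memory

open Classical

variable {n : ℕ} {G : SimpleGraph (Fin n)}

theorem advance_frame (s : Memory) : Frame s (advance s) :=
  ⟨advance_reg (by omega), advance_reg (by omega), advance_arr (by omega)⟩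

theorem Holds.lt {s : Memory} (h : s.Holds G) (u : Fin n) : (u : ℕ) < s.reg 0 := by
  rw [h.1]; exact u.2

theorem Holds.prod_eq {s : Memory} (h : s.Holds G) {f : Fin n → ℕ}
    (hf : ∀ u : Fin n, s.arr 2 u = f u) :
    ∏ u ∈ Finset.range (s.reg 0), s.arr 2 u = ∏ u, f u := by
  rw [h.1, Finset.prod_range]
  simp only [hf]

/-- The union of the types with digit `1`. -/
def unionOf (G : SimpleGraph (Fin n)) (d : ℕ → ℕ) : Set (Fin n) :=
  {u | TypeDigit G (fun v => d v) 1 u}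

theorem typeClosed_unionOf (d : ℕ → ℕ) : TypeClosed G (unionOf G d) :=
  fun _ _ huv ⟨w, hw, huw, hd⟩ => ⟨w, hw, huv.symm.trans huw, hd⟩

theorem improve_reg (s : Memory) : (improve s).reg = s.reg := by
  simp only [improve]
  split_ifs <;> simp

theorem improve_arr (s : Memory) {b : ℕ} (h3 : b ≠ 3) (h4 : b ≠ 4) :
    (improve s).arr b = s.arr b := by
  simp only [improve]
  split_ifs <;> simp [h3, h4]

theorem improve_frame (s : Memory) : Frame s (improve s) :=
  ⟨by rw [improve_reg], by rw [improve_reg], improve_arr s (by omega) (by omega)⟩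

theorem toSet_improve {s : Memory} (h : s.Holds G) :
    (improve s).toSet n 3 = if IsTwinCover G (unionOf G (s.arr 1)) ∧
      (unionOf G (s.arr 1)).ncard < (s.toSet n 3).ncard then unionOf G (s.arr 1)
      else s.toSet n 3 := by
  set t := s.fill 4 fun u => if s.Digit 1 u then 1 else 0 with ht
  have hT : t.Holds G := h.frame ⟨rfl, rfl, by simp [ht]⟩
  have e4 : t.toSet n 4 = unionOf G (s.arr 1) := by
    ext u
    change t.arr 4 u = 1 ↔ TypeDigit G (fun v => s.arr 1 v) 1 u
    rw [← h.digit_iff]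
    simp [ht, h.lt u]
  have e3 : t.toSet n 3 = s.toSet n 3 := by
    ext u
    change t.arr 3 u = 1 ↔ s.arr 3 u = 1
    simp [ht]
  have : improve s = if t.Cover ∧ t.count 4 < t.count 3 then t.fill 3 fun u => t.arr 4 u else t :=
    rfl
  rw [this, hT.cover_iff, hT.count_eq, hT.count_eq, e4, e3]
  split_ifs
  · rw [← e4]
    ext u
    change (t.fill 3 fun u => t.arr 4 u).arr 3 u = 1 ↔ t.arr 4 u = 1
    simp [hT.lt u]
  · exact e3

theorem unionOf_congr {d d' : ℕ → ℕ} (h : ∀ u < n, d u = d' u) : unionOf G d = unionOf G d' := by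
  have : (fun v : Fin n => d v) = fun v : Fin n => d' v := funext fun v => h v v.2
  rw [unionOf, unionOf, this]

/-- A type stores its digit at its first vertex, so the enumeration meets each union of types. -/
theorem exists_digits {X : Set (Fin n)} (hX : TypeClosed G X) :
    ∃ d : ℕ → ℕ, (∀ u : Fin n, d u < if IsFirst G u then 2 else 1) ∧ unionOf G d = X := by
  refine ⟨fun u => if h : u < n then if IsFirst G ⟨u, h⟩ ∧ (⟨u, h⟩ : Fin n) ∈ X then 1 else 0 else 0,
    fun u => ?_, ?_⟩
  · simp only [u.2, dif_pos, Fin.eta]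
    split_ifs <;> simp_all
  · ext u
    simp only [unionOf, TypeDigit, Set.mem_ofPred_eq, Fin.is_lt, dif_pos, Fin.eta]
    constructor
    · rintro ⟨v, hv, huv, h⟩
      split_ifs at h with h'
      exact hX v u huv.symm h'.2
    · intro hu
      obtain ⟨v, hv, huv⟩ := exists_isFirst (G := G) u
      exact ⟨v, hv, huv, if_pos ⟨hv, hX u v huv hu⟩⟩

/-- The first enumeration ends with a minimum twin-cover. -/
theorem enumerate_improve {a : Memory} (h : a.Holds G) (hgo : a.reg 2 = 1)
    (hD : ∀ u < a.reg 0, a.arr 1 u = 0)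
    (hR : ∀ u : Fin n, a.arr 2 u = if IsFirst G u then 2 else 1) (hX : ∀ u : Fin n, a.arr 3 u = 1) :
    let a' := (fun s => advance (improve s))^[∏ u ∈ Finset.range (a.reg 0), a.arr 2 u] a
    Frame a a' ∧ a'.reg 3 = a.reg 3 ∧ a'.reg 4 = a.reg 4 ∧ IsTwinCover G (a'.toSet n 3) ∧
      TypeClosed G (a'.toSet n 3) ∧ (a'.toSet n 3).ncard = twinCoverNumber G := by
  have hR0 : ∀ u < a.reg 0, 0 < a.arr 2 u := by
    rw [h.all_iff]
    intro u
    rw [hR]; split_ifs <;> omega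
  have key := iterate_advance (B := improve) (fun s => by rw [improve_reg])
    (fun s => improve_arr s (by omega) (by omega)) (fun s => improve_arr s (by omega) (by omega))
    hgo hD hR0
  set N := ∏ u ∈ Finset.range (a.reg 0), a.arr 2 u
  intro a'
  -- The stored set is always a twin-cover and a union of types, no larger than any twin-cover met
  -- so far.
  have inv : ∀ m ≤ N, let t := (fun s => advance (improve s))^[m] a
      Frame a t ∧ t.reg 3 = a.reg 3 ∧ t.reg 4 = a.reg 4 ∧ IsTwinCover G (t.toSet n 3) ∧
      TypeClosed G (t.toSet n 3) ∧ ∀ i < m, IsTwinCover G (unionOf G (mixedDigit (a.arr 2) i)) →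
        (t.toSet n 3).ncard ≤ (unionOf G (mixedDigit (a.arr 2) i)).ncard := by
    intro m
    induction m with
    | zero =>
      intro _
      have : a.toSet n 3 = Set.univ := by ext u; simpa [toSet] using hX u
      refine ⟨⟨rfl, rfl, rfl⟩, rfl, rfl, ?_, ?_, by simp⟩
      · change IsTwinCover G (a.toSet n 3)
        rw [this]; exact fun u v _ => .inl trivial
      · change TypeClosed G (a.toSet n 3)
        rw [this]; exact fun _ _ _ _ => trivial
    | succ m ih =>
      intro hm
      obtain ⟨i1, i2, i3, i4, i5, i6⟩ := ih (by omega)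
      obtain ⟨-, -, k3, -⟩ := key m (by omega)
      rw [Function.iterate_succ_apply']
      set t := (fun s => advance (improve s))^[m] a
      have hd : unionOf G (t.arr 1) = unionOf G (mixedDigit (a.arr 2) m) :=
        unionOf_congr fun u hu => k3 u (by rwa [h.1])
      have hset : (advance (improve t)).toSet n 3 = _ :=
        (show _ = (improve t).toSet n 3 by simp only [toSet, advance_arr (b := 3) (by omega)]).trans
          (toSet_improve (h.frame i1))
      rw [hd] at hset
      refine ⟨i1.trans ((improve_frame t).trans (advance_frame _)), ?_, ?_, ?_⟩
      · rw [advance_reg (by omega), improve_reg, i2]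
      · rw [advance_reg (by omega), improve_reg, i3]
      · rw [hset]
        split_ifs with hc
        · refine ⟨hc.1, typeClosed_unionOf _, fun i hi hcov => ?_⟩
          rcases Nat.lt_succ_iff_lt_or_eq.1 hi with hi | rfl
          · exact hc.2.le.trans (i6 i hi hcov)
          · exact le_rfl
        · refine ⟨i4, i5, fun i hi hcov => ?_⟩
          rcases Nat.lt_succ_iff_lt_or_eq.1 hi with hi | rfl
          · exact i6 i hi hcov
          · by_contra hn
            exact hc ⟨hcov, not_le.1 hn⟩
  obtain ⟨j1, j2, j3, j4, j5, j6⟩ := inv N le_rfl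
  refine ⟨j1, j2, j3, j4, j5, le_antisymm ?_ (twinCoverNumber_le j4)⟩
  -- Some minimum twin-cover is a union of types, so it was met in some round.
  obtain ⟨X, hX1, hX2, hX3⟩ := exists_twinCover G
  obtain ⟨d, hd, rfl⟩ := exists_digits hX2
  obtain ⟨m, hm, hmd⟩ := exists_mixedDigit_eq (a.arr 2) d (a.reg 0) (h.all_iff.2 fun u => by
    rw [hR]; exact hd u)
  have e : unionOf G (mixedDigit (a.arr 2) m) = unionOf G d :=
    unionOf_congr fun u hu => hmd u (by rwa [h.1])
  have := j6 m hm (e ▸ hX1)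
  rwa [e, hX3] at this

/-- Register `3` holds `0`, or `1` and the answer is yes. -/
def Sound (G : SimpleGraph (Fin n)) (s : Memory) : Prop :=
  s.reg 3 = 0 ∨ (s.reg 3 = 1 ∧ HasMinimalCut G (s.reg 1))

/-- Soundness uses only that connected sides make a cut minimal; the converse, which needs `G`
connected, serves to recognize a good candidate. A positive answer is never withdrawn. -/
theorem Sound.check {s t : Memory} (hs : Sound G s) (ht : t.Holds G) (hn : 0 < n)
    (h1 : t.reg 1 = s.reg 1) (h3 : t.reg 3 = s.reg 3) :
    Sound G (check t) ∧ (s.reg 3 = 1 → (Memory.check t).reg 3 = 1) ∧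
      (∀ S, t.toSet n 4 = S → IsMinimalCut G S → G.Connected → s.reg 1 ≤ cutSize G S →
        (Memory.check t).reg 3 = 1) := by
  have hc := check_answer ht hn
  refine ⟨?_, fun h => ?_, ?_⟩
  · unfold Sound
    rw [hc, check_reg t (by omega)]
    split_ifs with h
    · exact .inr ⟨rfl, _, h.1.isMinimalCut, by rw [ncard_cutset]; exact h.2⟩
    · rw [h1, h3]
      exact hs
  · rw [hc, h3, h]
    simp
  · rintro S rfl hmin hG hle
    rw [hc, if_pos ⟨hmin.sidesConnected hG, h1 ▸ hle⟩]

theorem trySegment_iterate {a : Memory} (h : a.Holds G) (hG : G.Connected) (hn : 0 < n)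
    (h4 : a.reg 4 = 0) (h3 : Sound G a) (m : ℕ) :
    let t := trySegment^[m] a
    Frame a t ∧ t.reg 4 = m ∧ (∀ b < 4, t.arr b = a.arr b) ∧ t.reg 2 = a.reg 2 ∧ Sound G t ∧
      ∀ y : Fin n, (y : ℕ) < m → IsMinimalCut G (twinSegment G y) →
        a.reg 1 ≤ cutSize G (twinSegment G y) → t.reg 3 = 1 := by
  induction m with
  | zero => exact ⟨⟨rfl, rfl, rfl⟩, h4, fun _ _ => rfl, rfl, h3, fun y hy => absurd hy (by omega)⟩
  | succ m ih =>
    obtain ⟨i1, i2, i3, i4, i5, i6⟩ := ih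
    rw [Function.iterate_succ_apply']
    set t := trySegment^[m] a
    set t' := t.fill 4 fun u => if t.Twins (t.reg 4) u ∧ u ≤ t.reg 4 then 1 else 0 with ht'
    have e : trySegment t = (check t').setReg 4 ((check t').reg 4 + 1) := rfl
    have hf : Frame t t' := ⟨rfl, rfl, by simp [ht']⟩
    have hT := (h.frame i1).frame hf
    obtain ⟨c1, c2, c3⟩ := i5.check hT hn rfl rfl
    have r3 : (trySegment t).reg 3 = (check t').reg 3 := by rw [e]; simp
    have r1 : (trySegment t).reg 1 = (check t').reg 1 := by rw [e]; simp
    refine ⟨i1.trans (hf.trans ((check_frame t').trans (by rw [e]; exact ⟨by simp, by simp, rfl⟩))),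
      ?_, fun b hb => ?_, ?_, ?_, fun y hy hmin hle => ?_⟩
    · rw [e]; simp [check_reg, ht', i2]
    · rw [e, setReg_arr, check_arr _ (by omega), ht', fill_arr, if_neg (by omega), i3 b hb]
    · rw [e]; simp [check_reg, ht', i4]
    · unfold Sound
      rw [r3, r1]
      exact c1
    · rw [r3]
      rcases Nat.lt_succ_iff_lt_or_eq.1 hy with hy | hy
      · exact c2 (i6 y hy hmin hle)
      · refine c3 (twinSegment G y) ?_ hmin hG (by rwa [i1.2.1])
        ext u
        have hu := (h.frame i1).lt u
        change t'.arr 4 u = 1 ↔ Tw G y u ∧ u ≤ y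
        rw [← (h.frame i1).twins_iff]
        simp [ht', hu, i2, ← hy]

/-- The second enumeration finds the answer. -/
theorem enumerate_tryCanonical {a : Memory} (h : a.Holds G) (hG : G.Connected) (hn : 0 < n)
    (hgo : a.reg 2 = 1) (hD : ∀ u < a.reg 0, a.arr 1 u = 0)
    (hR : ∀ u : Fin n, a.arr 2 u = radix G (a.toSet n 3) u) (h3 : Sound G a) :
    let a' := (fun s => advance (tryCanonical s))^[∏ u ∈ Finset.range (a.reg 0), a.arr 2 u] a
    Sound G a' ∧ a'.reg 1 = a.reg 1 ∧ (a.reg 3 = 1 → a'.reg 3 = 1) ∧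
      ∀ P : Fin n → ℕ, (∀ u, P u < radix G (a.toSet n 3) u) →
        IsMinimalCut G (canonicalSet G (a.toSet n 3) P) →
        a.reg 1 ≤ cutSize G (canonicalSet G (a.toSet n 3) P) → a'.reg 3 = 1 := by
  have hR0 : ∀ u < a.reg 0, 0 < a.arr 2 u := by
    rw [h.all_iff]
    intro u
    rw [hR]; unfold radix; split_ifs <;> omega
  have key := iterate_advance (B := tryCanonical) (fun s => check_reg _ (by omega))
    (fun s => (check_arr _ (by omega)).trans (by simp))
    (fun s => (check_arr _ (by omega)).trans (by simp)) hgo hD hR0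
  set N := ∏ u ∈ Finset.range (a.reg 0), a.arr 2 u
  intro a'
  set X := a.toSet n 3
  -- The twin-cover in array `3` stays fixed, and the answer accounts for all digit strings tried so
  -- far.
  have inv : ∀ m ≤ N, let t := (fun s => advance (tryCanonical s))^[m] a
      Frame a t ∧ t.arr 3 = a.arr 3 ∧ Sound G t ∧ (a.reg 3 = 1 → t.reg 3 = 1) ∧
      ∀ i < m, IsMinimalCut G (canonicalSet G X fun v => mixedDigit (a.arr 2) i v) →
        a.reg 1 ≤ cutSize G (canonicalSet G X fun v => mixedDigit (a.arr 2) i v) → t.reg 3 = 1 := by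
    intro m
    induction m with
    | zero => exact fun _ => ⟨⟨rfl, rfl, rfl⟩, rfl, h3, id, by simp⟩
    | succ m ih =>
      intro hm
      obtain ⟨i1, i2, i3, i4, i5⟩ := ih (by omega)
      obtain ⟨-, -, k3, -⟩ := key m (by omega)
      rw [Function.iterate_succ_apply']
      set t := (fun s => advance (tryCanonical s))^[m] a
      set t' := t.fill 4 fun u => if t.Canon u then 1 else 0 with ht'
      have e : tryCanonical t = check t' := rfl
      have hf : Frame t t' := ⟨rfl, rfl, by simp [ht']⟩
      have ht := h.frame i1
      obtain ⟨c1, c2, c3⟩ := i3.check (ht.frame hf) hn rfl rfl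
      have r3 : (advance (tryCanonical t)).reg 3 = (check t').reg 3 := advance_reg (by omega)
      refine ⟨i1.trans (hf.trans ((check_frame t').trans (advance_frame _))), ?_, ?_,
        fun h' => r3.trans (c2 (i4 h')), fun i hi hmin hle => r3.trans ?_⟩
      · rw [advance_arr (by omega), e, check_arr _ (by omega), ht', fill_arr, if_neg (by omega), i2]
      · unfold Sound
        rw [r3, advance_reg (by omega)]
        exact c1
      · rcases Nat.lt_succ_iff_lt_or_eq.1 hi with hi | rfl
        · exact c2 (i5 i hi hmin hle)
        · refine c3 _ ?_ hmin hG (by rwa [i1.2.1])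
          have e3 : t.toSet n 3 = X := by simp only [toSet, i2, X]
          have eP : (fun v : Fin n => t.arr 1 v) = fun v : Fin n => mixedDigit (a.arr 2) i v :=
            funext fun v => k3 v (h.lt v)
          rw [← e3, ← eP]
          ext u
          rw [← ht.canon_iff]
          change t'.arr 4 u = 1 ↔ _
          simp [ht', ht.lt u]
  obtain ⟨j1, j2, j3, j4, j5⟩ := inv N le_rfl
  refine ⟨j3, j1.2.1, j4, fun P hP hmin hle => ?_⟩
  -- The value `0` beyond `n` is a filler: only the digits of vertices matter.
  obtain ⟨m, hm, hmd⟩ := exists_mixedDigit_eq (a.arr 2) (fun u => if h : u < n then P ⟨u, h⟩ else 0)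
    (a.reg 0) (h.all_iff.2 fun u => by simpa [hR] using hP u)
  have e : (fun v : Fin n => mixedDigit (a.arr 2) m v) = P := funext fun v => by
    rw [hmd v (h.lt v)]; simp
  exact j5 m hm (by rwa [e]) (by rwa [e])

end Memory

open Memory in
theorem mainTheorem9 :
    ∃ (p : Prog) (c d : ℕ), ∀ (n : ℕ) (G : SimpleGraph (Fin n)), G.Connected → ∀ k : ℕ,
      ∃ (t : ℕ) (s : Memory), Exec p (inputMemory G k) t s ∧
        t ≤ c * n ^ d * (2 ^ twinCoverNumber G * 3 ^ 2 ^ twinCoverNumber G) ∧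
        (HasMinimalCut G k → s.reg 0 = 1) ∧ (¬ HasMinimalCut G k → s.reg 0 = 0) := by
  classical
  obtain ⟨T1, hT1, -, h1⟩ := St.setupCover
  obtain ⟨p1, hp1⟩ := h1 5 le_rfl
  obtain ⟨p2, T2, hT2, hp2⟩ := St.enumerate St.improve (fun s => improve_arr s (by omega) (by omega))
    (fun s => improve_arr s (by omega) (by omega))
  obtain ⟨T3, hT3, -, h3⟩ := St.setupCuts.seq St.trySegment.iter
  obtain ⟨p3, hp3⟩ := h3 5 le_rfl
  obtain ⟨p4, T4, hT4, hp4⟩ := St.enumerate St.tryCanonical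
    (fun s => (check_arr _ (by omega)).trans (by simp))
    (fun s => (check_arr _ (by omega)).trans (by simp))
  obtain ⟨c, d, hcd⟩ := hT1.add (hT2.add (hT3.add (hT4.add (.const 1))))
  refine ⟨.seq p1 (.seq p2 (.seq p3 (.seq p4 (.copy 0 3)))), c, d, fun n G hG k => ?_⟩
  have hn : 0 < n := Fin.pos_iff_nonempty.2 hG.nonempty
  set B := 2 ^ twinCoverNumber G * 3 ^ 2 ^ twinCoverNumber G with hB
  have hB1 : 1 ≤ B := Nat.mul_pos (by positivity) (by positivity)
  set a0 := inputMemory G k with ha0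
  have H0 : a0.Holds G := by
    refine ⟨by simp [ha0, inputMemory], fun u v => ?_⟩
    simp only [Memory.Adj, ha0, inputMemory, if_true, Fin.is_lt, true_and]
    constructor
    · intro h
      -- Row and column are recovered from the address as quotient and remainder modulo `n`.
      split_ifs at h with h'
      · obtain ⟨i, j, hij, e⟩ := h'
        have hu : u = i := by
          have := congrArg (· / n) e
          simpa [Nat.mul_comm _ n, Nat.mul_add_div hn, Nat.div_eq_of_lt, Fin.val_inj] using this
        have hv : v = j := by
          have := congrArg (· % n) e
          simpa [Nat.mul_comm _ n, Nat.mul_add_mod, Nat.mod_eq_of_lt, Fin.val_inj] using this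
        rwa [hu, hv]
    · exact fun h => if_pos ⟨u, v, h, rfl⟩
  have r1 : a0.reg 1 = k := by simp [ha0, inputMemory]
  set a1 := setupCover a0 with ha1
  have H1 : a1.Holds G := H0.frame ⟨by simp [ha1, setupCover], by simp [ha1, setupCover],
    by simp [ha1, setupCover]⟩
  have e0 : ∀ x, x ≠ 2 → a1.reg x = a0.reg x := fun x hx => by simp [ha1, setupCover, hx]
  have R1 : ∀ u : Fin n, a1.arr 2 u = if IsFirst G u then 2 else 1 := fun u => by
    have := H0.lt u
    simp [ha1, setupCover, this, H0.first_iff]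
  have D1 : ∀ u < a1.reg 0, a1.arr 1 u = 0 := fun u _ => by
    simp [ha1, setupCover, ha0, inputMemory]
  have X1 : ∀ u : Fin n, a1.arr 3 u = 1 := fun u => by
    have := H0.lt u
    simp [ha1, setupCover, this]
  have go1 : a1.reg 2 = 1 := by simp [ha1, setupCover]
  obtain ⟨f2, g2, g2', hcov, hclosed, htc⟩ := enumerate_improve H1 go1 D1 R1 X1
  set a2 := (fun s => advance (improve s))^[∏ u ∈ Finset.range (a1.reg 0), a1.arr 2 u] a1
  have H2 := H1.frame f2
  set a3 := setupCuts a2 with ha3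
  have H3 : a3.Holds G := H2.frame ⟨by simp [ha3, setupCuts], by simp [ha3, setupCuts],
    by simp [ha3, setupCuts]⟩
  have e3 : ∀ x, x ≠ 2 → a3.reg x = a2.reg x := fun x hx => by simp [ha3, setupCuts, hx]
  have X3 : a3.toSet n 3 = a2.toSet n 3 := by
    ext u
    change a3.arr 3 u = 1 ↔ a2.arr 3 u = 1
    simp [ha3, setupCuts]
  have R3 : ∀ u : Fin n, a3.arr 2 u = radix G (a2.toSet n 3) u := fun u => by
    have := H2.lt u
    simp [ha3, setupCuts, this, H2.first_iff, radix, toSet]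
    by_cases hX : a2.arr 3 u = 1 <;> by_cases hF : IsFirst G u <;> simp [hX, hF]
  have D3 : ∀ u < a3.reg 0, a3.arr 1 u = 0 := fun u hu => by
    have : u < a2.reg 0 := by rwa [e3 0 (by omega)] at hu
    simp [ha3, setupCuts, this]
  have go3 : a3.reg 2 = 1 := by simp [ha3, setupCuts]
  have r31 : a3.reg 1 = k := by
    rw [e3 1 (by omega), f2.2.1, e0 1 (by omega), r1]
  have s3 : Sound G a3 := .inl (by
    rw [e3 3 (by omega), g2, e0 3 (by omega)]; simp [ha0, inputMemory])
  obtain ⟨f4, -, i3, i4, s4, c4⟩ := trySegment_iterate H3 hG hn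
    (by rw [e3 4 (by omega), g2', e0 4 (by omega)]; simp [ha0, inputMemory]) s3 (a3.reg 0)
  set a4 := trySegment^[a3.reg 0] a3
  have H4 := H3.frame f4
  have X4 : a4.toSet n 3 = a2.toSet n 3 := by
    rw [← X3]; simp only [toSet, i3 3 (by omega)]
  have R4 : ∀ u : Fin n, a4.arr 2 u = radix G (a4.toSet n 3) u := fun u => by
    rw [i3 2 (by omega), R3, X4]
  have D4 : ∀ u < a4.reg 0, a4.arr 1 u = 0 := fun u hu => by
    rw [i3 1 (by omega)]; exact D3 u (by rwa [f4.1] at hu)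
  obtain ⟨s5, r5, m5, c5⟩ := enumerate_tryCanonical H4 hG hn (i4.trans go3) D4 R4 s4
  set a5 := (fun s => advance (tryCanonical s))^[∏ u ∈ Finset.range (a4.reg 0), a4.arr 2 u] a4
  have r41 : a4.reg 1 = k := f4.2.1.trans r31
  have hz : ∀ {a : Memory}, a.Holds G → a.reg 0 = n := fun h => h.1
  -- The first enumeration is bounded in the analysis by means of the minimum twin-cover that it
  -- ends with.
  have t2 : T2 (a1.reg 0) * ∏ u ∈ Finset.range (a1.reg 0), a1.arr 2 u ≤ T2 n * B := by
    rw [H1.prod_eq R1, hz H1, hB, ← htc]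
    exact Nat.mul_le_mul_left _ (prod_isFirst_le hcov)
  have t4 : T4 (a4.reg 0) * ∏ u ∈ Finset.range (a4.reg 0), a4.arr 2 u ≤ T4 n * B := by
    rw [H4.prod_eq R4, hz H4, hB, ← htc, X4]
    exact Nat.mul_le_mul_left _ (prod_radix_le hcov)
  have run : Run (.seq p1 (.seq p2 (.seq p3 (.seq p4 (.copy 0 3))))) a0 _
      fun s => s.reg 0 = a5.reg 3 :=
    (hp1 a0 a0 (.refl a0)).seq fun b1 hb1 =>
    ((hp2 a1 b1 hb1.1 go1 D1 fun u hu => by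
      have := R1 ⟨u, by rwa [hz H1] at hu⟩
      simp only at this
      rw [this]; split_ifs <;> omega).mono t2 fun _ h => h).seq fun b2 hb2 =>
    (hp3 a2 b2 hb2).seq fun b3 hb3 =>
    ((hp4 a4 b3 hb3.1 (i4.trans go3) D4 fun u hu => by
      have := R4 ⟨u, by rwa [hz H4] at hu⟩
      simp only at this
      rw [this]; unfold radix; split_ifs <;> omega).mono t4 fun _ h => h).seq fun b4 hb4 =>
    .copy (by simpa using hb4.1 3 (by omega))
  obtain ⟨t, s, hexec, ht, hs⟩ := run
  refine ⟨t, s, hexec, ht.trans ?_, fun hyes => ?_, fun hno => ?_⟩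
  · rw [hz H0, hz H2]
    -- The polynomial parts outside the enumerations are absorbed because `B` is at least `1`.
    calc T1 n + (T2 n * B + (T3 n + (T4 n * B + 1)))
        ≤ T1 n * B + (T2 n * B + (T3 n * B + (T4 n * B + 1 * B))) := by
          gcongr
          · exact Nat.le_mul_of_pos_right _ hB1
          · exact Nat.le_mul_of_pos_right _ hB1
          · omega
      _ = (T1 n + (T2 n + (T3 n + (T4 n + 1)))) * B := by ring
      _ ≤ c * n ^ d * B := Nat.mul_le_mul_right _ (hcd n hn)
  · rw [hs]
    obtain ⟨S, hS, hk⟩ := hyes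
    rw [ncard_cutset] at hk
    rw [X4, r41] at c5
    rw [r31] at c4
    rcases exists_candidate hG hclosed hcov hS with ⟨y, hy, hle⟩ | ⟨P, hP, hmin, hle⟩
    · exact m5 (c4 y (by rw [hz H3]; exact y.2) hy (hk.trans hle))
    · exact c5 P hP hmin (hk.trans hle)
  · rw [hs]
    rcases s5 with h | ⟨-, h⟩
    · exact h
    · rw [r5, r41] at h
      exact absurd h hno
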